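/- Let $\alpha$ be a peak composition of $n$, that is, a finite sequence of positive integers with sum $n$ in which every part except possibly the last is greater than $1$. The diagram $D_\beta$ of a composition $\beta$ consists of left-justified boxes, with $\beta_i$ boxes in the $i$th row from the bottom; $(c,r)$ denotes the box in column $c$ (from the left) and row $r$ (from the bottom). A standard filling of $D_\beta$, for $\beta$ a composition of $n$, is a filling with entries $1,\dots,n$, each used once. For a peak composition $\beta$ of $n$, let $\mathsf{SPCT}(\beta)$ be the set of standard fillings of $D_\beta$ such that (1) entries increase from left to right in each row; (2) entries in the first column increase from bottom to top; (3) for all $k\le n$, the boxes with entries $\le k$ form the diagram of a peak composition. Let $\mathsf{SPYCT}(\beta)$ be the set of those $T\in\mathsf{SPCT}(\beta)$ which also satisfy (4) if $T(c,r)<T(c+1,r')$ for some $c$ and some $r'<r$, then $(c+1,r)$ is a box of $T$ and $T(c+1,r)<T(c+1,r')$. A row strip of a standard filling $Q$ is a maximal nonempty sequence $a,a+1,\dots,a+j-1$ of entries of $Q$ in which each entry after the first is strictly right of its predecessor in $Q$; its length is $j$. A DIRT of shape $\beta$ is a standard filling $Q$ of $D_\beta$ such that (1) entries increase from left to right in each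 row; (2) all row strips start in the first column; (3) entries in the first column increase from top to bottom; (4) if $Q(c,r)>Q(c,r')$ for some $c$ and some $r'<r$, then $(c+1,r')$ is a box of $Q$ and $Q(c,r)>Q(c+1,r')$. Its row strip shape is the composition $(\gamma_1,\dots,\gamma_k)$ of $n$ in which $\gamma_i$ is the length of the row strip starting with $\gamma_1+\cdots+\gamma_{i-1}+1$. To insert $k$ into a filling $P$, let $\overline P$ be $P$ with one extra box with entry $\infty$ at the right end of each row. Scan the boxes of $\overline P$ column by column from right to left, each column from top to bottom. At a box $(c,r)$ with $c\ge 2$ and $\overline P(c-1,r)\le k<\overline P(c,r)$: if $\overline P(c,r)=\infty$, place $k$ there as a new box and stop; otherwise replace $\overline P(c,r)$ by $k$, and continue the scan from the next box with the old value of $\overline P(c,r)$ in the role of $k$. If the scan ends without stopping, create a new row consisting only of the current $k$, in the highest position such that all first-column entries below it are smaller than $k$, shifting the higher rows up. The reading insertion of $T$ is the pair $(P,Q)$ obtained from the pair of empty fillings by inserting into $P$ the entries $k_1,\dots,k_n$ of $T$ one after another, read from left to right in each row, rows from top to bottom; after the insertion of $k_j$, the letter $j$ is placed in $Q$ in the box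 corresponding to the newly created box of $P$ (a new row in $Q$ if a new row was created in $P$). Finally, for a set $X$ of positive integers let $\mathrm{Peak}(X)=\{i\in X: i-1\notin X,\ i\ne 1\}$. For a standard filling $T$ with entries $1,\dots,n$, let $\mathrm{Peak}_\uparrow(T)=\mathrm{Peak}(\{i<n: i+1\text{ is strictly above } i\text{ in }T\})$ and $\mathrm{Peak}_\leftarrow(T)=\mathrm{Peak}(\{i<n: i+1\text{ is weakly left of } i\text{ in }T\})$. Theorem. Reading insertion is a bijection from $\mathsf{SPCT}(\alpha)$ onto the set of pairs $(P,Q)$ such that, for some peak composition $\beta$ of $n$, $P\in\mathsf{SPYCT}(\beta)$ and $Q$ is a DIRT of shape $\beta$ with row strip shape $\alpha^{\mathrm{rev}}$ (the parts of $\alpha$ in reverse order). Moreover, if $T\in\mathsf{SPCT}(\alpha)$ is mapped to $(P,Q)$, then $\mathrm{Peak}_\uparrow(T)=\mathrm{Peak}_\leftarrow(P)$. -/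

import Mathlib

namespace PeakTableaux

/-- A filling of a composition diagram by natural numbers, recorded as the list of its rows
from bottom to top, each row being the list of its entries from left to right.
Rows and columns are indexed from `0`. -/
abbrev Filling : Type := List (List ℕ)

/-- The entry of `T` in the box in column `c` and row `r` (`none` if there is no such box). -/
def entry (T : Filling) (c r : ℕ) : Option ℕ := (T[r]?).bind fun row => row[c]?

/-- `T` is a filling of the diagram of `α`: the `i`-th row from the bottom has `αᵢ` boxes. -/
def HasShape {n : ℕ} (α : Composition n) (T : Filling) : Prop :=
  T.map List.length = α.blocks

/-- The diagram of a composition, as the set of its boxes `(column, row)`. -/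
def diagram {n : ℕ} (α : Composition n) : Set (ℕ × ℕ) :=
  {b | ∃ a, α.blocks[b.2]? = some a ∧ b.1 < a}

/-- Peak compositions: all parts except possibly the last one are greater than `1`. -/
def IsPeakComposition {n : ℕ} (α : Composition n) : Prop :=
  ∀ a ∈ α.blocks.dropLast, 1 < a

/-- `T` is a filling of the diagram of `α` by `1, …, n`, each used exactly once. -/
def IsStandard {n : ℕ} (α : Composition n) (T : Filling) : Prop :=
  HasShape α T ∧ T.flatten.Perm (List.range' 1 n)

/-- Entries in each row increase from left to right. -/
def RowsIncrease (T : Filling) : Prop :=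
  ∀ c c' r x y, c < c' → entry T c r = some x → entry T c' r = some y → x < y

/-- Entries in the first column increase from bottom to top. -/
def FirstColIncreasesUp (T : Filling) : Prop :=
  ∀ r r' x y, r < r' → entry T 0 r = some x → entry T 0 r' = some y → x < y

/-- Entries in the first column increase from top to bottom. -/
def FirstColIncreasesDown (T : Filling) : Prop :=
  ∀ r r' x y, r < r' → entry T 0 r = some x → entry T 0 r' = some y → y < x

/-- For every `k ≤ n`, the boxes with entries at most `k` form the diagram of a peak
composition. -/
def PeakCondition (n : ℕ) (T : Filling) : Prop :=
  ∀ k ≤ n, ∃ (m : ℕ) (β : Composition m), IsPeakComposition β ∧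
    {b : ℕ × ℕ | ∃ x, entry T b.1 b.2 = some x ∧ x ≤ k} = diagram β

/-- If `T(c,r) < T(c+1,r')` with `r' < r`, then the box `(c+1,r)` is present and
`T(c+1,r) < T(c+1,r')`. -/
def YoungTriple (T : Filling) : Prop :=
  ∀ c r r' x y, r' < r → entry T c r = some x → entry T (c + 1) r' = some y → x < y →
    ∃ z, entry T (c + 1) r = some z ∧ z < y

/-- Standard peak composition tableaux of shape `α`. -/
def SPCT {n : ℕ} (α : Composition n) : Set Filling :=
  {T | IsStandard α T ∧ RowsIncrease T ∧ FirstColIncreasesUp T ∧ PeakCondition n T}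

/-- Standard peak Young composition tableaux of shape `α`. -/
def SPYCT {n : ℕ} (α : Composition n) : Set Filling :=
  {T | IsStandard α T ∧ RowsIncrease T ∧ FirstColIncreasesUp T ∧ PeakCondition n T ∧
    YoungTriple T}

/-- The set of `i` such that `i + 1` is strictly above `i` in `T`. -/
def desUp (T : Filling) : Set ℕ :=
  {i | ∃ c r c' r', entry T c r = some i ∧ entry T c' r' = some (i + 1) ∧ r < r'}

/-- The set of `i` such that `i + 1` is weakly left of `i` in `T`. -/
def desLeft (T : Filling) : Set ℕ :=
  {i | ∃ c r c' r', entry T c r = some i ∧ entry T c' r' = some (i + 1) ∧ c' ≤ c}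

/-- The peak set of a set of positive integers. -/
def peakSet (X : Set ℕ) : Set ℕ := {i | i ∈ X ∧ i - 1 ∉ X ∧ i ≠ 1}

/-- `Peak_↑` -/
def peakUp (T : Filling) : Set ℕ := peakSet (desUp T)

/-- `Peak_←` -/
def peakLeft (T : Filling) : Set ℕ := peakSet (desLeft T)

/-- `a` and `b` are both entries of `Q`, and `b` is strictly right of `a`. -/
def StrictlyRight (Q : Filling) (a b : ℕ) : Prop :=
  ∃ c r c' r', entry Q c r = some a ∧ entry Q c' r' = some b ∧ c < c'

/-- `a, a + 1, …, a + j - 1` is a row strip of `Q` of length `j`: a nonempty sequence of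
entries, each strictly right of the preceding one, that can be extended neither at its end nor
at its beginning. -/
def IsRowStrip (Q : Filling) (a j : ℕ) : Prop :=
  0 < j ∧ (∃ c r, entry Q c r = some a) ∧
    (∀ i, i + 1 < j → StrictlyRight Q (a + i) (a + i + 1)) ∧
    (∀ b, b + 1 = a + j → ¬ StrictlyRight Q b (b + 1)) ∧
    (∀ b, b + 1 = a → ¬ StrictlyRight Q b a)

/-- If `Q(c,r) > Q(c,r')` with `r' < r`, then the box `(c+1,r')` is present and
`Q(c,r) > Q(c+1,r')`. -/
def RecordingTriple (Q : Filling) : Prop :=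
  ∀ c r r' x y, r' < r → entry Q c r = some x → entry Q c r' = some y → y < x →
    ∃ z, entry Q (c + 1) r' = some z ∧ z < x

/-- Dual immaculate recording tableaux of shape `α`. -/
def DIRT {n : ℕ} (α : Composition n) : Set Filling :=
  {Q | IsStandard α Q ∧ RowsIncrease Q ∧
    (∀ a j, IsRowStrip Q a j → ∃ r, entry Q 0 r = some a) ∧
    FirstColIncreasesDown Q ∧ RecordingTriple Q}

/-- The filling `Q`, with entries `1, …, n`, has row strip shape `γ = (γ₁, …, γₖ)`: the row
strip that starts with `γ₁ + ⋯ + γᵢ₋₁ + 1` has length `γᵢ`. -/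
def HasRowStripShape {n : ℕ} (γ : Composition n) (Q : Filling) : Prop :=
  ∀ i : Fin γ.length, IsRowStrip Q (γ.sizeUpTo i + 1) (γ.blocksFun i)

/-- The entry in column `c` and row `r` of the augmented diagram of `T`, where each row gets an
additional box with entry `∞` at its right end. -/
def augEntry (T : Filling) (c r : ℕ) : Option (WithTop ℕ) :=
  (T[r]?).bind fun row => (row.map (fun x : ℕ => (x : WithTop ℕ)) ++ [⊤])[c]?

/-- The boxes `(column, row)` of the augmented diagram of `T`, columns from right to left and
each column from top to bottom. -/
def augBoxes (T : Filling) : List (ℕ × ℕ) :=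
  ((List.range ((T.map List.length).foldr max 0 + 1)).reverse.flatMap fun c =>
    (List.range T.length).reverse.map fun r => (c, r)).filter
      fun b => (augEntry T b.1 b.2).isSome

/-- The test `T̄(c-1,r) ≤ k < T̄(c,r)`; it fails for boxes in the first column. -/
def admits (T : Filling) (k : ℕ) : ℕ × ℕ → Bool
  | (0, _) => false
  | (c + 1, r) =>
    match augEntry T c r, augEntry T (c + 1) r with
    | some a, some b => decide (a ≤ (k : WithTop ℕ)) && decide ((k : WithTop ℕ) < b)
    | _, _ => false

/-- Location of the box created by an insertion: at the right end of the existing row `r`, or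
in a new row that gets position `r`, the rows at positions `≥ r` being shifted up by one. -/
inductive NewBox : Type
  | endOfRow (r : ℕ) : NewBox
  | newRow (r : ℕ) : NewBox

/-- Create the box `b` in `T`, with entry `k`. -/
def addBox (T : Filling) (k : ℕ) : NewBox → Filling
  | NewBox.endOfRow r => T.modify r fun row => row ++ [k]
  | NewBox.newRow r => T.insertIdx r [k]

/-- The highest position for a new row with first entry `k` such that all entries of the first
column below it are smaller than `k`. -/
def newRowPos (T : Filling) (k : ℕ) : ℕ :=
  (T.takeWhile fun row => row.head?.all fun x => decide (x < k)).length

/-- Insertion of `k` into `T`, where only the listed boxes are scanned, in the given order.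
Returns the resulting filling and the location of the created box. -/
def insertScan : List (ℕ × ℕ) → Filling → ℕ → Filling × NewBox
  | [], T, k => (addBox T k (NewBox.newRow (newRowPos T k)), NewBox.newRow (newRowPos T k))
  | (c, r) :: bs, T, k =>
    if admits T k (c, r) then
      match entry T c r with
      | none => (addBox T k (NewBox.endOfRow r), NewBox.endOfRow r)
      | some y => insertScan bs (T.modify r fun row => row.set c k) y
    else insertScan bs T k

/-- Allen–Hallam–Mason insertion of `k` into `T`. -/
def insertEntry (T : Filling) (k : ℕ) : Filling × NewBox := insertScan (augBoxes T) T k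

/-- The reading word: rows from top to bottom, each row from left to right. -/
def readingWord (T : Filling) : List ℕ := T.reverse.flatten

/-- One step of reading insertion: insert the letter `kj.1` into `P`, and put the index `kj.2`
into the box of `Q` that corresponds to the created box. -/
def readingStep (PQ : Filling × Filling) (kj : ℕ × ℕ) : Filling × Filling :=
  ((insertEntry PQ.1 kj.1).1, addBox PQ.2 kj.2 (insertEntry PQ.1 kj.1).2)

/-- Reading insertion `T ↦ (P, Q)`; the letters of the reading word are numbered from `1`. -/
def readingInsertion (T : Filling) : Filling × Filling :=
  ((readingWord T).zipIdx 1).foldl readingStep ([], [])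

/-- Pairs `(P, Q)` of the same (peak) shape, `P` a standard peak Young composition tableau, `Q`
a dual immaculate recording tableau with row strip shape `γ`. -/
def tableauPairs {n : ℕ} (γ : Composition n) : Set (Filling × Filling) :=
  {PQ | ∃ β : Composition n, IsPeakComposition β ∧ PQ.1 ∈ SPYCT β ∧ PQ.2 ∈ DIRT β ∧
    HasRowStripShape γ PQ.2}

end PeakTableaux

/-! Reading insertion is a correspondence of Robinson–Schensted type, and the proof rests on four
properties of the insertion of a single letter.

Reversibility. With the value ⊤ outside the diagram, an insertion is a series of exchanges between a
letter in hand and the boxes of an array, visited in a fixed order. The invariant `Ready` says that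
the array satisfies the triple condition, that the letter is new, and that none of the last `R`
visited boxes admits it, where `R` is the number of rows. Under this invariant each exchange can be
undone as long as the letter is finite. Hence insertion is inverse to the removal of a box that ends
the lowest row of its length (`exists_insertEntry_eq`, `insertEntry_injective`). The largest entry
of a recording filling sits in exactly such a box, with the further restriction that a row of its
own is the bottom row (`Recording.add`, `Recording.remove`). Therefore the words in which a letter
creates a row only when it is smaller than all letters before it (`Proper`) correspond bijectively
to pairs of a Young composition tableau and a recording filling of the same shape (`exists_proper`,
`rsk_injective`).

Row bumping. After an insertion that creates no row, a larger letter ends strictly right of the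
previous new box and a smaller one ends weakly left of it (`colAt_lt_colAt`, `colAt_le_colAt`). So
increasing runs of the word turn into row strips of the recording filling.

The peak condition. It only concerns the first two columns (`PeakCols`). Read from the top, the rows
of a standard peak composition tableau are increasing words whose first letter is below all earlier
letters, as is the second letter from the second row on (`RowOK`). `RowOK.spec` and `StripOK.rowOK`
show that, for words cut into rows of the prescribed lengths, this is equivalent to the peak
condition on `P` together with the row strip condition on `Q`.

Descents. Once both `i` and `i + 1` are present, an insertion never changes whether `i + 1` is
weakly left of `i`, because no integer lies between them (`KeepsLeft`, `KeepsRight`). Which case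
occurs depends on the order of the two letters in the word, that is, on whether `i + 1` is strictly
above `i` in `T`. Thus even the descent sets agree, not only their peaks. -/

namespace PeakTableaux

/-! ### Young arrays and the exchange of a single entry -/

section

/-- A filling viewed as a function of column and row, with value `⊤` outside the diagram. -/
abbrev Arr : Type := ℕ → ℕ → WithTop ℕ

/-- Replace the value in column `c` and row `r`. -/
def setAt (V : Arr) (c r : ℕ) (k : WithTop ℕ) : Arr :=
  fun c' r' => if c' = c ∧ r' = r then k else V c' r'

/-- The array form of (standard) Young composition tableaux with distinct entries. -/
structure YoungArr (V : Arr) : Prop where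
  row : ∀ c r, V (c + 1) r = ⊤ ∨ V c r < V (c + 1) r
  col : ∀ r r', r < r' → V 0 r' = ⊤ ∨ V 0 r < V 0 r'
  triple : ∀ c r r', r' < r → V c r < V (c + 1) r' → V (c + 1) r ≤ V (c + 1) r'
  inj : ∀ c r c' r', V c r = V c' r' → V c r = ⊤ ∨ (c = c' ∧ r = r')

/-- The letter `k` may enter column `c + 1` in row `r`. -/
def Admits (V : Arr) (k : WithTop ℕ) (c r : ℕ) : Prop := V c r ≤ k ∧ k < V (c + 1) r

/-- The letter `k` is finite only if it does not occur in `V`. -/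
def Fresh (V : Arr) (k : WithTop ℕ) : Prop := ∀ c r, V c r = k → k = ⊤

variable {V : Arr} {k : WithTop ℕ} {c r : ℕ}

/-- Lowering one entry can violate the triple condition in two ways. Compared with a row above, the
new entry may be too small, which `J` excludes. Compared with a row below, it may newly be smaller
than an entry of the next column; then `K` puts `k` below the entry of that row in column `c + 1`,
and the triple condition one column to the left finishes the argument. -/
theorem YoungArr.bump (h : YoungArr V) (hk : Fresh V k)
    (J : ∀ r', r < r' → ¬ Admits V k c r') (K : ∀ r', r' ≤ r → ¬ Admits V k (c + 1) r')
    (ha : Admits V k c r) : YoungArr (setAt V (c + 1) r k) := by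
  obtain ⟨h1, h2, h3, h4⟩ := h
  obtain ⟨ha1, ha2⟩ := ha
  unfold Admits at J K
  unfold Fresh at hk
  constructor
  · intro c' r'
    have := h1 c' r'
    have := h1 (c + 1) r
    have := hk c r
    simp only [setAt]
    grind
  · intro r' r'' hr
    have := h2 r' r'' hr
    simp [setAt]
    grind
  · intro c' r1 r2 hr hlt
    simp only [setAt] at *
    have e1 := h3 c' r1 r2 hr
    have e2 := J r1
    have e3 := K r2
    have e4 := h3 c r r2
    have e5 := h1 (c + 1) r2
    have e6 : V (c + 1 + 1) r1 ≤ ⊤ := le_top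
    grind
  · intro c1 r1 c2 r2
    have := h4 c1 r1 c2 r2
    have := hk c1 r1
    have := hk c2 r2
    simp only [setAt]
    grind

theorem Fresh.bump (h : YoungArr V) (ha : Admits V k c r) :
    Fresh (setAt V (c + 1) r k) (V (c + 1) r) := by
  obtain ⟨ha1, ha2⟩ := ha
  intro c1 r1
  have := h.inj c1 r1 (c + 1) r
  simp only [setAt]
  grind

/-- With `not_admits_before` this moves the window of rejecting boxes one step on for the new letter
in hand. For rows above `r` it is the triple condition of the old array; in row `r` the box now
holds a smaller entry than the letter. -/
theorem not_admits_after (h : YoungArr V) (J : ∀ r', r < r' → ¬ Admits V k c r')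
    (ha : Admits V k c r) (r' : ℕ) (hr : r ≤ r') :
    ¬ Admits (setAt V (c + 1) r k) (V (c + 1) r) c r' := by
  have := J r'
  have := h.triple c r' r
  have := h.inj c r' (c + 1) r
  have : V (c + 1) r' ≤ ⊤ := le_top
  unfold Admits setAt at *
  grind

theorem not_admits_before (h : YoungArr V)
    (K : ∀ r', r' ≤ r → ¬ Admits V k (c + 1) r')
    (ha : Admits V k c r) (r' : ℕ) (hr : r' < r) :
    ¬ Admits (setAt V (c + 1) r k) (V (c + 1) r) (c + 1) r' := by
  have := K r' hr.le
  have := h.triple c r r'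
  have := h.inj (c + 1) r' (c + 1) r
  have : V (c + 2) r' ≤ ⊤ := le_top
  unfold Admits setAt at *
  grind

/-! ### The inverse step -/

/-- Mirror image of `YoungArr.bump`: the entry is raised. Rows above are controlled by `J`; for rows
below, `K` together with the triple condition in columns `c + 1` and `c + 2` would contradict that
`k` is smaller than the right neighbour. -/
theorem YoungArr.unbump (h : YoungArr V) (hk : Fresh V k)
    (J : ∀ r', r ≤ r' → ¬ Admits V k c r') (K : ∀ r', r' < r → ¬ Admits V k (c + 1) r')
    (ha : Admits V k (c + 1) r) : YoungArr (setAt V (c + 1) r k) := by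
  obtain ⟨h1, h2, h3, h4⟩ := h
  obtain ⟨ha1, ha2⟩ := ha
  unfold Admits at J K
  unfold Fresh at hk
  constructor
  · intro c' r'
    have := h1 c' r'
    have := h1 (c + 1) r
    have := hk (c + 1) r
    simp only [setAt]
    grind
  · intro r' r'' hr
    have := h2 r' r'' hr
    simp [setAt]
    grind
  · intro c' r1 r2 hr hlt
    simp only [setAt] at *
    have e1 := h3 c' r1 r2 hr
    have e2 := J r1
    have e3 := K r2
    have e4 := h3 (c + 1) r r2
    have e5 := h1 (c + 1) r2
    have e7 := hk (c + 1) r2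
    have e6 : V (c + 1 + 1) r1 ≤ ⊤ := le_top
    grind
  · intro c1 r1 c2 r2
    have := h4 c1 r1 c2 r2
    have := hk c1 r1
    have := hk c2 r2
    simp only [setAt]
    grind

theorem Fresh.unbump (h : YoungArr V) (hk : Fresh V k) (ha : Admits V k (c + 1) r) :
    Fresh (setAt V (c + 1) r k) (V (c + 1) r) := by
  obtain ⟨ha1, ha2⟩ := ha
  intro c1 r1
  have := h.inj c1 r1 (c + 1) r
  have := hk (c + 1) r
  simp only [setAt]
  grind

theorem not_admits_unbump_after (h : YoungArr V) (J : ∀ r', r ≤ r' → ¬ Admits V k c r')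
    (ha : Admits V k (c + 1) r) (r' : ℕ) (hr : r < r') :
    ¬ Admits (setAt V (c + 1) r k) (V (c + 1) r) c r' := by
  have := J r'
  have := h.triple c r' r
  have := h.inj c r' (c + 1) r
  unfold Admits setAt at *
  grind

theorem not_admits_unbump_before (h : YoungArr V) (hk : Fresh V k)
    (K : ∀ r', r' < r → ¬ Admits V k (c + 1) r')
    (ha : Admits V k (c + 1) r) (r' : ℕ) (hr : r' ≤ r) :
    ¬ Admits (setAt V (c + 1) r k) (V (c + 1) r) (c + 1) r' := by
  have := K r'
  have := h.triple (c + 1) r r'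
  have := hk (c + 1) r
  have : V (c + 2) r ≤ ⊤ := le_top
  unfold Admits setAt at *
  grind

/-! ### Removing and adding boxes -/

/-- Removing the last box of the lowest row of its length. -/
theorem YoungArr.remove (h : YoungArr V) (hr : V (c + 1) r ≠ ⊤) (hr' : V (c + 2) r = ⊤)
    (hlow : ∀ r', r' < r → V (c + 1) r' ≠ ⊤ → V (c + 2) r' ≠ ⊤) :
    YoungArr (setAt V (c + 1) r ⊤) := by
  obtain ⟨h1, h2, h3, h4⟩ := h
  constructor
  · intro c' r'
    have := h1 c' r'
    have := h1 (c + 1) r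
    simp only [setAt]
    grind
  · intro r' r'' hr
    have := h2 r' r'' hr
    simp [setAt]
    grind
  · intro c' r1 r2 hr hlt
    simp only [setAt] at *
    have e1 := h3 c' r1 r2 hr
    have e4 := h3 (c + 1) r1 r2
    have e5 := h1 (c + 1) r2
    have e6 : V (c + 1) r1 ≤ ⊤ := le_top
    have e7 := hlow r2
    have e8 : V (c + 2) r2 ≤ ⊤ := le_top
    grind
  · intro c1 r1 c2 r2
    have := h4 c1 r1 c2 r2
    simp only [setAt]
    grind

/-- Along with `YoungArr.remove` and the next two lemmas, this shows that the state with the removed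
entry in hand satisfies the scanning invariant, so that the insertion can be run backwards from it.
-/
theorem not_admits_remove_after (h : YoungArr V) (r' : ℕ) (hr : r < r') :
    ¬ Admits (setAt V (c + 1) r ⊤) (V (c + 1) r) c r' := by
  have := h.triple c r' r
  have := h.inj c r' (c + 1) r
  have : V (c + 1) r' ≤ ⊤ := le_top
  unfold Admits setAt at *
  grind

theorem not_admits_remove_before (h : YoungArr V) (hr' : V (c + 2) r = ⊤)
    (hlow : ∀ r', r' < r → V (c + 1) r' ≠ ⊤ → V (c + 2) r' ≠ ⊤) (r' : ℕ) (hr : r' ≤ r) :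
    ¬ Admits (setAt V (c + 1) r ⊤) (V (c + 1) r) (c + 1) r' := by
  have := h.triple (c + 1) r r'
  have := h.inj (c + 1) r' (c + 1) r
  have := hlow r'
  have : V (c + 2) r' ≤ ⊤ := le_top
  unfold Admits setAt at *
  grind

theorem Fresh.remove (h : YoungArr V) : Fresh (setAt V (c + 1) r ⊤) (V (c + 1) r) := by
  intro c1 r1
  have := h.inj c1 r1 (c + 1) r
  simp only [setAt]
  grind

/-- The row that receives a new box is the lowest one of its new length. -/
theorem lowest_of_admits (h : YoungArr V)
    (K : ∀ r', r' ≤ r → ¬ Admits V k (c + 1) r') (ha : Admits V k c r) (htop : V (c + 1) r = ⊤)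
    (r' : ℕ) (hr : r' < r) (hr' : V (c + 1) r' ≠ ⊤) : V (c + 2) r' ≠ ⊤ := by
  have := K r' hr.le
  have := h.triple c r r'
  unfold Admits at *
  have : V (c + 1) r' ≤ ⊤ := le_top
  grind

/-- Insert a row with the single entry `k` at position `p`. -/
def insRow (V : Arr) (p : ℕ) (k : WithTop ℕ) : Arr :=
  fun c r => if r < p then V c r else if r = p then (if c = 0 then k else ⊤) else V c (r - 1)

theorem YoungArr.insRow {p : ℕ} (h : YoungArr V) (hk : Fresh V k) (hk' : k ≠ ⊤)
    (J : ∀ r, ¬ Admits V k 0 r) (hp : ∀ r, r < p → V 0 r < k) (hp' : ∀ r, p ≤ r → k < V 0 r) :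
    YoungArr (insRow V p k) := by
  obtain ⟨h1, h2, h3, h4⟩ := h
  unfold Admits at J
  constructor
  · intro c' r'
    have := h1 c' r'
    have := h1 c' (r' - 1)
    simp only [PeakTableaux.insRow]
    grind
  · intro r' r'' hr
    have := h2 r' r''
    have := h2 (r' - 1) (r'' - 1)
    have := h2 r' (r'' - 1)
    have := hp r'
    have := hp' (r'' - 1)
    simp [PeakTableaux.insRow]
    grind
  · intro c' r1 r2 hr
    have := h3 c' r1 r2
    have := h3 c' (r1 - 1) (r2 - 1)
    have := h3 c' (r1 - 1) r2
    have := J r2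
    have := hp r2
    have : V (c' + 1) r1 ≤ ⊤ := le_top
    have : V (c' + 1) r2 ≤ ⊤ := le_top
    have : V (c' + 1) (r1 - 1) ≤ ⊤ := le_top
    simp [PeakTableaux.insRow]
    grind
  · intro c1 r1 c2 r2
    have := h4 c1 r1 c2 r2
    have := h4 c1 (r1 - 1) c2 (r2 - 1)
    have := h4 c1 r1 c2 (r2 - 1)
    have := h4 c1 (r1 - 1) c2 r2
    have := hk c1 r1
    have := hk c1 (r1 - 1)
    have := hk c2 r2
    have := hk c2 (r2 - 1)
    simp [PeakTableaux.insRow]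
    grind

/-- Delete the row at position `p`. -/
def delRow (V : Arr) (p : ℕ) : Arr := fun c r => if r < p then V c r else V c (r + 1)

theorem YoungArr.delRow (h : YoungArr V) (p : ℕ) : YoungArr (delRow V p) := by
  obtain ⟨h1, h2, h3, h4⟩ := h
  constructor
  · intro c' r'
    have := h1 c' r'
    have := h1 c' (r' + 1)
    simp only [PeakTableaux.delRow]
    grind
  · intro r' r'' hr
    have := h2 r' r''
    have := h2 (r' + 1) (r'' + 1)
    have := h2 r' (r'' + 1)
    simp [PeakTableaux.delRow]
    grind
  · intro c' r1 r2 hr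
    have := h3 c' r1 r2
    have := h3 c' (r1 + 1) (r2 + 1)
    have := h3 c' (r1 + 1) r2
    simp [PeakTableaux.delRow]
    grind
  · intro c1 r1 c2 r2
    have := h4 c1 r1 c2 r2
    have := h4 c1 (r1 + 1) c2 (r2 + 1)
    have := h4 c1 r1 c2 (r2 + 1)
    have := h4 c1 (r1 + 1) c2 r2
    simp [PeakTableaux.delRow]
    grind

theorem Fresh.delRow {p : ℕ} (h : YoungArr V) : Fresh (delRow V p) (V 0 p) := by
  intro c1 r1
  have := h.inj c1 r1 0 p
  have := h.inj c1 (r1 + 1) 0 p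
  simp only [PeakTableaux.delRow]
  grind

/-- A row below `p` that admits the removed letter would, by the triple condition, have an empty
second box, which `hlow` forbids. The rows above start with larger entries. -/
theorem not_admits_delRow {p : ℕ} (h : YoungArr V) (hp : V 1 p = ⊤)
    (hlow : ∀ r, r < p → V 1 r ≠ ⊤) (r : ℕ) :
    ¬ Admits (delRow V p) (V 0 p) 0 r := by
  have := h.triple 0 p r
  have := h.col p (r + 1)
  have := hlow r
  have : V 1 r ≤ ⊤ := le_top
  have : V 1 (r + 1) ≤ ⊤ := le_top
  have := h.row 0 (r + 1)
  simp only [PeakTableaux.delRow, Admits]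
  grind

end

/-! ### The scan as a sequence of reversible exchanges -/

section

instance (V : Arr) (k : WithTop ℕ) (c r : ℕ) : Decidable (Admits V k c r) :=
  inferInstanceAs (Decidable (_ ∧ _))

/-- The scanning state: an array and the letter in hand. -/
abbrev State : Type := Arr × WithTop ℕ

/-- Exchange the letter in hand with the entry in column `c` and row `r`. -/
def State.swap (s : State) (c r : ℕ) : State := (setAt s.1 c r s.2, s.1 c r)

/-- Scan the box with index `p` among `R` rows, which lies in column `p / R + 1`. -/
def bumpAt (R p : ℕ) (s : State) : State :=
  if Admits s.1 s.2 (p / R) (p % R) then s.swap (p / R + 1) (p % R) else s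

/-- The inverse of `bumpAt`. -/
def unbumpAt (R p : ℕ) (s : State) : State :=
  if Admits s.1 s.2 (p / R + 1) (p % R) then s.swap (p / R + 1) (p % R) else s

/-- The scanning invariant: none of the `R` boxes scanned last admits the letter in hand. -/
structure Ready (R p : ℕ) (s : State) : Prop where
  young : YoungArr s.1
  fresh : Fresh s.1 s.2
  window : ∀ c r, r < R → p ≤ c * R + r → c * R + r < p + R → ¬ Admits s.1 s.2 c r
  top : ∀ c r, R ≤ r → s.1 c r = ⊤

theorem index_div_mod {R : ℕ} (p : ℕ) : p / R * R + p % R = p := by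
  rw [mul_comm]; exact Nat.div_add_mod p R

/-- A window of `R` consecutive indices wraps around once: it runs through the top part of one
column and the bottom part of the column to its right. -/
theorem window_iff {R c r c' r' : ℕ} (hr : r < R) (hr' : r' < R) :
    c * R + r ≤ c' * R + r' ∧ c' * R + r' < c * R + r + R ↔
      (c' = c ∧ r ≤ r') ∨ (c' = c + 1 ∧ r' < r) := by
  constructor
  · rintro ⟨h1, h2⟩
    rcases lt_trichotomy c' c with h | h | h
    · have : (c' + 1) * R ≤ c * R := Nat.mul_le_mul_right _ h
      rw [add_mul] at this
      omega
    · subst h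
      left; omega
    · have h3 : (c + 1) * R ≤ c' * R := Nat.mul_le_mul_right _ h
      rcases Nat.lt_or_ge c' (c + 2) with h4 | h4
      · have : c' = c + 1 := by omega
        subst this
        right
        rw [add_mul] at *
        omega
      · have : (c + 2) * R ≤ c' * R := Nat.mul_le_mul_right _ h4
        rw [add_mul] at this
        omega
  · rintro (⟨rfl, h⟩ | ⟨rfl, h⟩)
    · omega
    · rw [add_mul]; omega

theorem window_succ_iff {R c r c' r' : ℕ} (hr : r < R) (hr' : r' < R) :
    c * R + r + 1 ≤ c' * R + r' ∧ c' * R + r' < c * R + r + 1 + R ↔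
      (c' = c ∧ r < r') ∨ (c' = c + 1 ∧ r' ≤ r) := by
  constructor
  · rintro ⟨h1, h2⟩
    by_cases h3 : c' * R + r' < c * R + r + R
    · rcases (window_iff hr hr').1 ⟨by omega, h3⟩ with ⟨rfl, h⟩ | ⟨rfl, h⟩
      · left; omega
      · right; omega
    · have h4 : c' * R + r' = (c + 1) * R + r := by rw [add_mul]; omega
      rcases (window_iff hr hr').1 ⟨h4.ge, by omega⟩ with ⟨rfl, h⟩ | ⟨rfl, h⟩
      · right; omega
      · rw [add_mul] at h4; rw [add_mul] at h4; omega
  · rintro (⟨rfl, h⟩ | ⟨rfl, h⟩)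
    · omega
    · rw [add_mul]; omega

variable {R p : ℕ} {s : State}

theorem ready_succ_iff (hR : 0 < R) : Ready R (p + 1) s ↔ YoungArr s.1 ∧ Fresh s.1 s.2 ∧
    (∀ r', p % R < r' → ¬ Admits s.1 s.2 (p / R) r') ∧
    (∀ r', r' ≤ p % R → ¬ Admits s.1 s.2 (p / R + 1) r') ∧ (∀ c r, R ≤ r → s.1 c r = ⊤) := by
  have hm := Nat.mod_lt p hR
  have hp := index_div_mod (R := R) p
  constructor
  · rintro ⟨h1, h2, h3, h4⟩
    refine ⟨h1, h2, fun r' hr => ?_, fun r' hr => ?_, h4⟩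
    · by_cases hr' : r' < R
      · have := (window_succ_iff (c := p / R) (c' := p / R) hm hr').2 (Or.inl ⟨rfl, hr⟩)
        rw [hp] at this
        exact h3 _ _ hr' this.1 this.2
      · rintro ⟨ha, hb⟩
        rw [h4 _ _ (not_lt.1 hr')] at ha
        exact absurd (ha.trans_lt hb) (not_lt.2 le_top)
    · have := (window_succ_iff (c := p / R) (c' := p / R + 1) hm (hr.trans_lt hm)).2
        (Or.inr ⟨rfl, hr⟩)
      rw [hp] at this
      exact h3 _ _ (hr.trans_lt hm) this.1 this.2
  · rintro ⟨h1, h2, h3, h4, h5⟩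
    refine ⟨h1, h2, fun c r hr ha hb => ?_, h5⟩
    rcases (window_succ_iff (c := p / R) (c' := c) hm hr).1
      (by rw [hp]; exact ⟨ha, hb⟩) with ⟨rfl, h⟩ | ⟨rfl, h⟩
    · exact h3 _ h
    · exact h4 _ h

theorem ready_iff (hR : 0 < R) : Ready R p s ↔ YoungArr s.1 ∧ Fresh s.1 s.2 ∧
    (∀ r', p % R ≤ r' → ¬ Admits s.1 s.2 (p / R) r') ∧
    (∀ r', r' < p % R → ¬ Admits s.1 s.2 (p / R + 1) r') ∧ (∀ c r, R ≤ r → s.1 c r = ⊤) := by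
  have hm := Nat.mod_lt p hR
  have hp := index_div_mod (R := R) p
  constructor
  · rintro ⟨h1, h2, h3, h4⟩
    refine ⟨h1, h2, fun r' hr => ?_, fun r' hr => ?_, h4⟩
    · by_cases hr' : r' < R
      · have := (window_iff (c := p / R) (c' := p / R) hm hr').2 (Or.inl ⟨rfl, hr⟩)
        rw [hp] at this
        exact h3 _ _ hr' this.1 this.2
      · rintro ⟨ha, hb⟩
        rw [h4 _ _ (not_lt.1 hr')] at ha
        exact absurd (ha.trans_lt hb) (not_lt.2 le_top)
    · have := (window_iff (c := p / R) (c' := p / R + 1) hm (hr.trans hm)).2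
        (Or.inr ⟨rfl, hr⟩)
      rw [hp] at this
      exact h3 _ _ (hr.trans hm) this.1 this.2
  · rintro ⟨h1, h2, h3, h4, h5⟩
    refine ⟨h1, h2, fun c r hr ha hb => ?_, h5⟩
    rcases (window_iff (c := p / R) (c' := c) hm hr).1
      (by rw [hp]; exact ⟨ha, hb⟩) with ⟨rfl, h⟩ | ⟨rfl, h⟩
    · exact h3 _ h
    · exact h4 _ h

theorem Ready.bumpAt (hR : 0 < R) (h : Ready R (p + 1) s) : Ready R p (bumpAt R p s) := by
  obtain ⟨h1, h2, J, K, h5⟩ := (ready_succ_iff hR).1 h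
  have hm := Nat.mod_lt p hR
  rw [ready_iff hR, PeakTableaux.bumpAt]
  split_ifs with ha
  · refine ⟨h1.bump h2 J K ha, Fresh.bump h1 ha, not_admits_after h1 J ha,
      not_admits_before h1 K ha, fun c r hr => ?_⟩
    have : r ≠ p % R := by omega
    simp [State.swap, setAt, this, h5 c r hr]
  · refine ⟨h1, h2, fun r' hr => ?_, fun r' hr => K r' hr.le, h5⟩
    rcases hr.eq_or_lt with rfl | hr
    · exact ha
    · exact J r' hr

theorem Ready.unbumpAt (hR : 0 < R) (h : Ready R p s) : Ready R (p + 1) (unbumpAt R p s) := by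
  obtain ⟨h1, h2, J, K, h5⟩ := (ready_iff hR).1 h
  have hm := Nat.mod_lt p hR
  rw [ready_succ_iff hR, PeakTableaux.unbumpAt]
  split_ifs with ha
  · refine ⟨h1.unbump h2 J K ha, Fresh.unbump h1 h2 ha, not_admits_unbump_after h1 J ha,
      not_admits_unbump_before h1 h2 K ha, fun c r hr => ?_⟩
    have : r ≠ p % R := by omega
    simp [State.swap, setAt, this, h5 c r hr]
  · refine ⟨h1, h2, fun r' hr => J r' hr.le, fun r' hr => ?_, h5⟩
    rcases hr.eq_or_lt with rfl | hr
    · exact ha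
    · exact K r' hr

theorem State.swap_swap (s : State) (c r : ℕ) : (s.swap c r).swap c r = s := by
  refine Prod.ext ?_ ?_
  · funext c' r'
    simp only [State.swap, setAt]
    grind
  · simp [State.swap, setAt]

/-- If an exchange took place, the box holds the larger of the two values and its left neighbour is
below the smaller one, so the box admits the letter in hand. If none took place, the invariant says
that the box rejects the letter. -/
theorem bumpAt_unbumpAt (hR : 0 < R) (h : Ready R p s) : bumpAt R p (unbumpAt R p s) = s := by
  obtain ⟨h1, h2, J, K, h5⟩ := (ready_iff hR).1 h
  have hJ := J _ le_rfl
  have e1 := h1.row (p / R) (p % R)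
  have e3 : s.1 (p / R + 1 + 1) (p % R) ≤ ⊤ := le_top
  have e2 := h2 (p / R + 1) (p % R)
  unfold bumpAt unbumpAt
  split_ifs with ha hb
  · exact s.swap_swap _ _
  · exfalso
    simp only [State.swap, setAt, Admits] at *
    grind
  · rfl

/-- The proviso excludes the exchange that ends an insertion at an empty box: with ⊤ in hand
`unbumpAt` never acts. -/
theorem unbumpAt_bumpAt (hR : 0 < R) (h : Ready R (p + 1) s) (hk : (bumpAt R p s).2 ≠ ⊤) :
    unbumpAt R p (bumpAt R p s) = s := by
  obtain ⟨h1, h2, J, K, h5⟩ := (ready_succ_iff hR).1 h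
  have hK := K _ le_rfl
  have e1 := h1.row (p / R + 1) (p % R)
  have e3 : s.1 (p / R + 1) (p % R) ≤ ⊤ := le_top
  unfold bumpAt unbumpAt at *
  split_ifs at * with ha hb
  · exact s.swap_swap _ _
  · exfalso
    simp only [State.swap, setAt, Admits] at *
    grind
  · rfl

/-- The state reached from `s` when the boxes with indices `p + j - 1, …, p` are scanned. -/
def scanDown (R : ℕ) : ℕ → ℕ → State → State
  | 0, _, s => s
  | j + 1, p, s => bumpAt R p (scanDown R j (p + 1) s)

/-- The state reached from `s` when the boxes with indices at least `p` and below `N` are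
scanned. -/
def trace (R N : ℕ) (s : State) (p : ℕ) : State := scanDown R (N - p) p s

theorem trace_of_le {N : ℕ} (s : State) (h : N ≤ p) : trace R N s p = s := by
  simp [trace, Nat.sub_eq_zero_of_le h, scanDown]

theorem trace_of_lt {N : ℕ} (s : State) (h : p < N) :
    trace R N s p = bumpAt R p (trace R N s (p + 1)) := by
  have : N - p = (N - (p + 1)) + 1 := by omega
  rw [trace, this, scanDown, trace]

theorem bumpAt_top {V : Arr} : bumpAt R p (V, ⊤) = (V, ⊤) := by
  simp [bumpAt, Admits]

theorem snd_le_bumpAt : s.2 ≤ (bumpAt R p s).2 := by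
  unfold bumpAt
  split_ifs with h
  · exact h.2.le
  · exact le_rfl

theorem ready_trace {N : ℕ} (hR : 0 < R) (h : Ready R N s) (hp : p ≤ N) :
    Ready R p (trace R N s p) := by
  induction hp using Nat.decreasingInduction with
  | self => rwa [trace_of_le s le_rfl]
  | of_succ k hk ih =>
    rw [trace_of_lt s hk]
    exact ih.bumpAt hR

/-- Every ready state is reached by a scan from a ready state. -/
theorem exists_trace_eq {N : ℕ} (hR : 0 < R) (hp : p ≤ N) (h : Ready R p s) :
    ∃ s', Ready R N s' ∧ trace R N s' p = s := by
  revert s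
  induction hp using Nat.decreasingInduction with
  | self => exact fun {s} h => ⟨s, h, trace_of_le s le_rfl⟩
  | of_succ k hk ih =>
    intro s h
    obtain ⟨s', h1, h2⟩ := ih (h.unbumpAt hR)
    exact ⟨s', h1, by rw [trace_of_lt _ hk, h2, bumpAt_unbumpAt hR h]⟩

theorem trace_injective {N : ℕ} (hR : 0 < R) {s' : State} (h : Ready R N s) (h' : Ready R N s')
    (hp : p ≤ N) (hk : (trace R N s p).2 ≠ ⊤) (he : trace R N s p = trace R N s' p) :
    s = s' := by
  induction hp using Nat.decreasingInduction with
  | self => simpa [trace_of_le] using he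
  | of_succ k hkN ih =>
    have hk' := hk
    rw [he] at hk'
    rw [trace_of_lt _ hkN] at hk he hk'
    rw [trace_of_lt _ hkN] at he
    have e1 := unbumpAt_bumpAt hR (ready_trace hR h hkN) hk
    have e2 := unbumpAt_bumpAt hR (ready_trace hR h' hkN) hk'
    refine ih (fun hh => hk ?_) ?_
    · exact top_le_iff.1 (hh ▸ snd_le_bumpAt)
    · rw [← e1, he, e2]

theorem bumpAt_col_zero (r : ℕ) : (bumpAt R p s).1 0 r = s.1 0 r := by
  unfold bumpAt
  split_ifs <;> simp [State.swap, setAt]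

theorem index_div {c r : ℕ} (hr : r < R) : (c * R + r) / R = c := by
  rw [mul_comm, Nat.mul_add_div (by omega), Nat.div_eq_of_lt hr, add_zero]

theorem index_mod {c r : ℕ} (hr : r < R) : (c * R + r) % R = r := by
  rw [mul_comm, Nat.mul_add_mod, Nat.mod_eq_of_lt hr]

theorem bumpAt_of_ne {c r : ℕ} (h : c * R + r ≠ p) :
    (bumpAt R p s).1 (c + 1) r = s.1 (c + 1) r := by
  unfold bumpAt
  split_ifs
  · have : ¬ (c = p / R ∧ r = p % R) := by
      rintro ⟨rfl, rfl⟩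
      exact h (index_div_mod p)
    simp only [State.swap, setAt]
    grind
  · rfl

theorem trace_col_zero {N : ℕ} (hp : p ≤ N) (r : ℕ) : (trace R N s p).1 0 r = s.1 0 r := by
  induction hp using Nat.decreasingInduction with
  | self => rw [trace_of_le s le_rfl]
  | of_succ k hk ih => rw [trace_of_lt s hk, bumpAt_col_zero, ih]

theorem trace_entry_eq {N q c r : ℕ} (hq : q ≤ p) (hp : p ≤ N)
    (h : c * R + r < q ∨ p ≤ c * R + r) :
    (trace R N s q).1 (c + 1) r = (trace R N s p).1 (c + 1) r := by
  induction hq using Nat.decreasingInduction with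
  | self => rfl
  | of_succ k hk ih =>
    rw [trace_of_lt s (by omega), bumpAt_of_ne (by omega), ih (by omega)]

/-- The effect of a scan in terms of the initial array `A`, the final array `B`, and the letter
`a p` in hand after scanning the box with index `p`. -/
structure Scan (R N : ℕ) (A B : Arr) (a : ℕ → WithTop ℕ) : Prop where
  col_zero : ∀ r, B 0 r = A 0 r
  outside : ∀ c r, R ≤ r ∨ N ≤ c * R + r → B (c + 1) r = A (c + 1) r
  swap : ∀ c r, r < R → c * R + r < N → Admits A (a (c * R + r + 1)) c r →
    B (c + 1) r = a (c * R + r + 1) ∧ a (c * R + r) = A (c + 1) r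
  skip : ∀ c r, r < R → c * R + r < N → ¬ Admits A (a (c * R + r + 1)) c r →
    B (c + 1) r = A (c + 1) r ∧ a (c * R + r) = a (c * R + r + 1)

/-- For positive `c` the box in column `c` and row `r` has index `c * R + r - R`, so the bound says
that it has not been scanned yet. -/
theorem trace_initial {N c r : ℕ} (hp : p ≤ N) (h : c * R + r < p + R) :
    (trace R N s p).1 c r = s.1 c r := by
  cases c with
  | zero => exact trace_col_zero hp r
  | succ c =>
    rw [trace_entry_eq hp le_rfl (by rw [add_mul] at h; omega), trace_of_le s le_rfl]

/-- The test at a box reads the box and its left neighbour, both still untouched at that moment.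
Hence each decision depends only on the initial array and on the letter in hand. -/
theorem scan_trace {N : ℕ} (hR : 0 < R) :
    Scan R N s.1 (trace R N s 0).1 (fun p => (trace R N s p).2) := by
  have key : ∀ c r, r < R → c * R + r < N →
      trace R N s (c * R + r) = if Admits s.1 (trace R N s (c * R + r + 1)).2 c r then
        (trace R N s (c * R + r + 1)).swap (c + 1) r else trace R N s (c * R + r + 1) := by
    intro c r hr hN
    rw [trace_of_lt s hN, bumpAt, index_div hr, index_mod hr]
    refine if_congr ?_ rfl rfl
    rw [Admits, Admits, trace_initial hN (by omega), trace_initial hN (by rw [add_mul]; omega)]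
  have hfin : ∀ c r, c * R + r < N →
      (trace R N s 0).1 (c + 1) r = (trace R N s (c * R + r)).1 (c + 1) r := by
    intro c r hN
    exact trace_entry_eq (Nat.zero_le _) hN.le (Or.inr le_rfl)
  refine ⟨fun r => trace_col_zero (Nat.zero_le _) r, ?_, ?_, ?_⟩
  · intro c r h
    have : ∀ p ≤ N, (trace R N s p).1 (c + 1) r = s.1 (c + 1) r := by
      intro p hp
      induction hp using Nat.decreasingInduction with
      | self => rw [trace_of_le s le_rfl]
      | of_succ k hk ih =>
        rw [trace_of_lt s hk, ← ih]
        rcases h with h | h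
        · have := Nat.mod_lt k hR
          unfold bumpAt
          split_ifs
          · have : r ≠ k % R := by omega
            simp [State.swap, setAt, this]
          · rfl
        · exact bumpAt_of_ne (by omega)
    exact this 0 (Nat.zero_le _)
  · intro c r hr hN ha
    rw [hfin c r hN, key c r hr hN, if_pos ha]
    refine ⟨by simp [State.swap, setAt], ?_⟩
    exact trace_initial hN (by rw [add_mul]; omega)
  · intro c r hr hN ha
    rw [hfin c r hN, key c r hr hN, if_neg ha]
    exact ⟨trace_initial hN (by rw [add_mul]; omega), rfl⟩

/-! ### Comparison of two successive scans -/

variable {N : ℕ} {A B C : Arr} {a b : ℕ → WithTop ℕ}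

theorem Scan.step (h : Scan R N A B a) {c r : ℕ} (hr : r < R) (hN : c * R + r < N) :
    (A c r ≤ a (c * R + r + 1) ∧ a (c * R + r + 1) < A (c + 1) r ∧
      B (c + 1) r = a (c * R + r + 1) ∧ a (c * R + r) = A (c + 1) r) ∨
    ((a (c * R + r + 1) < A c r ∨ A (c + 1) r ≤ a (c * R + r + 1)) ∧
      B (c + 1) r = A (c + 1) r ∧ a (c * R + r) = a (c * R + r + 1)) := by
  by_cases ha : Admits A (a (c * R + r + 1)) c r
  · exact Or.inl ⟨ha.1, ha.2, h.swap c r hr hN ha⟩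
  · refine Or.inr ⟨?_, h.skip c r hr hN ha⟩
    unfold Admits at ha
    by_contra! hc
    exact ha hc

theorem Scan.letter_le (h : Scan R N A B a) (hR : 0 < R) (hp : p < N) : a (p + 1) ≤ a p := by
  have hm := Nat.mod_lt p hR
  have e := index_div_mod (R := R) p
  have h1 := h.swap (p / R) (p % R) hm (by omega)
  have h2 := h.skip (p / R) (p % R) hm (by omega)
  rw [e] at h1 h2
  by_cases ha : Admits A (a (p + 1)) (p / R) (p % R)
  · rw [(h1 ha).2]
    exact ha.2.le
  · exact (h2 ha).2.ge

theorem Scan.letter_mono (h : Scan R N A B a) (hR : 0 < R) {q : ℕ} (hq : q ≤ p) (hp : p ≤ N) :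
    a p ≤ a q := by
  induction hq using Nat.decreasingInduction with
  | self => exact le_rfl
  | of_succ k hk ih => exact ih.trans (h.letter_le hR (by omega))

theorem Scan.le (h : Scan R N A B a) (c r : ℕ) : B c r ≤ A c r := by
  cases c with
  | zero => exact (h.col_zero r).le
  | succ c =>
    by_cases hr : R ≤ r ∨ N ≤ c * R + r
    · exact (h.outside c r hr).le
    · push Not at hr
      by_cases ha : Admits A (a (c * R + r + 1)) c r
      · rw [(h.swap c r hr.1 hr.2 ha).1]
        exact ha.2.le
      · exact (h.skip c r hr.1 hr.2 ha).1.le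

theorem Scan.letter_eq_of_top (h : Scan R N A B a) (hR : 0 < R) {q : ℕ}
    (hq : ∀ c r, r < R → q ≤ c * R + r → A c r = ⊤) (hp : p ≤ N) (hqp : q ≤ p) : a p = a N := by
  induction hp using Nat.decreasingInduction with
  | self => rfl
  | of_succ k hk ih =>
    rw [← ih (by omega)]
    have hm := Nat.mod_lt k hR
    have e := index_div_mod (R := R) k
    have h1 := h.skip (k / R) (k % R) hm (by omega)
    rw [e] at h1
    refine (h1 ?_).2
    rintro ⟨h2, h3⟩
    rw [hq (k / R) (k % R) hm (by omega), top_le_iff] at h2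
    rw [h2] at h3
    exact not_top_lt h3

/-- Row bumping for increasing letters. -/
theorem Scan.bumping_lt (h : Scan R N A B a) (h' : Scan R N B C b)
    (hA : ∀ c r, A c r ≤ A (c + 1) r) (hR : 0 < R) (h0 : a (N - R) ≤ b N) (hp : p + R ≤ N) :
    a p ≤ b (p + R) := by
  have hp' : p ≤ N - R := by omega
  induction hp' using Nat.decreasingInduction with
  | self => rwa [Nat.sub_add_cancel (by omega)]
  | of_succ k hk ih_1 =>
    have ih := ih_1 (by omega)
    have hm := Nat.mod_lt k hR
    have e := index_div_mod (R := R) k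
    have e' : (k / R + 1) * R + k % R = k + R := by rw [add_mul]; omega
    have h1 := h.step (c := k / R) hm (by omega)
    have h3 := h.swap (k / R + 1) (k % R) hm (by omega)
    have h4 := h.skip (k / R + 1) (k % R) hm (by omega)
    have h5 := h'.step (c := k / R + 1) hm (by omega)
    have h7 := hA (k / R + 1) (k % R)
    rw [e] at h1
    rw [e'] at h3 h4 h5
    have e'' : k + 1 + R = k + R + 1 := by omega
    rw [e''] at ih
    -- The box to the right of the current one still holds an entry at least `A (c + 1) r`: it is
    -- unchanged, or it received a letter that passed the test against that very entry. This bounds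
    -- from below whatever the second scan, one column ahead, carries away.
    have h8 : B (k / R + 1 + 1) (k % R) = A (k / R + 1 + 1) (k % R) ∨
        A (k / R + 1) (k % R) ≤ B (k / R + 1 + 1) (k % R) := by
      by_cases ha : Admits A (a (k + R + 1)) (k / R + 1) (k % R)
      · exact Or.inr ((h3 ha).1 ▸ ha.1)
      · exact Or.inl (h4 ha).1
    clear h3 h4 e e' e'' hm h0
    generalize k / R = c, k % R = r, a (k + 1) = x, b (k + R + 1) = y, b (k + R) = y',
      a k = x' at *
    clear hp hk ih_1
    rcases h1 with ⟨p1, p2, p3, p4⟩ | ⟨p1, p3, p4⟩ <;>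
    rcases h5 with ⟨q1, q2, q3, q4⟩ | ⟨q1, q3, q4⟩ <;> grind

/-- Row bumping for decreasing letters. -/
theorem Scan.bumping_gt (h : Scan R N A B a) (h' : Scan R N B C b)
    (hA : ∀ c r, r < R → c * R + r < N → A (c + 1) r = a (c * R + r + 1) →
      a (c * R + r + 1) = ⊤) (hR : 0 < R)
    (h0 : b N < a N) (hp : p ≤ N) : b p < a p ∨ a p = ⊤ := by
  induction hp using Nat.decreasingInduction with
  | self => exact Or.inl h0
  | of_succ k hk ih =>
    have hm := Nat.mod_lt k hR
    have e := index_div_mod (R := R) k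
    have h1 := h.step (c := k / R) hm (by omega)
    have h5 := h'.step (c := k / R) hm (by omega)
    have h7 := hA (k / R) (k % R) hm (by omega)
    rw [e] at h1 h5 h7
    -- The first scan visits the left neighbour after the current box, when the letter in hand has
    -- only grown. So a letter placed there is at least `a (k + 1)` and would not let the smaller
    -- letter of the second scan in.
    have hprev : B (k / R) (k % R) = A (k / R) (k % R) ∨ a (k + 1) ≤ B (k / R) (k % R) := by
      rcases hc : k / R with _ | c
      · left; exact h.col_zero _
      · have e1 : c * R + k % R + R = k := by rw [hc, add_mul] at e; omega
        by_cases ha : Admits A (a (c * R + k % R + 1)) c (k % R)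
        · right
          rw [(h.swap c (k % R) hm (by omega) ha).1]
          exact h.letter_mono hR (by omega) (by omega)
        · left
          exact (h.skip c (k % R) hm (by omega) ha).1
    have : a k ≤ ⊤ := le_top
    clear hA h0 hm e
    generalize k / R = c, k % R = r, a (k + 1) = x, b (k + 1) = y, b k = y', a k = x' at *
    clear hk hR
    grind

end

/-! ### Insertion into fillings as a scan of arrays -/

/-- The array of a filling. -/
def val (T : Filling) : Arr := fun c r => (entry T c r).elim ⊤ fun x => (x : WithTop ℕ)

theorem entry_eq_some_iff {T : Filling} {c r x : ℕ} :
    entry T c r = some x ↔ ∃ row, T[r]? = some row ∧ row[c]? = some x := by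
  simp [entry, Option.bind_eq_some_iff]

theorem val_eq_coe_iff {T : Filling} {c r x : ℕ} : val T c r = (x : WithTop ℕ) ↔
    entry T c r = some x := by
  unfold val
  cases entry T c r <;> simp

theorem val_eq_top_iff {T : Filling} {c r : ℕ} : val T c r = ⊤ ↔ entry T c r = none := by
  unfold val
  cases entry T c r <;> simp

theorem entry_of_row {T : Filling} {r : ℕ} {row : List ℕ} (h : T[r]? = some row) (c : ℕ) :
    entry T c r = row[c]? := by
  simp [entry, h]

theorem entry_of_none {T : Filling} {r : ℕ} (h : T[r]? = none) (c : ℕ) :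
    entry T c r = none := by
  simp [entry, h]

theorem val_ne_top_iff {T : Filling} {c r : ℕ} : val T c r ≠ ⊤ ↔
    ∃ l, (T.map List.length)[r]? = some l ∧ c < l := by
  rw [Ne, val_eq_top_iff, List.getElem?_map]
  cases h : T[r]? with
  | none => simp [entry, h]
  | some row => simp [entry, h]

theorem val_le_length {T : Filling} {c r : ℕ} (hr : T.length ≤ r) : val T c r = ⊤ := by
  rw [val_eq_top_iff, entry, List.getElem?_eq_none hr]; rfl

theorem augEntry_of_row {T : Filling} {r : ℕ} {row : List ℕ} (h : T[r]? = some row) (c : ℕ) :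
    augEntry T c r = if c ≤ row.length then some (val T c r) else none := by
  rw [augEntry, h, Option.bind_some, val, entry_of_row h]
  split_ifs with hc
  · rcases hc.eq_or_lt with rfl | hc
    · simp
    · rw [List.getElem?_append_left (by simpa using hc)]
      simp [hc]
  · rw [List.getElem?_eq_none]
    simp; omega

theorem augEntry_of_none {T : Filling} {r : ℕ} (h : T[r]? = none) (c : ℕ) :
    augEntry T c r = none := by
  simp [augEntry, h]

theorem admits_iff {T : Filling} {k c r : ℕ} :
    admits T k (c + 1, r) = true ↔ Admits (val T) k c r := by
  cases h : T[r]? with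
  | none =>
    have : val T c r = ⊤ := by simp [val_eq_top_iff, entry, h]
    simp [admits, augEntry_of_none h, Admits, this]
  | some row =>
    simp only [admits, augEntry_of_row h, Admits]
    have h1 : val T c r = ⊤ ↔ row.length ≤ c := by
      rw [val_eq_top_iff, entry_of_row h, List.getElem?_eq_none_iff]
    split_ifs with h2 h3
    · simp
    · have : val T c r = ⊤ := by rw [h1]; omega
      simp [this]
    · have : val T c r = ⊤ := by rw [h1]; omega
      simp [this]

theorem insertScan_cons_zero (r : ℕ) (bs : List (ℕ × ℕ)) (T : Filling) (k : ℕ) :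
    insertScan ((0, r) :: bs) T k = insertScan bs T k := by
  simp [insertScan, admits]

theorem insertScan_cons_of_not {c r : ℕ} {bs : List (ℕ × ℕ)} {T : Filling} {k : ℕ}
    (h : ¬ Admits (val T) k c r) : insertScan ((c + 1, r) :: bs) T k = insertScan bs T k := by
  rw [← admits_iff] at h
  simp [insertScan, h]

theorem insertScan_cons_of_none {c r : ℕ} {bs : List (ℕ × ℕ)} {T : Filling} {k : ℕ}
    (h : Admits (val T) k c r) (h' : entry T (c + 1) r = none) :
    insertScan ((c + 1, r) :: bs) T k =
      (addBox T k (NewBox.endOfRow r), NewBox.endOfRow r) := by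
  rw [← admits_iff] at h
  simp [insertScan, h, h']

theorem insertScan_cons_of_some {c r y : ℕ} {bs : List (ℕ × ℕ)} {T : Filling} {k : ℕ}
    (h : Admits (val T) k c r) (h' : entry T (c + 1) r = some y) :
    insertScan ((c + 1, r) :: bs) T k =
      insertScan bs (T.modify r fun row => row.set (c + 1) k) y := by
  rw [← admits_iff] at h
  simp [insertScan, h, h']

theorem insertScan_append_of_zero (bs : List (ℕ × ℕ)) (T : Filling) (k : ℕ) (l : List (ℕ × ℕ))
    (hl : ∀ b ∈ l, b.1 = 0) : insertScan (bs ++ l) T k = insertScan bs T k := by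
  induction bs generalizing T k with
  | nil =>
    induction l with
    | nil => rfl
    | cons b l ih =>
      obtain ⟨c, r⟩ := b
      have : c = 0 := hl (c, r) (by simp)
      subst this
      rw [List.nil_append, insertScan_cons_zero]
      exact ih fun b hb => hl b (by simp [hb])
  | cons b bs ih =>
    obtain ⟨c, r⟩ := b
    rw [List.cons_append, insertScan, insertScan]
    split_ifs
    · cases entry T c r with
      | none => rfl
      | some y => exact ih _ _
    · exact ih _ _

theorem insertScan_append_of_not_admits (l : List (ℕ × ℕ)) (bs : List (ℕ × ℕ)) (T : Filling) (k : ℕ)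
    (hl : ∀ b ∈ l, 0 < b.1 ∧ ¬ Admits (val T) k (b.1 - 1) b.2) :
    insertScan (l ++ bs) T k = insertScan bs T k := by
  induction l with
  | nil => rfl
  | cons b l ih =>
    obtain ⟨c, r⟩ := b
    obtain ⟨h1, h2⟩ := hl (c, r) (by simp)
    obtain ⟨c, rfl⟩ : ∃ d, c = d + 1 := ⟨c - 1, by simp at h1; omega⟩
    rw [List.cons_append, insertScan_cons_of_not]
    · exact ih fun b hb => hl b (by simp [hb])
    · exact h2

theorem map_length_modify_set (T : Filling) (r c k : ℕ) :
    (T.modify r fun row => row.set c k).map List.length = T.map List.length := by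
  apply List.ext_getElem?
  intro i
  simp only [List.getElem?_map, List.getElem?_modify]
  cases T[i]? with
  | none => rfl
  | some row => by_cases h : r = i <;> simp [h]

/-- A box outside the augmented diagram has ⊤ to its left and never admits a letter. Exchanges keep
the row lengths, so this remains true throughout the scan. -/
theorem insertScan_filter (T₀ : Filling) (bs : List (ℕ × ℕ)) (T : Filling) (k : ℕ)
    (h : T.map List.length = T₀.map List.length) :
    insertScan (bs.filter fun b => (augEntry T₀ b.1 b.2).isSome) T k = insertScan bs T k := by
  induction bs generalizing T k with
  | nil => rfl
  | cons b bs ih =>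
    obtain ⟨c, r⟩ := b
    rw [List.filter_cons]
    split_ifs with hb
    · rw [insertScan, insertScan]
      split_ifs
      · cases entry T c r with
        | none => rfl
        | some y => exact ih _ _ (by rw [map_length_modify_set, h])
      · exact ih _ _ h
    · rw [ih _ _ h]
      cases c with
      | zero => rw [insertScan_cons_zero]
      | succ c =>
        rw [insertScan_cons_of_not]
        rintro ⟨h1, -⟩
        have h2 : val T c r ≠ ⊤ := (h1.trans_lt (WithTop.coe_lt_top k)).ne
        rw [val_ne_top_iff, h, List.getElem?_map] at h2
        obtain ⟨l, h3, h4⟩ := h2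
        cases h5 : T₀[r]? with
        | none => simp [h5] at h3
        | some row =>
          simp [h5] at h3
          rw [augEntry_of_row h5, if_pos (by omega)] at hb
          simp at hb

/-- The boxes with indices `p - 1, …, 0`, for `R` rows. -/
def scanBoxes (R p : ℕ) : List (ℕ × ℕ) :=
  (List.range p).reverse.map fun q => (q / R + 1, q % R)

theorem scanBoxes_succ (R p : ℕ) :
    scanBoxes R (p + 1) = (p / R + 1, p % R) :: scanBoxes R p := by
  simp [scanBoxes, List.range_succ]

theorem scanBoxes_add (R p q : ℕ) : scanBoxes R (p + q) =
    ((List.range q).reverse.map fun i => ((p + i) / R + 1, (p + i) % R)) ++ scanBoxes R p := by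
  simp [scanBoxes, List.range_add, ← List.map_reverse, Function.comp_def]

theorem scanBoxes_mul (R m : ℕ) : scanBoxes R (m * R) =
    ((List.range m).reverse.map (· + 1)).flatMap fun c =>
      (List.range R).reverse.map fun r => (c, r) := by
  induction m with
  | zero => simp [scanBoxes]
  | succ m ih =>
    rw [add_mul, one_mul, scanBoxes_add, ih]
    simp only [List.range_succ, List.reverse_append, List.reverse_singleton, List.map_append,
      List.flatMap_append, List.map_cons, List.map_nil, List.flatMap_cons, List.flatMap_nil,
      List.append_nil]
    congr 1
    apply List.map_congr_left
    intro i hi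
    have : i < R := by simpa using hi
    rw [index_div this, index_mod this]

theorem le_foldr_max (l : List ℕ) (x : ℕ) (hx : x ∈ l) : x ≤ l.foldr max 0 := by
  induction l with
  | nil => simp at hx
  | cons a l ih =>
    simp only [List.foldr_cons]
    rcases List.mem_cons.1 hx with rfl | h
    · exact le_max_left _ _
    · exact (ih h).trans (le_max_right _ _)

/-- The scanned region may be any full rectangle that covers the diagram. The freedom in `M` makes
it possible to scan two fillings along the same list of indices. -/
theorem insertEntry_eq {T : Filling} {M : ℕ} (hM : ∀ c r, val T c r ≠ ⊤ → c < M) (k : ℕ) :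
    insertEntry T k = insertScan (scanBoxes T.length (M * T.length)) T k := by
  have key : ∀ m, (∀ c r, val T c r ≠ ⊤ → c < m) → ∀ m', m ≤ m' →
      insertScan (scanBoxes T.length (m * T.length)) T k =
        insertScan (scanBoxes T.length (m' * T.length)) T k := by
    intro m hm m' hmm
    obtain ⟨d, rfl⟩ := Nat.exists_eq_add_of_le hmm
    rw [add_mul, scanBoxes_add, insertScan_append_of_not_admits]
    intro b hb
    simp only [List.mem_map, List.mem_reverse, List.mem_range] at hb
    obtain ⟨i, hi, rfl⟩ := hb
    refine ⟨Nat.succ_pos _, fun had => ?_⟩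
    have h1 := hm _ _ (had.1.trans_lt (WithTop.coe_lt_top k)).ne
    have hR : 0 < T.length := by
      rcases Nat.eq_zero_or_pos T.length with h | h
      · rw [h] at hi; simp at hi
      · exact h
    have : m ≤ (m * T.length + i) / T.length := by
      rw [Nat.le_div_iff_mul_le hR]; omega
    simp at h1
    omega
  set m := (T.map List.length).foldr max 0 with hm
  have hm' : ∀ c r, val T c r ≠ ⊤ → c < m := by
    intro c r h
    obtain ⟨l, h1, h2⟩ := val_ne_top_iff.1 h
    exact h2.trans_le (le_foldr_max _ _ (List.mem_of_getElem? h1))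
  have h0 : insertEntry T k = insertScan (scanBoxes T.length (m * T.length)) T k := by
    rw [insertEntry, augBoxes, insertScan_filter T _ T k rfl, ← hm,
      scanBoxes_mul, List.range_succ_eq_map, List.reverse_cons, List.flatMap_append,
      insertScan_append_of_zero, List.map_reverse]
    intro b hb
    simp at hb
    obtain ⟨a, -, rfl⟩ := hb
    rfl
  rw [h0]
  rcases le_total m M with h | h
  · exact key m hm' M h
  · exact (key M hM m h).symm

theorem val_modify_set {T : Filling} {c r k y : ℕ} (h : entry T c r = some y) :
    val (T.modify r fun row => row.set c k) = setAt (val T) c r k := by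
  obtain ⟨row, h1, h2⟩ := entry_eq_some_iff.1 h
  funext c' r'
  simp only [val, entry, setAt, List.getElem?_modify]
  by_cases hr : r = r'
  · subst hr
    have hc : c < row.length := by
      by_contra hc
      rw [List.getElem?_eq_none (by omega)] at h2
      simp at h2
    by_cases hc' : c = c'
    · subst hc'
      simp [h1, hc]
    · simp [h1, hc', Ne.symm hc']
  · have : ¬ (c' = c ∧ r' = r) := fun h => hr h.2.symm
    rw [if_neg this]
    cases T[r']? <;> simp [hr]

theorem val_addBox_endOfRow {T : Filling} {r k : ℕ} {row : List ℕ} (h : T[r]? = some row) :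
    val (addBox T k (NewBox.endOfRow r)) = setAt (val T) row.length r k := by
  funext c' r'
  simp only [val, entry, setAt, List.getElem?_modify, addBox]
  by_cases hr : r = r'
  · subst hr
    by_cases hc' : c' = row.length
    · subst hc'
      simp [h]
    · rcases lt_or_gt_of_ne hc' with h' | h'
      · simp [h, hc', List.getElem?_append_left h']
      · have h1 : (row ++ [k])[c']? = none := List.getElem?_eq_none (by simp; omega)
        have h2 : row[c']? = none := List.getElem?_eq_none (by omega)
        simp [h, hc', h1, h2]
  · have : ¬ (c' = row.length ∧ r' = r) := fun h => hr h.2.symm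
    rw [if_neg this]
    cases T[r']? <;> simp [hr]

theorem val_addBox_newRow {T : Filling} {p k : ℕ} (hp : p ≤ T.length) :
    val (addBox T k (NewBox.newRow p)) = insRow (val T) p k := by
  funext c r
  simp only [val, entry, insRow, addBox, List.getElem?_insertIdx]
  rcases lt_trichotomy r p with h | rfl | h
  · simp [h]
  · cases c <;> simp [hp]
  · simp [h.not_gt, h.ne']

theorem bumpAt_admits {R p : ℕ} {s : State} (h : Admits s.1 s.2 (p / R) (p % R)) :
    bumpAt R p s = s.swap (p / R + 1) (p % R) := if_pos h

theorem bumpAt_not_admits {R p : ℕ} {s : State} (h : ¬ Admits s.1 s.2 (p / R) (p % R)) :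
    bumpAt R p s = s := if_neg h

/-- An insertion follows the trace of the scanning states until it ends at the right end of a
row. -/
theorem insertEntry_trace {T : Filling} {M : ℕ} (hM : ∀ c r, val T c r ≠ ⊤ → c < M) (k : ℕ)
    {p : ℕ} (hp : p ≤ M * T.length) :
    (∃ (T' : Filling) (k' : ℕ), trace T.length (M * T.length) (val T, (k : WithTop ℕ)) p =
        (val T', (k' : WithTop ℕ)) ∧ T'.map List.length = T.map List.length ∧
        insertEntry T k = insertScan (scanBoxes T.length p) T' k') ∨
    (∃ q, p ≤ q ∧ q < M * T.length ∧ ∃ (T' : Filling) (k' : ℕ),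
      trace T.length (M * T.length) (val T, (k : WithTop ℕ)) (q + 1) =
        (val T', (k' : WithTop ℕ)) ∧ T'.map List.length = T.map List.length ∧
      (T.map List.length)[q % T.length]? = some (q / T.length + 1) ∧
      Admits (val T') k' (q / T.length) (q % T.length) ∧
      trace T.length (M * T.length) (val T, (k : WithTop ℕ)) p =
        (val (addBox T' k' (NewBox.endOfRow (q % T.length))), ⊤) ∧
      insertEntry T k = (addBox T' k' (NewBox.endOfRow (q % T.length)),
        NewBox.endOfRow (q % T.length))) := by
  induction hp using Nat.decreasingInduction with
  | self =>
    left
    exact ⟨T, k, trace_of_le _ le_rfl, rfl, insertEntry_eq hM k⟩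
  | of_succ p hp ih =>
    rw [trace_of_lt _ hp]
    rcases ih with ⟨T', k', h1, h2, h3⟩ | ⟨q, hpq, hq, T', k', h1, h2, h3, h4, h5, h6⟩
    · rw [scanBoxes_succ] at h3
      rw [h1]
      by_cases ha : Admits (val T') k' (p / T.length) (p % T.length)
      · rw [bumpAt_admits ha]
        cases h : entry T' (p / T.length + 1) (p % T.length) with
        | some y =>
          left
          refine ⟨_, y, ?_, ?_, h3.trans (insertScan_cons_of_some ha h)⟩
          · rw [val_modify_set h, State.swap]
            exact Prod.ext rfl (val_eq_coe_iff.2 h)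
          · rw [map_length_modify_set, h2]
        | none =>
          right
          have h4 : val T' (p / T.length) (p % T.length) ≠ ⊤ :=
            (ha.1.trans_lt (WithTop.coe_lt_top k')).ne
          obtain ⟨l, h5, h6⟩ := val_ne_top_iff.1 h4
          rw [List.getElem?_map] at h5
          cases h7 : T'[p % T.length]? with
          | none => simp [h7] at h5
          | some row =>
            rw [h7] at h5
            simp at h5
            subst h5
            have h8 : row.length = p / T.length + 1 := by
              rw [entry_of_row h7, List.getElem?_eq_none_iff] at h
              omega
            refine ⟨p, le_rfl, hp, T', k', h1, h2, ?_, ha, ?_,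
              h3.trans (insertScan_cons_of_none ha h)⟩
            · rw [← h2, List.getElem?_map, h7, ← h8]; rfl
            · rw [val_addBox_endOfRow h7, h8, State.swap]
              exact Prod.ext rfl (val_eq_top_iff.2 h)
      · left
        rw [bumpAt_not_admits ha]
        exact ⟨T', k', rfl, h2, h3.trans (insertScan_cons_of_not ha)⟩
    · right
      -- With ⊤ in hand no box acts any more, so the trace stays constant although the insertion
      -- itself has already stopped.
      exact ⟨q, by omega, hq, T', k', h1, h2, h3, h4, by rw [h5, bumpAt_top], h6⟩

/-- Arrays do not see empty rows, whence the two side conditions. -/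
theorem eq_of_val_eq {T T' : Filling} (h : val T = val T') (hT : [] ∉ T) (hT' : [] ∉ T') :
    T = T' := by
  have he : ∀ c r, entry T c r = entry T' c r := by
    intro c r
    cases h1 : entry T c r with
    | none => rw [← val_eq_top_iff, h, val_eq_top_iff] at h1; exact h1.symm
    | some x => rw [← val_eq_coe_iff, h, val_eq_coe_iff] at h1; exact h1.symm
  apply List.ext_getElem?
  intro r
  cases h1 : T[r]? with
  | none =>
    cases h2 : T'[r]? with
    | none => rfl
    | some row =>
      have h3 := he 0 r
      rw [entry_of_none h1, entry_of_row h2] at h3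
      cases row with
      | nil => exact absurd (List.mem_of_getElem? h2) hT'
      | cons a l => simp at h3
  | some row =>
    cases h2 : T'[r]? with
    | none =>
      have h3 := he 0 r
      rw [entry_of_none h2, entry_of_row h1] at h3
      cases row with
      | nil => exact absurd (List.mem_of_getElem? h1) hT
      | cons a l => simp at h3
    | some row' =>
      congr 1
      apply List.ext_getElem?
      intro c
      rw [← entry_of_row h1, ← entry_of_row h2, he]

/-- Every array with the support of a filling is the array of a filling. -/
theorem exists_val_eq (T : Filling) (V : Arr) (h : ∀ c r, V c r = ⊤ ↔ val T c r = ⊤) :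
    ∃ T' : Filling, val T' = V ∧ T'.map List.length = T.map List.length := by
  refine ⟨T.mapIdx fun r row => row.mapIdx fun c _ => (V c r).untopD 0, ?_, ?_⟩
  · funext c r
    have h1 := h c r
    simp only [val, entry, List.getElem?_mapIdx] at h1 ⊢
    cases hr : T[r]? with
    | none => simp [hr] at h1; simp [h1]
    | some row =>
      cases hc : row[c]? with
      | none => simp [hr, hc] at h1; simp [h1, hc]
      | some x =>
        simp [hr, hc] at h1
        obtain ⟨y, hy⟩ := WithTop.ne_top_iff_exists.1 h1
        simp [hc, ← hy]
        rfl
  · apply List.ext_getElem?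
    intro r
    simp only [List.getElem?_map, List.getElem?_mapIdx]
    cases T[r]? <;> simp

theorem not_nil_mem_iff {T : Filling} : [] ∉ T ↔ 0 ∉ T.map List.length := by
  simp

theorem not_nil_mem_of_map_length_eq {T T' : Filling} (h : T.map List.length = T'.map List.length)
    (hT : [] ∉ T') : [] ∉ T := by
  rwa [not_nil_mem_iff, h, ← not_nil_mem_iff]

theorem val_zero_ne_top_iff {T : Filling} (hT : [] ∉ T) {r : ℕ} : val T 0 r ≠ ⊤ ↔ r < T.length := by
  constructor
  · intro h
    by_contra hr
    exact h (val_le_length (by omega))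
  · intro h
    rw [Ne, val_eq_top_iff, entry_of_row (List.getElem?_eq_getElem h)]
    intro h'
    simp at h'
    exact hT (h' ▸ List.getElem_mem h)

/-! ### The effect of one insertion on a Young composition tableau -/

/-- Young composition tableaux with distinct entries and without empty rows. -/
def Young (T : Filling) : Prop := YoungArr (val T) ∧ [] ∉ T

/-- The first window is the column just beyond the rectangle; the left neighbours of its boxes are
all ⊤. -/
theorem Ready.init {T : Filling} (hT : Young T) {k : WithTop ℕ} (hk : Fresh (val T) k) {M : ℕ}
    (hM : ∀ c r, val T c r ≠ ⊤ → c < M) :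
    Ready T.length (M * T.length) (val T, k) := by
  refine ⟨hT.1, hk, fun c r hr h1 h2 => ?_, fun c r hr => val_le_length hr⟩
  rintro ⟨h3, h4⟩
  have : val T c r ≠ ⊤ := (h3.trans_lt (h4.trans_le le_top)).ne
  have h5 := hM c r this
  have : (c + 1) * T.length ≤ M * T.length := Nat.mul_le_mul_right _ h5
  rw [add_mul] at this
  omega

theorem Ready.trace_of_bound {T : Filling} (hT : Young T) {k : WithTop ℕ} (hk : Fresh (val T) k)
    {M : ℕ} (hM : ∀ c r, val T c r ≠ ⊤ → c < M) {p : ℕ} (hp : p ≤ M * T.length) :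
    Ready T.length p (trace T.length (M * T.length) (val T, k) p) := by
  rcases Nat.eq_zero_or_pos T.length with h | h
  · have h1 := Ready.init hT hk hM
    rw [trace_of_le _ (by simp [h])]
    simp only [h, mul_zero] at h1 hp
    rwa [h, Nat.le_zero.1 hp]
  · exact ready_trace h (Ready.init hT hk hM) hp

theorem Ready.not_admits_zero {R : ℕ} {s : State} (h : Ready R 0 s) (r : ℕ) :
    ¬ Admits s.1 s.2 0 r := by
  by_cases hr : r < R
  · exact h.window 0 r hr (Nat.zero_le _) (by omega)
  · rintro ⟨h1, h2⟩
    rw [h.top 0 r (by omega), top_le_iff] at h1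
    rw [h1] at h2
    exact not_top_lt h2

theorem exists_bound (T : Filling) : ∃ M, ∀ M', M ≤ M' → ∀ c r, val T c r ≠ ⊤ → c < M' := by
  refine ⟨(T.map List.length).foldr max 0, fun M' hM' c r h => ?_⟩
  obtain ⟨l, h1, h2⟩ := val_ne_top_iff.1 h
  exact h2.trans_le ((le_foldr_max _ _ (List.mem_of_getElem? h1)).trans hM')

theorem val_cons_succ (row : List ℕ) (T : Filling) (c r : ℕ) :
    val (row :: T) c (r + 1) = val T c r := rfl

theorem newRowPos_spec {T : Filling} (hT : [] ∉ T) (y : ℕ) : newRowPos T y ≤ T.length ∧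
    (∀ r, r < newRowPos T y → val T 0 r < y) ∧ ¬ val T 0 (newRowPos T y) < y := by
  induction T with
  | nil => simp [newRowPos, val, entry]
  | cons row T ih =>
    have ih := ih (by simp at hT; exact hT.2)
    cases row with
    | nil => simp at hT
    | cons a row =>
      by_cases ha : a < y
      · have h1 : newRowPos ((a :: row) :: T) y = newRowPos T y + 1 := by
          simp [newRowPos, ha]
        rw [h1]
        refine ⟨by simpa using ih.1, fun r hr => ?_, ih.2.2⟩
        cases r with
        | zero => simpa [val, entry] using ha
        | succ r => exact ih.2.1 r (by omega)
      · have h1 : newRowPos ((a :: row) :: T) y = 0 := by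
          simp [newRowPos, ha]
        rw [h1]
        refine ⟨Nat.zero_le _, by simp, ?_⟩
        simpa [val, entry] using ha

theorem newRowPos_eq {T : Filling} (hT : [] ∉ T) {y p : ℕ}
    (h1 : ∀ r, r < p → val T 0 r < y) (h2 : ¬ val T 0 p < y) : newRowPos T y = p := by
  obtain ⟨h3, h4, h5⟩ := newRowPos_spec hT y
  rcases lt_trichotomy (newRowPos T y) p with h | h | h
  · exact absurd (h1 _ h) h5
  · exact h
  · exact absurd (h4 _ h) h2

/-- The row lengths after the creation of a box. -/
def addLen (l : List ℕ) : NewBox → List ℕ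
  | NewBox.endOfRow r => l.modify r (· + 1)
  | NewBox.newRow p => l.insertIdx p 1

theorem map_length_addBox (T : Filling) (k : ℕ) (b : NewBox) :
    (addBox T k b).map List.length = addLen (T.map List.length) b := by
  cases b with
  | endOfRow r =>
    apply List.ext_getElem?
    intro i
    simp only [addBox, addLen, List.getElem?_map, List.getElem?_modify]
    cases T[i]? with
    | none => rfl
    | some row => by_cases h : r = i <;> simp [h]
  | newRow p => simp [addBox, addLen, List.map_insertIdx]

/-- The box `b` has been added to `T` at an admissible place: it is in the lowest row of its
length. -/
def Corner (T : Filling) : NewBox → Prop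
  | NewBox.endOfRow r => ∃ c, val T (c + 1) r ≠ ⊤ ∧ val T (c + 2) r = ⊤ ∧
      ∀ r', r' < r → val T (c + 1) r' ≠ ⊤ → val T (c + 2) r' ≠ ⊤
  | NewBox.newRow p => val T 0 p ≠ ⊤ ∧ val T 1 p = ⊤ ∧ ∀ r, r < p → val T 1 r ≠ ⊤

/-- The two ways in which an insertion can end. -/
theorem insertEntry_cases {T : Filling} (hT : Young T) {k : ℕ} {M : ℕ}
    (hM : ∀ c r, val T c r ≠ ⊤ → c < M) :
    (∃ (c r : ℕ) (S : Filling) (y : ℕ), r < T.length ∧ c * T.length + r < M * T.length ∧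
      (T.map List.length)[r]? = some (c + 1) ∧
      trace T.length (M * T.length) (val T, (k : WithTop ℕ)) (c * T.length + r + 1) =
        (val S, (y : WithTop ℕ)) ∧ S.map List.length = T.map List.length ∧
      insertEntry T k = (addBox S y (NewBox.endOfRow r), NewBox.endOfRow r) ∧
      val (addBox S y (NewBox.endOfRow r)) = setAt (val S) (c + 1) r y ∧
      Admits (val S) y c r ∧
      ∀ p ≤ c * T.length + r, trace T.length (M * T.length) (val T, (k : WithTop ℕ)) p =
        (val (addBox S y (NewBox.endOfRow r)), ⊤)) ∨
    (∃ (S : Filling) (y : ℕ), trace T.length (M * T.length) (val T, (k : WithTop ℕ)) 0 =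
        (val S, (y : WithTop ℕ)) ∧ S.map List.length = T.map List.length ∧
      insertEntry T k =
        (addBox S y (NewBox.newRow (newRowPos S y)), NewBox.newRow (newRowPos S y)) ∧
      val (addBox S y (NewBox.newRow (newRowPos S y))) = insRow (val S) (newRowPos S y) y ∧
      [] ∉ S) := by
  rcases insertEntry_trace hM k (Nat.zero_le _) with
    ⟨S, y, h1, h2, h3⟩ | ⟨q, -, hq, S, y, h1, h2, h3, h4, h5, h6⟩
  · right
    have hS := not_nil_mem_of_map_length_eq h2 hT.2
    exact ⟨S, y, h1, h2, h3, val_addBox_newRow (newRowPos_spec hS y).1, hS⟩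
  · left
    have hR : 0 < T.length := by
      rcases Nat.eq_zero_or_pos T.length with h | h
      · simp [h] at hq
      · exact h
    have e := index_div_mod (R := T.length) q
    have h7 : val (addBox S y (NewBox.endOfRow (q % T.length))) =
        setAt (val S) (q / T.length + 1) (q % T.length) y := by
      rw [← h2, List.getElem?_map] at h3
      cases h8 : S[q % T.length]? with
      | none => simp [h8] at h3
      | some row =>
        rw [h8] at h3
        simp at h3
        rw [val_addBox_endOfRow h8, h3]
    refine ⟨q / T.length, q % T.length, S, y, Nat.mod_lt _ hR, by omega, h3, by rw [e, h1], h2,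
      h6, h7, h4, fun p hp => ?_⟩
    rw [e] at hp
    have hrow : val S (q / T.length + 1) (q % T.length) = ⊤ := by
      by_contra hne
      obtain ⟨l, h8, h9⟩ := val_ne_top_iff.1 hne
      rw [h2, h3] at h8
      simp at h8
      omega
    induction hp using Nat.decreasingInduction with
    | self =>
      rw [trace_of_lt _ hq, h1, bumpAt_admits h4, State.swap, h7]
      exact Prod.ext rfl hrow
    | of_succ p hp ih => rw [trace_of_lt _ (by omega), ih, bumpAt_top]

/-- Both endings are read off from the invariant. At the end of a row, `lowest_of_admits` makes the
new box the lowest of its length. For a new row, the window at index 0 says that no box of the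
second column admits the letter, which is what `YoungArr.insRow` needs. -/
theorem insertEntry_young {T : Filling} (hT : Young T) {k : ℕ} (hk : Fresh (val T) k) :
    Young (insertEntry T k).1 ∧ Corner (insertEntry T k).1 (insertEntry T k).2 ∧
      (insertEntry T k).1.map List.length = addLen (T.map List.length) (insertEntry T k).2 := by
  obtain ⟨M, hM⟩ := exists_bound T
  have hM := hM M le_rfl
  rcases insertEntry_cases hT (k := k) hM with
    ⟨c, r, S, y, hr, hN, h1, h2, h3, h4, h5, h6, h7⟩ | ⟨S, y, h1, h2, h3, h4, hS⟩
  · have hR : 0 < T.length := by omega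
    have h8 := Ready.trace_of_bound hT hk hM (p := c * T.length + r) hN.le
    have h9 := Ready.trace_of_bound hT hk hM (p := c * T.length + r + 1) hN
    rw [h7 _ le_rfl] at h8
    rw [h2, ready_succ_iff hR, index_div hr, index_mod hr] at h9
    obtain ⟨g1, g2, g3, g4, g5⟩ := h9
    have hlen := map_length_addBox S y (NewBox.endOfRow r)
    rw [h3] at hlen
    rw [h4]
    have hrow : val S (c + 1) r = ⊤ := by
      by_contra hne
      obtain ⟨l, h8, h9⟩ := val_ne_top_iff.1 hne
      rw [h3, h1] at h8
      simp at h8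
      omega
    refine ⟨⟨h8.young, ?_⟩, ⟨c, ?_, ?_, ?_⟩, hlen⟩
    · have h10 := not_nil_mem_of_map_length_eq h3 hT.2
      simp only [addBox]
      intro hmem
      obtain ⟨i, hi⟩ := List.mem_iff_getElem?.1 hmem
      rw [List.getElem?_modify] at hi
      cases hSi : S[i]? with
      | none => simp [hSi] at hi
      | some row =>
        by_cases hri : r = i
        · simp [hSi, hri] at hi
        · simp [hSi, hri] at hi
          exact h10 (hi ▸ List.mem_of_getElem? hSi)
    · simp [h5, setAt]
    · have : val S (c + 2) r = ⊤ := by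
        have : val S (c + 2) r = ⊤ ∨ val S (c + 1) r < val S (c + 2) r := g1.row (c + 1) r
        rw [hrow] at this
        simpa using this
      simp [h5, setAt, this]
    · intro r' hr' hne
      rw [h5] at hne ⊢
      have hne' : r' ≠ r := hr'.ne
      simp [setAt, hne'] at hne ⊢
      exact lowest_of_admits g1 g4 h6 hrow r' hr' hne
  · have h8 := Ready.trace_of_bound hT hk hM (p := 0) (Nat.zero_le _)
    rw [h1] at h8
    have h9 := h8.not_admits_zero
    have h10 : ∀ x, val S 0 x = (y : WithTop ℕ) → False := by
      intro x hx
      exact WithTop.coe_ne_top (h8.fresh 0 x hx)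
    obtain ⟨g1, g2, g3⟩ := newRowPos_spec hS y
    have hlen := map_length_addBox S y (NewBox.newRow (newRowPos S y))
    rw [h2] at hlen
    rw [h3]
    have hy := h8.young
    refine ⟨⟨?_, ?_⟩, ⟨?_, ?_, ?_⟩, hlen⟩
    · rw [h4]
      refine hy.insRow h8.fresh WithTop.coe_ne_top h9 g2 fun r hr => ?_
      have h11 : (y : WithTop ℕ) < val S 0 (newRowPos S y) :=
        lt_of_le_of_ne (not_lt.1 g3) fun h => h10 _ h.symm
      rcases hr.eq_or_lt with rfl | hr
      · exact h11
      · rcases hy.col _ _ hr with h | h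
        · rw [h]; exact WithTop.coe_lt_top y
        · exact h11.trans h
    · rw [not_nil_mem_iff, hlen, addLen]
      intro hmem
      rcases List.eq_or_mem_of_mem_insertIdx hmem with h | h
      · simp at h
      · rw [← h2] at h
        exact not_nil_mem_iff.1 hS h
    · simp [h4, insRow]
    · simp [h4, insRow]
    -- A row below with a single box starts with a smaller entry, so its empty second box would have
    -- admitted the letter.
    · intro r hr
      rw [h4]
      simp only [insRow, hr, if_true]
      have h12 := h9 r
      have h13 := g2 r hr
      intro h14
      exact h12 ⟨h13.le, lt_of_lt_of_eq (WithTop.coe_lt_top y) h14.symm⟩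

theorem mem_setAt_iff {V : Arr} {c r : ℕ} {k x : WithTop ℕ} :
    ((∃ c' r', setAt V c r k c' r' = x) ∨ V c r = x) ↔ ((∃ c' r', V c' r' = x) ∨ k = x) := by
  constructor
  · rintro (⟨c', r', h⟩ | h)
    · simp only [setAt] at h
      split_ifs at h
      · exact Or.inr h
      · exact Or.inl ⟨c', r', h⟩
    · exact Or.inl ⟨c, r, h⟩
  · rintro (⟨c', r', h⟩ | h)
    · by_cases hc : c' = c ∧ r' = r
      · obtain ⟨rfl, rfl⟩ := hc
        exact Or.inr h
      · exact Or.inl ⟨c', r', by simp [setAt, hc, h]⟩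
    · exact Or.inl ⟨c, r, by simp [setAt, h]⟩

theorem mem_trace_iff {R N p : ℕ} (s : State) (x : WithTop ℕ) (hp : p ≤ N) :
    ((∃ c r, (trace R N s p).1 c r = x) ∨ (trace R N s p).2 = x) ↔
      ((∃ c r, s.1 c r = x) ∨ s.2 = x) := by
  induction hp using Nat.decreasingInduction with
  | self => rw [trace_of_le s le_rfl]
  | of_succ p hp ih =>
    rw [trace_of_lt s hp, ← ih, bumpAt]
    split_ifs
    · exact mem_setAt_iff
    · rfl

/-- The number `x` is an entry of `T`. -/
def IsEntry (T : Filling) (x : ℕ) : Prop := ∃ c r, entry T c r = some x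

theorem isEntry_iff {T : Filling} {x : ℕ} : IsEntry T x ↔ ∃ c r, val T c r = x := by
  simp [IsEntry, val_eq_coe_iff]

theorem isEntry_insertEntry {T : Filling} (hT : Young T) (k x : ℕ) :
    IsEntry (insertEntry T k).1 x ↔ IsEntry T x ∨ x = k := by
  obtain ⟨M, hM⟩ := exists_bound T
  have hM := hM M le_rfl
  have key := mem_trace_iff (R := T.length) (N := M * T.length) (p := 0)
    (val T, (k : WithTop ℕ)) (x : WithTop ℕ) (Nat.zero_le _)
  simp only [isEntry_iff]
  have hxk : ((k : WithTop ℕ) = x) ↔ x = k := by rw [Nat.cast_inj, eq_comm]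
  rw [hxk] at key
  rw [← key]
  rcases insertEntry_cases hT (k := k) hM with
    ⟨c, r, S, y, hr, hN, h1, h2, h3, h4, h5, h6, h7⟩ | ⟨S, y, h1, h2, h3, h4, hS⟩
  · rw [h7 0 (Nat.zero_le _), h4]
    simp
  · rw [h1, h3]
    simp only [h4]
    obtain ⟨g1, -, -⟩ := newRowPos_spec hS y
    generalize newRowPos S y = p at g1
    constructor
    · rintro ⟨c, r, h⟩
      simp only [insRow] at h
      split_ifs at h
      · exact Or.inl ⟨c, r, h⟩
      · exact Or.inr h
      · exact absurd h (WithTop.coe_ne_top).symm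
      · exact Or.inl ⟨c, r - 1, h⟩
    · rintro (⟨c, r, h⟩ | h)
      · by_cases hr : r < p
        · exact ⟨c, r, by simp [insRow, hr, h]⟩
        · exact ⟨c, r + 1, by
            have h1 : ¬ r + 1 < p := by omega
            have h2 : ¬ r + 1 = p := by omega
            simp [insRow, h1, h2, h]⟩
      · exact ⟨0, p, by simp [insRow, h]⟩

/-- Only an exchange with an empty box alters the set of occupied boxes, and it leaves ⊤ in hand for
the rest of the scan. -/
theorem trace_support {R N p : ℕ} (s : State) (hp : p ≤ N) (h : (trace R N s p).2 ≠ ⊤) (c r : ℕ) :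
    (trace R N s p).1 c r = ⊤ ↔ s.1 c r = ⊤ := by
  induction hp using Nat.decreasingInduction with
  | self => rw [trace_of_le s le_rfl]
  | of_succ p hp ih =>
    rw [trace_of_lt s hp] at h ⊢
    have h1 : (trace R N s (p + 1)).2 ≠ ⊤ := fun h1 => h (top_le_iff.1 (h1 ▸ snd_le_bumpAt))
    rw [← ih h1]
    unfold bumpAt at h ⊢
    split_ifs with ha
    · rw [if_pos ha] at h
      simp only [State.swap, setAt] at h ⊢
      split_ifs with hc
      · rw [hc.1, hc.2]
        exact ⟨fun h2 => absurd h2 h1, fun h2 => absurd h2 h⟩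
      · rfl
    · rfl

theorem snd_le_trace {R N p : ℕ} (s : State) (hp : p ≤ N) : s.2 ≤ (trace R N s p).2 := by
  induction hp using Nat.decreasingInduction with
  | self => rw [trace_of_le s le_rfl]
  | of_succ p hp ih =>
    rw [trace_of_lt s hp]
    exact ih.trans snd_le_bumpAt

/-! ### Undoing an insertion -/

theorem setAt_setAt (V : Arr) (c r : ℕ) (k l : WithTop ℕ) :
    setAt (setAt V c r k) c r l = setAt V c r l := by
  funext c' r'
  simp only [setAt]
  grind

theorem setAt_self (V : Arr) (c r : ℕ) : setAt V c r (V c r) = V := by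
  funext c' r'
  simp only [setAt]
  grind

/-- From a ready state with the support of `S` the insertion can be undone. -/
theorem exists_insertEntry_of_ready {S : Filling} {y p : ℕ} {M : ℕ} (hS : [] ∉ S)
    (hM : ∀ c r, val S c r ≠ ⊤ → c < M) (hR : 0 < S.length) (hp : p ≤ M * S.length)
    (h : Ready S.length p (val S, (y : WithTop ℕ))) :
    ∃ (T : Filling) (k : ℕ), Young T ∧ Fresh (val T) k ∧ T.map List.length = S.map List.length ∧
      insertEntry T k = insertScan (scanBoxes S.length p) S y := by
  obtain ⟨⟨V, x⟩, h1, h2⟩ := exists_trace_eq hR hp h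
  have hx : x ≠ ⊤ := by
    intro hx
    have := snd_le_trace (R := S.length) (V, x) hp
    rw [h2, hx] at this
    exact absurd (top_le_iff.1 this) WithTop.coe_ne_top
  obtain ⟨k, hk⟩ := WithTop.ne_top_iff_exists.1 hx
  have hk : x = (k : WithTop ℕ) := hk.symm
  subst hk
  have hsup : ∀ c r, V c r = ⊤ ↔ val S c r = ⊤ := by
    intro c r
    have := trace_support (R := S.length) (V, (k : WithTop ℕ)) hp
      (by rw [h2]; exact WithTop.coe_ne_top) c r
    rw [h2] at this
    exact this.symm
  obtain ⟨T, rfl, h3⟩ := exists_val_eq S V hsup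
  have hlen : T.length = S.length := by simpa using congrArg List.length h3
  have hTM : ∀ c r, val T c r ≠ ⊤ → c < M := fun c r hne =>
    hM c r fun h => hne ((hsup c r).2 h)
  refine ⟨T, k, ⟨h1.young, not_nil_mem_of_map_length_eq h3 hS⟩, h1.fresh, h3, ?_⟩
  rcases insertEntry_trace hTM k (p := p) (by rwa [hlen]) with
    ⟨S', y', g1, g2, g3⟩ | ⟨q, -, hq, S', y', g1, g2, g3, g4, g5, g6⟩
  · rw [hlen] at g1 g3
    have g4 := g1.symm.trans h2
    rw [Prod.mk.injEq] at g4
    have g5 : S' = S := eq_of_val_eq g4.1 (not_nil_mem_of_map_length_eq (g2.trans h3) hS) hS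
    have g6 : y' = y := by simpa using g4.2
    rw [g3, g5, g6]
  · rw [hlen] at g5
    have g7 := g5.symm.trans h2
    rw [Prod.mk.injEq] at g7
    exact absurd g7.2.symm WithTop.coe_ne_top

/-- Every admissible box of a Young composition tableau is created by an insertion. -/
theorem exists_insertEntry_eq {T' : Filling} (hT' : Young T') {b : NewBox} (hb : Corner T' b) :
    ∃ (T : Filling) (k : ℕ), Young T ∧ Fresh (val T) k ∧ insertEntry T k = (T', b) := by
  cases b with
  | endOfRow r =>
    obtain ⟨c, h1, h2, h3⟩ := hb
    obtain ⟨y, hy⟩ := WithTop.ne_top_iff_exists.1 h1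
    have hy' : val T' (c + 1) r = (y : WithTop ℕ) := hy.symm
    obtain ⟨row, h4, h5⟩ := entry_eq_some_iff.1 (val_eq_coe_iff.1 hy')
    rw [val_eq_top_iff, entry_of_row h4, List.getElem?_eq_none_iff] at h2
    have h6 : c + 1 < row.length := by
      by_contra hc
      rw [List.getElem?_eq_none (by omega)] at h5
      simp at h5
    have hrow : row = row.dropLast ++ [y] := by
      apply List.ext_getElem?
      intro i
      rcases lt_trichotomy i (c + 1) with hi | rfl | hi
      · rw [List.getElem?_append_left (by simp; omega), List.getElem?_dropLast, if_pos (by omega)]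
      · rw [h5, List.getElem?_append_right (by simp; omega)]
        have : c + 1 - row.dropLast.length = 0 := by simp; omega
        rw [this]
        rfl
      · rw [List.getElem?_eq_none (by omega), List.getElem?_eq_none (by simp; omega)]
    set S : Filling := T'.modify r List.dropLast with hS
    have hSr : S[r]? = some row.dropLast := by simp [hS, h4]
    have hadd : addBox S y (NewBox.endOfRow r) = T' := by
      apply List.ext_getElem?
      intro i
      simp only [addBox, hS, List.getElem?_modify]
      cases hi : T'[i]? with
      | none => rfl
      | some row' =>
        by_cases hri : r = i
        · subst hri
          rw [h4] at hi
          cases hi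
          simp [← hrow]
        · simp [hri]
    have hlenr : row.dropLast.length = c + 1 := by simp; omega
    have hval := val_addBox_endOfRow (k := y) hSr
    rw [hadd, hlenr] at hval
    have hSc : val S (c + 1) r = ⊤ := by
      rw [val_eq_top_iff, entry_of_row hSr, List.getElem?_eq_none (by omega)]
    have hvS : val S = setAt (val T') (c + 1) r ⊤ := by
      rw [hval, setAt_setAt, ← hSc, setAt_self]
    have hSnil : [] ∉ S := by
      intro hmem
      obtain ⟨i, hi⟩ := List.mem_iff_getElem?.1 hmem
      rw [hS, List.getElem?_modify] at hi
      cases hT'i : T'[i]? with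
      | none => simp [hT'i] at hi
      | some row' =>
        by_cases hri : r = i
        · subst hri
          rw [h4] at hT'i
          cases hT'i
          rw [h4] at hi
          have hi' : row.dropLast = [] := by
            simpa only [if_true, Option.map_eq_map, Option.map_some, Option.some.injEq] using hi
          rw [hi'] at hlenr
          simp at hlenr
        · simp [hT'i, hri] at hi
          exact hT'.2 (hi ▸ List.mem_of_getElem? hT'i)
    have hr : r < S.length := by
      rw [List.getElem?_eq_some_iff] at hSr
      exact hSr.1
    have hR : 0 < S.length := by omega
    have h2' : val T' (c + 2) r = ⊤ := by
      rw [val_eq_top_iff, entry_of_row h4, List.getElem?_eq_none (by omega)]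
    -- The box to be emptied has index `c * S.length + r`; the state with its entry `y` in hand is
    -- the one just before this box is scanned, hence the `+ 1`.
    have hready : Ready S.length (c * S.length + r + 1) (val S, (y : WithTop ℕ)) := by
      rw [ready_succ_iff hR, index_div hr, index_mod hr]
      have e1 : (y : WithTop ℕ) = val T' (c + 1) r := hy'.symm
      refine ⟨?_, ?_, ?_, ?_, fun c r hr => val_le_length hr⟩
      · rw [hvS]; exact hT'.1.remove h1 h2' h3
      · rw [hvS, e1]; exact Fresh.remove hT'.1
      · rw [hvS, e1]; exact fun r' hr' => not_admits_remove_after hT'.1 r' hr'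
      · rw [hvS, e1]; exact fun r' hr' => not_admits_remove_before hT'.1 h2' h3 r' hr'
    obtain ⟨M, hM⟩ := exists_bound S
    have hp : c * S.length + r + 1 ≤ (M + c + 1) * S.length := by
      have : (c + 1) * S.length ≤ (M + c + 1) * S.length := Nat.mul_le_mul_right _ (by omega)
      rw [add_mul c] at this
      omega
    obtain ⟨T, k, g1, g2, g3, g4⟩ :=
      exists_insertEntry_of_ready hSnil (hM (M + c + 1) (by omega)) hR hp hready
    refine ⟨T, k, g1, g2, ?_⟩
    rw [g4, scanBoxes_succ, index_div hr, index_mod hr, insertScan_cons_of_none, hadd]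
    · refine ⟨?_, by rw [hSc]; exact WithTop.coe_lt_top y⟩
      have := hT'.1.row c r
      rw [hvS]
      simp only [setAt]
      rw [if_neg (by simp), ← hy']
      exact (this.resolve_left h1).le
    · exact val_eq_top_iff.1 hSc
  | newRow p =>
    obtain ⟨h1, h2, h3⟩ := hb
    have hp : p < T'.length := (val_zero_ne_top_iff hT'.2).1 h1
    have h4 : T'[p]? = some T'[p] := List.getElem?_eq_getElem hp
    obtain ⟨y, hy⟩ : ∃ y, T'[p] = [y] := by
      rw [val_eq_top_iff, entry_of_row h4, List.getElem?_eq_none_iff] at h2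
      match h : T'[p] with
      | [] => exact absurd (h ▸ List.getElem_mem hp) hT'.2
      | [y] => exact ⟨y, rfl⟩
      | a :: b :: l => rw [h] at h2; simp at h2
    rw [hy] at h4
    set S : Filling := T'.eraseIdx p with hS
    have hSlen : S.length = T'.length - 1 := by simp [hS, List.length_eraseIdx, hp]
    have hadd : addBox S y (NewBox.newRow p) = T' := by
      simp only [addBox, hS, ← hy]
      exact List.insertIdx_eraseIdx_getElem hp
    have hy' : val T' 0 p = (y : WithTop ℕ) := by
      rw [val_eq_coe_iff, entry_of_row h4]; rfl
    have hvS : val S = delRow (val T') p := by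
      funext c r
      simp only [val, entry, delRow, hS, List.getElem?_eraseIdx]
      split_ifs <;> rfl
    have hSnil : [] ∉ S := fun h => hT'.2 (List.mem_of_mem_eraseIdx h)
    have hready : Ready S.length 0 (val S, (y : WithTop ℕ)) := by
      refine ⟨?_, ?_, fun c r hr _ hcr => ?_, fun c r hr => val_le_length hr⟩
      · rw [hvS]; exact hT'.1.delRow p
      · rw [hvS, ← hy']; exact Fresh.delRow hT'.1
      · have hc : c = 0 := by
          rcases Nat.eq_zero_or_pos c with h | h
          · exact h
          · have : 1 * S.length ≤ c * S.length := Nat.mul_le_mul_right _ h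
            omega
        rw [hc, hvS, ← hy']
        exact not_admits_delRow hT'.1 h2 h3 r
    have hpos : newRowPos S y = p := by
      apply newRowPos_eq hSnil
      · intro r hr
        rw [hvS, ← hy']
        simp only [delRow, hr, if_true]
        exact (hT'.1.col r p hr).resolve_left h1
      · rw [hvS, ← hy']
        simp only [delRow, lt_irrefl, if_false]
        rcases hT'.1.col p (p + 1) (Nat.lt_succ_self p) with h | h
        · rw [h]; exact not_top_lt
        · exact h.not_gt
    rcases Nat.eq_zero_or_pos S.length with hR | hR
    · have : S = [] := List.eq_nil_of_length_eq_zero hR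
      refine ⟨[], y, ⟨?_, by simp⟩, ?_, ?_⟩
      · rw [← this]; exact hready.young
      · rw [← this]; exact hready.fresh
      · rw [← hadd, ← hpos, this]; rfl
    · obtain ⟨M, hM⟩ := exists_bound S
      obtain ⟨T, k, g1, g2, g3, g4⟩ :=
        exists_insertEntry_of_ready hSnil (hM M le_rfl) hR (Nat.zero_le _) hready
      refine ⟨T, k, g1, g2, ?_⟩
      rw [g4]
      simp only [scanBoxes, List.range_zero, List.reverse_nil, List.map_nil, insertScan, hpos, hadd]

/-- The insertion is determined by its result and the created box. -/
theorem insertEntry_injective {T T' : Filling} (hT : Young T) (hT' : Young T') {k k' : ℕ}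
    (hk : Fresh (val T) k) (hk' : Fresh (val T') k')
    (h : insertEntry T k = insertEntry T' k') : T = T' ∧ k = k' := by
  obtain ⟨M₁, hM₁⟩ := exists_bound T
  obtain ⟨M₂, hM₂⟩ := exists_bound T'
  have hM : ∀ c r, val T c r ≠ ⊤ → c < max M₁ M₂ := hM₁ _ (le_max_left _ _)
  have hM' : ∀ c r, val T' c r ≠ ⊤ → c < max M₁ M₂ := hM₂ _ (le_max_right _ _)
  generalize max M₁ M₂ = M at hM hM'
  -- Two scans that pass through a common state with a finite letter in hand have the same start. It
  -- remains to recover from the result and the created box the last state before the box was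
  -- created.
  have fin : ∀ {p : ℕ} {s : State} (_ : T.length = T'.length) (_ : p ≤ M * T.length)
      (_ : s.2 ≠ ⊤), trace T.length (M * T.length) (val T, (k : WithTop ℕ)) p = s →
      trace T'.length (M * T'.length) (val T', (k' : WithTop ℕ)) p = s → T = T' ∧ k = k' := by
    intro p s hl hp hs h1 h2
    have key : ((val T, (k : WithTop ℕ)) : State) = (val T', (k' : WithTop ℕ)) := by
      rcases Nat.eq_zero_or_pos T.length with hR | hR
      · rw [trace_of_le _ (by simp [hR])] at h1
        rw [trace_of_le _ (by simp [← hl, hR])] at h2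
        rw [h1, h2]
      · have g1 := Ready.init hT hk hM
        have g2 := Ready.init hT' hk' hM'
        rw [← hl] at g2 h2
        exact trace_injective hR g1 g2 hp (by rw [h1]; exact hs) (h1.trans h2.symm)
    rw [Prod.mk.injEq] at key
    exact ⟨eq_of_val_eq key.1 hT.2 hT'.2, by simpa using key.2⟩
  rcases insertEntry_cases hT (k := k) hM with
    ⟨c, r, S, y, hr, hN, h1, h2, h3, h4, h5, h6, h7⟩ | ⟨S, y, h1, h2, h3, h4, hS⟩ <;>
  rcases insertEntry_cases hT' (k := k') hM' with
    ⟨c', r', S', y', hr', hN', h1', h2', h3', h4', h5', h6', h7'⟩ |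
    ⟨S', y', h1', h2', h3', h4', hS'⟩
  · rw [h4, h4', Prod.mk.injEq, NewBox.endOfRow.injEq] at h
    obtain ⟨h, rfl⟩ := h
    have hlen := congrArg (List.map List.length) h
    rw [map_length_addBox, map_length_addBox, h3, h3'] at hlen
    have hl : T.length = T'.length := by simpa [addLen] using congrArg List.length hlen
    have hc : c = c' := by
      have := congrArg (fun l => l[r]?) hlen
      simp only [addLen, List.getElem?_modify, h1, h1'] at this
      simpa using this
    subst hc
    have e := h5.symm.trans ((congrArg val h).trans h5')
    have t1 : val S (c + 1) r = ⊤ := by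
      by_contra hne
      obtain ⟨l, g1, g2⟩ := val_ne_top_iff.1 hne
      rw [h3, h1] at g1
      simp at g1
      omega
    have t2 : val S' (c + 1) r = ⊤ := by
      by_contra hne
      obtain ⟨l, g1, g2⟩ := val_ne_top_iff.1 hne
      rw [h3', h1'] at g1
      simp at g1
      omega
    have e1 : val S = val S' := by
      have := congrArg (fun V => setAt V (c + 1) r ⊤) e
      simp only [setAt_setAt] at this
      rwa [← t1, setAt_self, t1, ← t2, setAt_self] at this
    have e2 : (y : WithTop ℕ) = y' := by
      have := congrFun (congrFun e (c + 1)) r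
      simpa [setAt] using this
    refine fin hl hN WithTop.coe_ne_top h2 ?_
    rw [e1, e2, hl]
    exact h2'
  · rw [h4, h3', Prod.mk.injEq] at h
    exact absurd h.2 (by simp)
  · rw [h3, h4', Prod.mk.injEq] at h
    exact absurd h.2 (by simp)
  · rw [h3, h3', Prod.mk.injEq, NewBox.newRow.injEq] at h
    obtain ⟨h, hp⟩ := h
    simp only [addBox] at h
    rw [← hp] at h
    have g1 := (newRowPos_spec hS y).1
    have g2 := (newRowPos_spec hS' y').1
    rw [← hp] at g2
    have e1 := congrArg (fun l => l.eraseIdx (newRowPos S y)) h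
    simp only [List.eraseIdx_insertIdx_self] at e1
    have e2 := congrArg (fun l => l[newRowPos S y]?) h
    simp only [List.getElem?_insertIdx_self, g1, g2, if_true] at e2
    subst e1
    have e3 : y = y' := by simpa using e2
    subst e3
    have hl : T.length = T'.length := by
      simpa using congrArg List.length (h2.symm.trans h2')
    exact fin hl (Nat.zero_le _) WithTop.coe_ne_top h1 h1'

/-! ### Row bumping and the peak condition -/

section

/-- The column of the new box that is created in `T`. -/
def newCol (T : Filling) : NewBox → ℕ
  | NewBox.endOfRow r => ((T.map List.length)[r]?).getD 0
  | NewBox.newRow _ => 0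

/-- The column of the box created by the insertion of `k` into `T`. -/
def colAt (T : Filling) (k : ℕ) : ℕ := newCol T (insertEntry T k).2

variable {T : Filling} {k : ℕ}

/-- An insertion that ends at the right end of a row, as a scan. -/
theorem exists_scan (hT : Young T) (hk : Fresh (val T) k) (h0 : 0 < colAt T k) {M : ℕ}
    (hM : ∀ c r, val T c r ≠ ⊤ → c < M) :
    ∃ (c r : ℕ) (a : ℕ → WithTop ℕ), r < T.length ∧ c * T.length + r < M * T.length ∧
      colAt T k = c + 1 ∧ (insertEntry T k).2 = NewBox.endOfRow r ∧
      val T c r ≠ ⊤ ∧ (insertEntry T k).1.length = T.length ∧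
      Scan T.length (M * T.length) (val T) (val (insertEntry T k).1) a ∧
      a (M * T.length) = k ∧ a (c * T.length + r) = ⊤ ∧ a (c * T.length + r + 1) ≠ ⊤ ∧
      ∀ c r, r < T.length → c * T.length + r < M * T.length →
        val T (c + 1) r = a (c * T.length + r + 1) → a (c * T.length + r + 1) = ⊤ := by
  rcases insertEntry_cases hT (k := k) hM with
    ⟨c, r, S, y, hr, hN, h1, h2, h3, h4, h5, h6, h7⟩ | ⟨S, y, h1, h2, h3, h4, hS⟩
  · have hR : 0 < T.length := by omega
    have hs := scan_trace (s := (val T, (k : WithTop ℕ))) (N := M * T.length) hR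
    rw [h7 0 (Nat.zero_le _)] at hs
    refine ⟨c, r, _, hr, hN, ?_, by rw [h4], ?_, ?_, by rw [h4]; exact hs, ?_, ?_, ?_, ?_⟩
    · rw [colAt, h4, newCol, h1]; rfl
    · rw [val_ne_top_iff]
      exact ⟨_, h1, Nat.lt_succ_self c⟩
    · rw [h4]
      simpa [addBox] using congrArg List.length h3
    · show (trace _ _ _ _).2 = _
      rw [trace_of_le _ le_rfl]
    · show (trace _ _ _ _).2 = _
      rw [h7 _ le_rfl]
    · show (trace _ _ _ _).2 ≠ _
      rw [h2]; exact WithTop.coe_ne_top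
    · intro c' r' hr' hN' he
      have h8 := Ready.trace_of_bound hT hk hM hN'
      have h9 := trace_initial (R := T.length) (s := (val T, (k : WithTop ℕ))) (c := c' + 1)
        (r := r') hN' (by rw [add_mul]; omega)
      exact h8.fresh (c' + 1) r' (h9.trans he)
  · rw [colAt, h3] at h0
    simp [newCol] at h0

theorem Young.le_succ (hT : Young T) (c r : ℕ) : val T c r ≤ val T (c + 1) r := by
  rcases hT.1.row c r with h | h
  · rw [h]; exact le_top
  · exact h.le

theorem fresh_iff : Fresh (val T) (k : WithTop ℕ) ↔ ¬ IsEntry T k := by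
  rw [isEntry_iff]
  constructor
  · rintro h ⟨c, r, h1⟩
    exact WithTop.coe_ne_top (h c r h1)
  · intro h c r h1
    exact absurd ⟨c, r, h1⟩ h

/-- The bound leaves one spare column. There the first letter is still in hand unchanged, which
starts the comparison `Scan.bumping_lt` of indices that differ by a whole column. -/
theorem exists_common_bound (T T' : Filling) : ∃ M, (∀ c r, val T c r ≠ ⊤ → c + 1 < M) ∧
    ∀ c r, val T' c r ≠ ⊤ → c + 1 < M := by
  obtain ⟨M₁, h₁⟩ := exists_bound T
  obtain ⟨M₂, h₂⟩ := exists_bound T'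
  exact ⟨max M₁ M₂ + 1, fun c r h => Nat.succ_lt_succ (h₁ _ (le_max_left _ _) c r h),
    fun c r h => Nat.succ_lt_succ (h₂ _ (le_max_right _ _) c r h)⟩

theorem colAt_pos_of_scan_top {a : ℕ → WithTop ℕ} {M : ℕ} (hT : Young T)
    (hM : ∀ c r, val T c r ≠ ⊤ → c < M)
    (ha : ∀ p, a p = (trace T.length (M * T.length) (val T, (k : WithTop ℕ)) p).2)
    (h : a 0 = ⊤) : 0 < colAt T k := by
  rcases insertEntry_cases hT (k := k) hM with
    ⟨c, r, S, y, hr, hN, h1, h2, h3, h4, h5, h6, h7⟩ | ⟨S, y, h1, h2, h3, h4, hS⟩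
  · rw [colAt, h4, newCol, h1]; exact Nat.succ_pos c
  · rw [ha, h1] at h
    exact absurd h WithTop.coe_ne_top

/-- If `k < k'` are inserted in this order, the second new box is strictly right of the first. -/
theorem colAt_lt_colAt (hT : Young T) (hk : Fresh (val T) k) (h0 : 0 < colAt T k) {k' : ℕ} (hlt : k < k') :
    colAt T k < colAt (insertEntry T k).1 k' := by
  have hT1 := (insertEntry_young hT hk).1
  obtain ⟨M, hM, hM'⟩ := exists_common_bound T (insertEntry T k).1
  have hMl : ∀ c r, val T c r ≠ ⊤ → c < M := fun c r h => by have := hM c r h; omega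
  have hMl' : ∀ c r, val (insertEntry T k).1 c r ≠ ⊤ → c < M :=
    fun c r h => by have := hM' c r h; omega
  obtain ⟨c, r, a, hr, hN, h1, h2, h3, h4, h5, h6, h7, h8, -⟩ := exists_scan hT hk h0 hMl
  have hR : 0 < T.length := by omega
  have hcM := hM c r h3
  have hs := scan_trace (R := T.length) (s := (val (insertEntry T k).1, (k' : WithTop ℕ)))
    (N := M * T.length) hR
  have hle : c * T.length + r + T.length ≤ M * T.length := by
    have : (c + 2) * T.length ≤ M * T.length := Nat.mul_le_mul_right _ hcM
    rw [add_mul] at this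
    omega
  have h9 : a (M * T.length - T.length) = k := by
    rw [← h6]
    refine h5.letter_eq_of_top hR (q := M * T.length - T.length) ?_ (by omega) le_rfl
    intro c' r' hr' hq
    by_contra hne
    have := hM c' r' hne
    have : (c' + 2) * T.length ≤ M * T.length := Nat.mul_le_mul_right _ this
    rw [add_mul] at this
    omega
  have key := h5.bumping_lt hs hT.le_succ hR (by
    show _ ≤ (trace _ _ _ _).2
    rw [h9, trace_of_le _ le_rfl]
    exact WithTop.coe_le_coe.2 hlt.le) hle
  -- The first scan has ⊤ in hand at index `c * R + r`, so the second one has it already at the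
  -- index of the next column: its box was created further right.
  rw [h7, top_le_iff] at key
  have hpos : 0 < colAt (insertEntry T k).1 k' := by
    refine colAt_pos_of_scan_top hT1 hMl' (fun _ => rfl) ?_
    rw [h4]
    exact top_le_iff.1 (key ▸ hs.letter_mono hR (Nat.zero_le _) hle)
  rcases insertEntry_cases hT1 (k := k') hMl' with
    ⟨c', r', S, y, hr', hN', g1, g2, g3, g4, g5, g6, g7⟩ | ⟨S, y, g1, g2, g3, g4, hS⟩
  · rw [h1, colAt, g4, newCol, g1, Option.getD_some]
    rw [h4] at hr' hN' g2
    by_contra hc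
    have hc : c' * T.length ≤ c * T.length := Nat.mul_le_mul_right _ (by omega)
    have := hs.letter_mono hR (p := c * T.length + r + T.length) (q := c' * T.length + r' + 1)
    have h10 : (⊤ : WithTop ℕ) ≤ (trace T.length (M * T.length)
        (val (insertEntry T k).1, (k' : WithTop ℕ)) (c' * T.length + r' + 1)).2 := by
      rw [← key]
      exact hs.letter_mono hR (by omega) hle
    rw [g2, top_le_iff] at h10
    exact WithTop.coe_ne_top h10
  · rw [colAt, g3] at hpos
    simp [newCol] at hpos

/-- If `k > k'` are inserted in this order, the second new box is weakly left of the first. -/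
theorem colAt_le_colAt (hT : Young T) (hk : Fresh (val T) k) (h0 : 0 < colAt T k) {k' : ℕ}
    (hk' : Fresh (val (insertEntry T k).1) k') (hlt : k' < k) :
    colAt (insertEntry T k).1 k' ≤ colAt T k := by
  rcases Nat.eq_zero_or_pos (colAt (insertEntry T k).1 k') with h0' | h0'
  · omega
  have hT1 := (insertEntry_young hT hk).1
  obtain ⟨M, hM, hM'⟩ := exists_common_bound T (insertEntry T k).1
  have hMl : ∀ c r, val T c r ≠ ⊤ → c < M := fun c r h => by have := hM c r h; omega
  have hMl' : ∀ c r, val (insertEntry T k).1 c r ≠ ⊤ → c < M :=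
    fun c r h => by have := hM' c r h; omega
  obtain ⟨c, r, a, hr, hN, h1, h2, h3, h4, h5, h6, h7, h8, h9⟩ := exists_scan hT hk h0 hMl
  obtain ⟨c', r', b, hr', hN', g1, g2, g3, g4, g5, g6, g7, g8, g9⟩ :=
    exists_scan hT1 hk' h0' hMl'
  have hR : 0 < T.length := by omega
  rw [h4] at hr' hN' g4 g5 g6 g7 g8
  have key := h5.bumping_gt g5 h9 hR
    (by rw [h6, g6]; exact WithTop.coe_lt_coe.2 hlt) (p := c' * T.length + r') hN'.le
  -- When the second scan has ⊤ in hand, so has the first. The first new box was therefore created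
  -- at the same index or at a larger one.
  rw [g7] at key
  have key : a (c' * T.length + r') = ⊤ := key.resolve_left not_top_lt
  rw [h1, g1]
  by_contra hc
  have hc : (c + 1) * T.length ≤ c' * T.length := Nat.mul_le_mul_right _ (by omega)
  rw [add_mul] at hc
  have := h5.letter_mono hR (p := c' * T.length + r') (q := c * T.length + r + 1)
    (by omega) hN'.le
  rw [key, top_le_iff] at this
  exact h8 this

/-- Inserting a letter smaller than all entries. -/
theorem insertEntry_min (hT : Young T) (hk : ∀ x, IsEntry T x → k < x) :
    insertEntry T k = ([k] :: T, NewBox.newRow 0) := by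
  obtain ⟨M, hM⟩ := exists_bound T
  have hlt : ∀ c r, ¬ val T c r ≤ k := by
    intro c r h
    obtain ⟨x, hx⟩ := WithTop.ne_top_iff_exists.1 (h.trans_lt (WithTop.coe_lt_top k)).ne
    have hx : val T c r = (x : WithTop ℕ) := hx.symm
    have := hk x (isEntry_iff.2 ⟨c, r, hx⟩)
    rw [hx] at h
    have : x ≤ k := WithTop.coe_le_coe.1 h
    omega
  have h1 := insertScan_append_of_not_admits (scanBoxes T.length (M * T.length)) [] T k (by
    intro b hb
    simp only [scanBoxes, List.mem_map] at hb
    obtain ⟨q, -, rfl⟩ := hb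
    exact ⟨Nat.succ_pos _, fun h => hlt _ _ h.1⟩)
  rw [List.append_nil] at h1
  have h2 : newRowPos T k = 0 :=
    newRowPos_eq hT.2 (by simp) fun h => hlt _ _ h.le
  rw [insertEntry_eq (hM M le_rfl), h1, insertScan, h2]
  rfl

/-- A letter larger than the entry of a bottom row with a single box does not create a row. -/
theorem colAt_pos_of_single {z : ℕ} (hT : Young ([z] :: T)) (hk : Fresh (val ([z] :: T)) k)
    (hz : z < k) : 0 < colAt ([z] :: T) k := by
  obtain ⟨M, hM⟩ := exists_bound ([z] :: T)
  have hM := hM M le_rfl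
  rcases insertEntry_cases hT (k := k) hM with
    ⟨c, r, S, y, hr, hN, h1, h2, h3, h4, h5, h6, h7⟩ | ⟨S, y, h1, h2, h3, h4, hS⟩
  · rw [colAt, h4, newCol, h1]; exact Nat.succ_pos c
  · exfalso
    have h8 := Ready.trace_of_bound hT hk hM (p := 0) (Nat.zero_le _)
    have h9 := h8.not_admits_zero 0
    have h10 := snd_le_trace (R := ([z] :: T).length) (val ([z] :: T), (k : WithTop ℕ))
      (Nat.zero_le (M * ([z] :: T).length))
    have h11 := trace_col_zero (R := ([z] :: T).length) (s := (val ([z] :: T), (k : WithTop ℕ)))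
      (Nat.zero_le (M * ([z] :: T).length)) 0
    rw [h1] at h9 h10 h11
    refine h9 ⟨?_, ?_⟩
    · rw [h11]
      exact (WithTop.coe_le_coe.2 hz.le).trans h10
    · have : val S 1 0 = ⊤ := by
        by_contra hne
        obtain ⟨l, g1, g2⟩ := val_ne_top_iff.1 hne
        rw [h2] at g1
        simp at g1
        omega
      show (y : WithTop ℕ) < val S (0 + 1) 0
      rw [zero_add, this]
      exact WithTop.coe_lt_top y

/-- Inserting the second smallest letter into a tableau with the smallest letter alone in the
bottom row. -/
theorem insertEntry_second {z : ℕ} (hz : z < k) (hk : ∀ x, IsEntry T x → k < x) :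
    insertEntry ([z] :: T) k = ([z, k] :: T, NewBox.endOfRow 0) := by
  obtain ⟨M, hM⟩ := exists_bound ([z] :: T)
  have hlt : ∀ c r, val ([z] :: T) c r ≤ k → c = 0 ∧ r = 0 := by
    intro c r h
    obtain ⟨x, hx⟩ := WithTop.ne_top_iff_exists.1 (h.trans_lt (WithTop.coe_lt_top k)).ne
    have hx : val ([z] :: T) c r = (x : WithTop ℕ) := hx.symm
    rw [hx] at h
    have hxk : x ≤ k := WithTop.coe_le_coe.1 h
    cases r with
    | zero =>
      rw [val_eq_coe_iff] at hx
      cases c with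
      | zero => exact ⟨rfl, rfl⟩
      | succ c => simp [entry] at hx
    | succ r =>
      rw [val_cons_succ] at hx
      have := hk x (isEntry_iff.2 ⟨c, r, hx⟩)
      omega
  have hM := hM (M + 1) (by omega)
  rw [insertEntry_eq hM]
  set R := ([z] :: T).length with hR
  have hR0 : 0 < R := by simp [hR]
  -- Index 0, the second box of the bottom row, is scanned last and is split off: only there is the
  -- left neighbour, `z`, at most `k`.
  have h1 : (M + 1) * R = 1 + ((M + 1) * R - 1) := by
    have : 1 * R ≤ (M + 1) * R := Nat.mul_le_mul_right _ (by omega)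
    omega
  rw [h1, scanBoxes_add, insertScan_append_of_not_admits, scanBoxes_succ, Nat.zero_div,
    Nat.zero_mod, insertScan_cons_of_none]
  · rfl
  · refine ⟨WithTop.coe_le_coe.2 hz.le, ?_⟩
    have : val ([z] :: T) (0 + 1) 0 = ⊤ := rfl
    rw [this]
    exact WithTop.coe_lt_top k
  · rfl
  · intro b hb
    simp only [List.mem_map, List.mem_reverse, List.mem_range] at hb
    obtain ⟨i, hi, rfl⟩ := hb
    refine ⟨Nat.succ_pos _, fun h => ?_⟩
    obtain ⟨h2, h3⟩ := hlt _ _ h.1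
    have := index_div_mod (R := R) (1 + i)
    simp only [Nat.add_sub_cancel] at h2 h3
    rw [h2, h3] at this
    omega

/-! ### The peak condition -/

/-- The peak condition in terms of the first two columns. -/
def PeakCols (T : Filling) : Prop := ∀ r, val T 0 (r + 1) ≠ ⊤ → val T 1 r < val T 0 (r + 1)

/-- Without a new row the first column stays as it is and every other entry can only decrease. -/
theorem PeakCols.insertEntry (hT : Young T) (hk : Fresh (val T) k) (h0 : 0 < colAt T k)
    (h : PeakCols T) : PeakCols (insertEntry T k).1 := by
  obtain ⟨M, hM⟩ := exists_bound T
  obtain ⟨c, r, a, -, -, -, -, -, -, h5, -⟩ := exists_scan hT hk h0 (hM M le_rfl)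
  intro r hr
  rw [h5.col_zero] at hr ⊢
  exact (h5.le 1 r).trans_lt (h r hr)

/-- An insertion that ends right of the second column does not affect the peak condition. -/
theorem peakCols_insertEntry_iff (hT : Young T) (hk : Fresh (val T) k) (h0 : 1 < colAt T k) :
    PeakCols (insertEntry T k).1 ↔ PeakCols T := by
  obtain ⟨M, hM⟩ := exists_bound T
  obtain ⟨c, r, a, hr, hN, h1, -, -, -, h5, -, h7, -⟩ :=
    exists_scan hT hk (by omega) (hM M le_rfl)
  have hR : 0 < T.length := by omega
  have hc : T.length ≤ c * T.length := by
    have : 1 * T.length ≤ c * T.length := Nat.mul_le_mul_right _ (by omega)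
    omega
  -- The second column has the indices below `R`. They come after the index at which the letter
  -- became ⊤, so nothing happens there.
  have key : ∀ r', val (insertEntry T k).1 1 r' = val T 1 r' := by
    intro r'
    by_cases hr' : r' < T.length
    · rcases h5.step (c := 0) hr' (by omega) with h | h
      · have := h5.letter_mono hR (q := 0 * T.length + r' + 1) (p := c * T.length + r)
          (by omega) hN.le
        rw [h7, top_le_iff] at this
        rw [this] at h
        exact absurd h.2.1 not_top_lt
      · exact h.2.1
    · exact h5.outside 0 r' (Or.inl (by omega))
  unfold PeakCols
  simp only [h5.col_zero, key]

/-- If `T` is nonempty, the peak condition on the result forces the bottom row to get a second box,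
which holds the final letter `a 1`. So `k ≤ a 1`, and `a 1` is smaller than the first entry of `T`.
Any earlier exchange in the second column would have placed a still smaller letter to the right of a
first-column entry of `T`; hence the second column of `T` is unchanged. -/
theorem peakCols_of_insertEntry_second {z : ℕ} (hT : Young ([z] :: T))
    (hk : Fresh (val ([z] :: T)) k) (hz : z < k) (h : PeakCols (insertEntry ([z] :: T) k).1) :
    PeakCols T ∧ (k < val T 0 0) := by
  obtain ⟨M, hM⟩ := exists_bound ([z] :: T)
  obtain ⟨c, r, a, hr, hN, -, -, -, -, h5, h6, h7, -⟩ :=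
    exists_scan hT hk (colAt_pos_of_single hT hk hz) (hM M le_rfl)
  set B := val (insertEntry ([z] :: T) k).1 with hB
  set R := ([z] :: T).length with hR
  have hR0 : 0 < R := by simp [hR]
  have hT' := (insertEntry_young hT hk).1.1
  by_cases hT0 : val T 0 0 = ⊤
  · refine ⟨fun r hr => ?_, by rw [hT0]; exact WithTop.coe_lt_top k⟩
    have : val ([z] :: T) 0 (0 + 1) = ⊤ := hT0
    have h8 := hT.1.col 1 (r + 1 + 1) (by omega)
    rw [zero_add] at this
    rw [this] at h8
    exact absurd (h8.resolve_right not_top_lt) hr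
  have hb1 : B 1 0 < val T 0 0 := by
    have := h 0
    rw [← hB, h5.col_zero] at this
    exact this hT0
  have hcol : ∀ r, val T 0 0 ≤ val T 0 r := by
    intro r
    cases r with
    | zero => exact le_rfl
    | succ r =>
      rcases hT.1.col 1 (r + 1 + 1) (by omega) with h | h
      · rw [val_cons_succ] at h
        rw [h]; exact le_top
      · exact h.le
  have hNpos : 0 < M * R := by omega
  have e1 := h5.step (c := 0) (r := 0) hR0 (by omega)
  have h10 : val ([z] :: T) (0 + 1) 0 = ⊤ := rfl
  have hb1' : B 1 0 = a 1 := by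
    rcases e1 with e1 | e1
    · simpa using e1.2.2.1
    · rw [h10] at e1
      rw [zero_add] at e1
      rw [e1.2.1] at hb1
      exact absurd hb1 not_top_lt
  have hstep : ∀ r, B 1 (r + 1) = val T 1 r := by
    intro r
    by_cases hr : r + 1 < R
    · by_cases hN : 0 * R + (r + 1) < M * R
      · rcases h5.step (c := 0) hr hN with e | e
        · exfalso
          have h11 : B 1 (r + 1) ≤ B 1 0 := by
            rw [hb1']
            refine e.2.2.1.le.trans (h5.letter_mono hR0 (by omega) ?_)
            omega
          have h12 := h11.trans_lt (hb1.trans_le (hcol r))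
          have h13 := hT'.row 0 (r + 1)
          rw [← hB, h5.col_zero] at h13
          rcases h13 with h13 | h13
          · rw [zero_add] at h13
            rw [h13] at h12
            exact not_top_lt h12
          · exact absurd (h12.trans h13) (lt_irrefl _)
        · exact e.2.1
      · exact h5.outside 0 (r + 1) (Or.inr (by omega))
    · exact h5.outside 0 (r + 1) (Or.inl (by omega))
  refine ⟨fun r hr => ?_, ?_⟩
  · have := h (r + 1)
    rw [← hB, h5.col_zero, hstep] at this
    exact this hr
  · refine lt_of_le_of_lt ?_ hb1
    rw [hb1', ← h6]
    exact h5.letter_mono hR0 hNpos le_rfl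

end

/-! ### The relative position of two consecutive letters -/

section

/-- During a scan, `y` stays weakly left of `x`. -/
structure KeepsLeft (R p : ℕ) (x y : WithTop ℕ) (s : State) : Prop where
  both : ∀ c r c' r', s.1 c r = x → s.1 c' r' = y → c' ≤ c
  low : s.2 = x → ∀ c r, s.1 c r = y → c * R + r < p + R
  high : s.2 = y → ∀ c r, s.1 c r = x → p ≤ c * R

/-- During a scan, `y` stays strictly right of `x`. -/
structure KeepsRight (R p : ℕ) (x y : WithTop ℕ) (s : State) : Prop where
  both : ∀ c r c' r', s.1 c r = x → s.1 c' r' = y → c < c'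
  low : s.2 = x → ∀ c r, s.1 c r = y → p + R ≤ c * R
  high : s.2 = y → ∀ c r, s.1 c r = x → c * R + r < p

theorem setAt_eq_iff {V : Arr} {c r c' r' : ℕ} {k x : WithTop ℕ} : setAt V c r k c' r' = x ↔
    (c' = c ∧ r' = r ∧ k = x) ∨ (¬ (c' = c ∧ r' = r) ∧ V c' r' = x) := by
  simp only [setAt]
  grind

theorem lt_of_mul_lt {R c c' r : ℕ} (hr : r < R) (h : c * R < c' * R + r + 1) : c ≤ c' := by
  by_contra hc
  have : (c' + 1) * R ≤ c * R := Nat.mul_le_mul_right _ (by omega)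
  rw [add_mul] at this
  omega

theorem mul_le_of_lt {R c c' : ℕ} (h : c < c') : c * R + R ≤ c' * R := by
  have : (c + 1) * R ≤ c' * R := Nat.mul_le_mul_right _ h
  rwa [add_mul, one_mul] at this

variable {R c₀ r₀ : ℕ} {V : Arr} {k x y : WithTop ℕ}

/-- While `x` is in hand, `low` says that the box of `y` is not yet scanned or lies in the first
column. The scan cannot pass that box with `x` still in hand: the left neighbour of `y` is below
`y`, hence at most `x` by `hcov`, so the box admits `x`. -/
theorem KeepsLeft.skip (h : KeepsLeft R (c₀ * R + r₀ + 1) x y (V, k)) (hr₀ : r₀ < R)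
    (hV : YoungArr V) (hR : ∀ c r, R ≤ r → V c r = ⊤) (hxy : x < y) (hy : y ≠ ⊤)
    (hcov : ∀ z, z < y → z ≤ x) (ha : ¬ Admits V k c₀ r₀) :
    KeepsLeft R (c₀ * R + r₀) x y (V, k) := by
  obtain ⟨h1, h2, h3⟩ := h
  refine ⟨h1, fun hk c r hc => ?_, fun hk c r hc => by have := h3 hk c r hc; omega⟩
  have h4 := h2 hk c r hc
  by_contra h5
  have hr : r < R := by
    by_contra hr
    exact hy (hc.symm.trans (hR c r (by omega)))
  have h6 : c * R + r = (c₀ + 1) * R + r₀ := by rw [add_mul]; omega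
  have h7 := congrArg (· / R) h6
  have h8 := congrArg (· % R) h6
  simp only [index_div hr, index_div hr₀, index_mod hr, index_mod hr₀] at h7 h8
  subst h7 h8
  have hc : V (c₀ + 1) r = y := hc
  have hk : k = x := hk
  have h9 := (hV.row c₀ r).resolve_left (by rw [hc]; exact hy)
  rw [hc] at h9
  exact ha ⟨hk ▸ hcov _ h9, by rw [hc, hk]; exact hxy⟩

theorem KeepsLeft.swap (h : KeepsLeft R (c₀ * R + r₀ + 1) x y (V, k)) (hr₀ : r₀ < R)
    (hV : YoungArr V) (hR : ∀ c r, R ≤ r → V c r = ⊤) (hxy : x < y) (hy : y ≠ ⊤)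
    (hcov : ∀ z, z < y → z ≤ x) (ha : Admits V k c₀ r₀) :
    KeepsLeft R (c₀ * R + r₀) x y (setAt V (c₀ + 1) r₀ k, V (c₀ + 1) r₀) := by
  obtain ⟨h1, h2, h3⟩ := h
  obtain ⟨ha1, ha2⟩ := ha
  simp only at h1 h2 h3
  have hx : x ≠ ⊤ := (hxy.trans_le le_top).ne
  refine ⟨fun c r c' r' hc hc' => ?_, fun hk c r hc => ?_, fun hk c r hc => ?_⟩
  · simp only [setAt_eq_iff] at hc hc'
    rcases hc with ⟨rfl, rfl, rfl⟩ | ⟨-, hc⟩ <;> rcases hc' with ⟨rfl, rfl, rfl⟩ | ⟨-, hc'⟩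
    · exact le_rfl
    · have h4 := h2 rfl c' r' hc'
      refine lt_of_mul_lt (r := r) hr₀ ?_
      rw [add_mul]; omega
    · have h4 := h3 rfl c r hc
      by_contra h5
      have : c * R ≤ c₀ * R := Nat.mul_le_mul_right _ (by omega)
      omega
    · exact h1 c r c' r' hc hc'
  · simp only [setAt_eq_iff] at hk hc
    rcases hc with ⟨rfl, rfl, rfl⟩ | ⟨hne, hc⟩
    · rw [hk] at ha2
      exact absurd ha2 hxy.not_gt
    · have hr : r < R := by
        by_contra hr
        exact hy (hc.symm.trans (hR c r (by omega)))
      have h4 := h1 _ _ _ _ hk hc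
      rcases Nat.lt_or_ge c (c₀ + 1) with h5 | h5
      · have : c * R ≤ c₀ * R := Nat.mul_le_mul_right _ (by omega)
        omega
      · have h6 : c = c₀ + 1 := by omega
        subst h6
        rw [add_mul, one_mul]
        suffices r < r₀ by omega
        rcases lt_trichotomy r r₀ with h7 | rfl | h7
        · exact h7
        · exact absurd (hk.symm.trans hc) hxy.ne
        -- If `y` were above `x` in the same column, its left neighbour would be below `x`, and the
        -- triple condition would give `y ≤ x`.
        · exfalso
          have h8 := hV.row c₀ r
          rw [hc] at h8
          have h9 := hcov _ (h8.resolve_left hy)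
          have h10 : V c₀ r ≠ x := by
            intro h10
            have := (hV.inj c₀ r (c₀ + 1) r₀ (h10.trans hk.symm)).resolve_left
              (by rw [h10]; exact hx)
            omega
          have h11 := hV.triple c₀ r r₀ h7 (hk ▸ lt_of_le_of_ne h9 h10)
          rw [hc, hk] at h11
          exact absurd hxy h11.not_gt
  · simp only [setAt_eq_iff] at hk hc
    have key : c₀ + 1 ≤ c := by
      rcases hc with ⟨rfl, rfl, rfl⟩ | ⟨hne, hc⟩
      · exact le_rfl
      · exact h1 _ _ _ _ hc hk
    have := mul_le_of_lt (R := R) (c := c₀) (c' := c) (by omega)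
    omega

/-- While `y` is in hand, `high` says that the box to the right of `x` is not yet scanned. That box
holds a value above `x`, hence at least `y` by `hcov`, and `y` itself is not in the array; so the
box admits `y` and the scan cannot pass it. -/
theorem KeepsRight.skip (h : KeepsRight R (c₀ * R + r₀ + 1) x y (V, k)) (hr₀ : r₀ < R)
    (hV : YoungArr V) (hk' : Fresh V k) (hR : ∀ c r, R ≤ r → V c r = ⊤) (hxy : x < y)
    (hy : y ≠ ⊤) (hcov : ∀ z, z < y → z ≤ x) (ha : ¬ Admits V k c₀ r₀) :
    KeepsRight R (c₀ * R + r₀) x y (V, k) := by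
  obtain ⟨h1, h2, h3⟩ := h
  simp only at h1 h2 h3
  have hx : x ≠ ⊤ := (hxy.trans_le le_top).ne
  refine ⟨h1, fun hk c r hc => by have := h2 hk c r hc; omega, fun hk c r hc => ?_⟩
  simp only at hk hc
  have h4 := h3 hk c r hc
  by_contra h5
  have hr : r < R := by
    by_contra hr
    exact hx (hc.symm.trans (hR c r (by omega)))
  have h6 : c * R + r = c₀ * R + r₀ := by omega
  have h7 := congrArg (· / R) h6
  have h8 := congrArg (· % R) h6
  simp only [index_div hr, index_div hr₀, index_mod hr, index_mod hr₀] at h7 h8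
  subst h7 h8
  have h9 := hV.row c r
  rw [hc] at h9
  refine ha ⟨by rw [hc, hk]; exact hxy.le, lt_of_le_of_ne ?_ ?_⟩
  · rcases h9 with h9 | h9
    · rw [h9]; exact le_top
    · by_contra h10
      exact absurd (hcov _ (hk ▸ not_le.1 h10)) (not_le.2 h9)
  · intro h10
    exact hy (hk ▸ hk' (c + 1) r h10.symm)

theorem KeepsRight.swap (h : KeepsRight R (c₀ * R + r₀ + 1) x y (V, k)) (hr₀ : r₀ < R)
    (hV : YoungArr V) (hR : ∀ c r, R ≤ r → V c r = ⊤) (hxy : x < y) (hy : y ≠ ⊤)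
    (hcov : ∀ z, z < y → z ≤ x) (ha : Admits V k c₀ r₀) :
    KeepsRight R (c₀ * R + r₀) x y (setAt V (c₀ + 1) r₀ k, V (c₀ + 1) r₀) := by
  obtain ⟨h1, h2, h3⟩ := h
  obtain ⟨ha1, ha2⟩ := ha
  simp only at h1 h2 h3
  have hx : x ≠ ⊤ := (hxy.trans_le le_top).ne
  refine ⟨fun c r c' r' hc hc' => ?_, fun hk c r hc => ?_, fun hk c r hc => ?_⟩
  · simp only [setAt_eq_iff] at hc hc'
    rcases hc with ⟨rfl, rfl, rfl⟩ | ⟨-, hc⟩ <;> rcases hc' with ⟨rfl, rfl, rfl⟩ | ⟨-, hc'⟩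
    · exact absurd hxy (lt_irrefl _)
    · have h4 := h2 rfl c' r' hc'
      by_contra h5
      have : c' * R ≤ (c₀ + 1) * R := Nat.mul_le_mul_right _ (by omega)
      rw [add_mul] at this
      omega
    · have h4 := h3 rfl c r hc
      have := lt_of_mul_lt (c := c) (c' := c₀) hr₀ (by omega)
      omega
    · exact h1 c r c' r' hc hc'
  · simp only [setAt_eq_iff] at hk hc
    rcases hc with ⟨rfl, rfl, rfl⟩ | ⟨hne, hc⟩
    · rw [hk] at ha2
      exact absurd ha2 hxy.not_gt
    · have h4 := h1 _ _ _ _ hk hc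
      have := mul_le_of_lt (R := R) h4
      rw [add_mul] at this
      omega
  · simp only [setAt_eq_iff] at hk hc
    have hkx : k ≠ x := by
      rintro rfl
      have := h2 rfl _ _ hk
      rw [add_mul] at this
      omega
    rcases hc with ⟨-, -, hc⟩ | ⟨hne, hc⟩
    · exact absurd hc hkx
    · have h4 := h1 _ _ _ _ hc hk
      rcases Nat.lt_or_ge c c₀ with h5 | h5
      · by_cases hr : r < R
        · have := mul_le_of_lt (R := R) h5
          omega
        · exact absurd (hc.symm.trans (hR c r (by omega))) hx
      · have h6 : c = c₀ := by omega
        subst h6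
        suffices r < r₀ by omega
        have h7 : k < x := lt_of_le_of_ne (hcov _ (hk ▸ ha2)) hkx
        rcases lt_trichotomy r r₀ with h8 | rfl | h8
        · exact h8
        · rw [hc] at ha1
          exact absurd h7 ha1.not_gt
        -- If `x` were in the column to the left and in a higher row, the triple condition would
        -- bound its right neighbour by `y`. No value lies between `x` and `y`, so `y` would occur
        -- twice.
        · exfalso
          have h9 := hV.triple c r r₀ h8 (by rw [hc, hk]; exact hxy)
          rw [hk] at h9
          have h10 := hV.row c r
          rw [hc] at h10
          rcases h10 with h10 | h10
          · rw [h10, top_le_iff] at h9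
            exact hy h9
          · have h11 : V (c + 1) r = y := by
              refine le_antisymm h9 (not_lt.1 fun h12 => ?_)
              exact absurd (hcov _ h12) (not_le.2 h10)
            have := (hV.inj _ _ _ _ (h11.trans hk.symm)).resolve_left (by rw [h11]; exact hy)
            omega

theorem KeepsLeft.trace {N p : ℕ} {s : State} (h : KeepsLeft R N x y s) (hR : 0 < R)
    (hs : Ready R N s) (hxy : x < y) (hy : y ≠ ⊤) (hcov : ∀ z, z < y → z ≤ x) (hp : p ≤ N) :
    KeepsLeft R p x y (trace R N s p) := by
  induction hp using Nat.decreasingInduction with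
  | self => rwa [trace_of_le s le_rfl]
  | of_succ p hp ih =>
    have h1 := ready_trace hR hs hp
    rw [trace_of_lt s hp]
    have e := index_div_mod (R := R) p
    have hm := Nat.mod_lt p hR
    have key := ih
    rw [← e] at ih
    by_cases ha : Admits (PeakTableaux.trace R N s (p + 1)).1 (PeakTableaux.trace R N s (p + 1)).2
      (p / R) (p % R)
    · rw [bumpAt_admits ha]
      have := KeepsLeft.swap (V := (PeakTableaux.trace R N s (p + 1)).1)
        (c₀ := p / R) (r₀ := p % R) (by rw [e]; exact key) hm h1.young h1.top hxy hy hcov ha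
      rwa [e] at this
    · rw [bumpAt_not_admits ha]
      have := KeepsLeft.skip (V := (PeakTableaux.trace R N s (p + 1)).1)
        (c₀ := p / R) (r₀ := p % R) (by rw [e]; exact key) hm h1.young h1.top hxy hy hcov ha
      rwa [e] at this

theorem KeepsRight.trace {N p : ℕ} {s : State} (h : KeepsRight R N x y s) (hR : 0 < R)
    (hs : Ready R N s) (hxy : x < y) (hy : y ≠ ⊤) (hcov : ∀ z, z < y → z ≤ x) (hp : p ≤ N) :
    KeepsRight R p x y (trace R N s p) := by
  induction hp using Nat.decreasingInduction with
  | self => rwa [trace_of_le s le_rfl]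
  | of_succ p hp ih =>
    have h1 := ready_trace hR hs hp
    rw [trace_of_lt s hp]
    have e := index_div_mod (R := R) p
    have hm := Nat.mod_lt p hR
    by_cases ha : Admits (PeakTableaux.trace R N s (p + 1)).1 (PeakTableaux.trace R N s (p + 1)).2
      (p / R) (p % R)
    · rw [bumpAt_admits ha]
      have := KeepsRight.swap (V := (PeakTableaux.trace R N s (p + 1)).1)
        (c₀ := p / R) (r₀ := p % R) (by rw [e]; exact ih) hm h1.young h1.top hxy hy hcov ha
      rwa [e] at this
    · rw [bumpAt_not_admits ha]
      have := KeepsRight.skip (V := (PeakTableaux.trace R N s (p + 1)).1)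
        (c₀ := p / R) (r₀ := p % R) (by rw [e]; exact ih) hm h1.young h1.fresh h1.top hxy hy
          hcov ha
      rwa [e] at this

/-- `i + 1` is weakly left of `i`, if both occur. -/
def WeaklyLeft (T : Filling) (i : ℕ) : Prop :=
  ∀ c r c' r', entry T c r = some i → entry T c' r' = some (i + 1) → c' ≤ c

/-- `i + 1` is strictly right of `i`, if both occur. -/
def RightOf (T : Filling) (i : ℕ) : Prop :=
  ∀ c r c' r', entry T c r = some i → entry T c' r' = some (i + 1) → c < c'

theorem coe_succ_cover (i : ℕ) (z : WithTop ℕ) (h : z < ((i + 1 : ℕ) : WithTop ℕ)) :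
    z ≤ (i : WithTop ℕ) := by
  obtain ⟨z, rfl⟩ := WithTop.ne_top_iff_exists.1 (h.trans_le le_top).ne
  have h : z < i + 1 := WithTop.coe_lt_coe.1 h
  exact WithTop.coe_le_coe.2 (Nat.lt_succ_iff.1 h)

theorem insRow_eq_coe {V : Arr} {q c r : ℕ} {y : WithTop ℕ} {x : ℕ}
    (h : insRow V q y c r = (x : WithTop ℕ)) : (c = 0 ∧ y = x) ∨ ∃ r', V c r' = x := by
  simp only [insRow] at h
  split_ifs at h with h1 h2 h3
  · exact Or.inr ⟨_, h⟩
  · exact Or.inl ⟨h3, h⟩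
  · exact absurd h.symm WithTop.coe_ne_top
  · exact Or.inr ⟨_, h⟩

/-- The proviso `hi` excludes that `i + 1` arrives when `i` is already present;
`RightOf.insertEntry` covers that order of arrival. -/
theorem WeaklyLeft.insertEntry {T : Filling} {k i : ℕ} (hT : Young T) (hk : Fresh (val T) k)
    (h : WeaklyLeft T i) (hi : k = i + 1 → ¬ IsEntry T i) :
    WeaklyLeft (insertEntry T k).1 i := by
  obtain ⟨M, hM⟩ := exists_bound T
  have hM := hM M le_rfl
  have hxy : ((i : ℕ) : WithTop ℕ) < ((i + 1 : ℕ) : WithTop ℕ) :=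
    WithTop.coe_lt_coe.2 (Nat.lt_succ_self i)
  rcases Nat.eq_zero_or_pos T.length with hR | hR
  · have : T = [] := List.eq_nil_of_length_eq_zero hR
    subst this
    have e : PeakTableaux.insertEntry [] k = ([[k]], NewBox.newRow 0) := rfl
    intro c r c' r' h1 h2
    rw [e] at h2
    cases c' with
    | zero => exact Nat.zero_le _
    | succ c' => cases r' <;> simp [entry] at h2
  have hinit : KeepsLeft T.length (M * T.length) (i : WithTop ℕ) ((i + 1 : ℕ) : WithTop ℕ)
      (val T, (k : WithTop ℕ)) := by
    refine ⟨fun c r c' r' h1 h2 => h c r c' r' (val_eq_coe_iff.1 h1) (val_eq_coe_iff.1 h2),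
      fun _ c r h1 => ?_, fun h1 c r h2 => ?_⟩
    · have hne : val T c r ≠ ⊤ := fun h0 => WithTop.coe_ne_top (h1.symm.trans h0)
      have h2 := mul_le_of_lt (R := T.length) (hM c r hne)
      have h3 : r < T.length := by
        by_contra h3
        exact hne (val_le_length (by omega))
      omega
    · have h1 : k = i + 1 := WithTop.coe_inj.1 h1
      exact absurd (isEntry_iff.2 ⟨c, r, h2⟩) (hi h1)
  have key := hinit.trace hR (Ready.init hT hk hM) hxy WithTop.coe_ne_top (coe_succ_cover i)
    (Nat.zero_le _)
  rcases insertEntry_cases hT (k := k) hM with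
    ⟨c, r, S, y, hr, hN, h1, h2, h3, h4, h5, h6, h7⟩ | ⟨S, y, h1, h2, h3, h4, hS⟩
  · rw [h7 0 (Nat.zero_le _)] at key
    rw [h4]
    intro c r c' r' g1 g2
    exact key.both c r c' r' (val_eq_coe_iff.2 g1) (val_eq_coe_iff.2 g2)
  · rw [h1] at key
    rw [h3]
    intro c r c' r' g1 g2
    rw [← val_eq_coe_iff, h4] at g1 g2
    rcases insRow_eq_coe g2 with ⟨rfl, -⟩ | ⟨r₂, g2⟩
    · exact Nat.zero_le _
    · rcases insRow_eq_coe g1 with ⟨rfl, g3⟩ | ⟨r₁, g1⟩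
      -- If `i` is left over for the new row, `low` at index 0 confines `i + 1` to the first column.
      · have := key.low g3 c' r₂ g2
        by_contra hc
        have := mul_le_of_lt (R := T.length) (c := 0) (c' := c') (by omega)
        omega
      · exact key.both _ _ _ _ g1 g2

theorem RightOf.insertEntry {T : Filling} {k i : ℕ} (hT : Young T) (hk : Fresh (val T) k)
    (h : RightOf T i) (hi : k = i → ¬ IsEntry T (i + 1)) :
    RightOf (insertEntry T k).1 i := by
  obtain ⟨M, hM⟩ := exists_bound T
  have hM := hM M le_rfl
  have hxy : ((i : ℕ) : WithTop ℕ) < ((i + 1 : ℕ) : WithTop ℕ) :=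
    WithTop.coe_lt_coe.2 (Nat.lt_succ_self i)
  rcases Nat.eq_zero_or_pos T.length with hR | hR
  · have : T = [] := List.eq_nil_of_length_eq_zero hR
    subst this
    have e : PeakTableaux.insertEntry [] k = ([[k]], NewBox.newRow 0) := rfl
    intro c r c' r' h1 h2
    rw [e] at h1 h2
    rw [entry_eq_some_iff] at h1 h2
    obtain ⟨row, g1, g2⟩ := h1
    obtain ⟨row', g1', g2'⟩ := h2
    have g3 := List.mem_of_getElem? g1
    have g3' := List.mem_of_getElem? g1'
    simp only [List.mem_singleton] at g3 g3'
    subst g3 g3'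
    have g4 := List.mem_of_getElem? g2
    have g4' := List.mem_of_getElem? g2'
    simp only [List.mem_singleton] at g4 g4'
    omega
  have hinit : KeepsRight T.length (M * T.length) (i : WithTop ℕ) ((i + 1 : ℕ) : WithTop ℕ)
      (val T, (k : WithTop ℕ)) := by
    refine ⟨fun c r c' r' h1 h2 => h c r c' r' (val_eq_coe_iff.1 h1) (val_eq_coe_iff.1 h2),
      fun h1 c r h2 => ?_, fun _ c r h1 => ?_⟩
    · have h1 : k = i := WithTop.coe_inj.1 h1
      exact absurd (isEntry_iff.2 ⟨c, r, h2⟩) (hi h1)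
    · have hne : val T c r ≠ ⊤ := fun h0 => WithTop.coe_ne_top (h1.symm.trans h0)
      have h2 := mul_le_of_lt (R := T.length) (hM c r hne)
      have h3 : r < T.length := by
        by_contra h3
        exact hne (val_le_length (by omega))
      omega
  have key := hinit.trace hR (Ready.init hT hk hM) hxy WithTop.coe_ne_top (coe_succ_cover i)
    (Nat.zero_le _)
  rcases insertEntry_cases hT (k := k) hM with
    ⟨c, r, S, y, hr, hN, h1, h2, h3, h4, h5, h6, h7⟩ | ⟨S, y, h1, h2, h3, h4, hS⟩
  · rw [h7 0 (Nat.zero_le _)] at key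
    rw [h4]
    intro c r c' r' g1 g2
    exact key.both c r c' r' (val_eq_coe_iff.2 g1) (val_eq_coe_iff.2 g2)
  · rw [h1] at key
    rw [h3]
    intro c r c' r' g1 g2
    rw [← val_eq_coe_iff, h4] at g1 g2
    rcases insRow_eq_coe g1 with ⟨rfl, g3⟩ | ⟨r₁, g3⟩ <;>
    rcases insRow_eq_coe g2 with ⟨rfl, g4⟩ | ⟨r₂, g4⟩
    · exact absurd (g3.symm.trans g4) hxy.ne
    · have := key.low g3 c' r₂ g4
      rcases Nat.eq_zero_or_pos c' with rfl | hc
      · rw [zero_mul] at this; omega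
      · exact hc
    -- If `i + 1` were left over for the new row, `high` would place `i` at a negative index.
    · have := key.high g4 c r₁ g3
      omega
    · exact key.both _ _ _ _ g3 g4

end

/-! ### Words, recording fillings and the correspondence between words and pairs -/

/-- The pair of fillings obtained from a word by successive insertion. -/
def rsk (w : List ℕ) : Filling × Filling := (w.zipIdx 1).foldl readingStep ([], [])

theorem rsk_snoc (w : List ℕ) (x : ℕ) : rsk (w ++ [x]) =
    ((insertEntry (rsk w).1 x).1, addBox (rsk w).2 (w.length + 1) (insertEntry (rsk w).1 x).2) := by
  rw [rsk, List.zipIdx_append, List.foldl_append, ← rsk, add_comm 1]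
  rfl

/-- Standard recording fillings with `m` boxes. -/
structure Recording (m : ℕ) (Q : Filling) : Prop where
  not_nil : [] ∉ Q
  isEntry : ∀ x, IsEntry Q x ↔ 1 ≤ x ∧ x ≤ m
  inj : ∀ c r c' r' x, entry Q c r = some x → entry Q c' r' = some x → c = c' ∧ r = r'
  rows : RowsIncrease Q
  down : FirstColIncreasesDown Q
  triple : RecordingTriple Q

theorem entry_addBox_endOfRow {Q : Filling} {r j : ℕ} {row : List ℕ} (h : Q[r]? = some row)
    (c' r' : ℕ) : entry (addBox Q j (NewBox.endOfRow r)) c' r' =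
      if c' = row.length ∧ r' = r then some j else entry Q c' r' := by
  have h1 := congrFun (congrFun (val_addBox_endOfRow (k := j) h) c') r'
  simp only [setAt] at h1
  split_ifs at h1 ⊢
  · exact val_eq_coe_iff.1 h1
  · cases h2 : entry Q c' r' with
    | none => rwa [← val_eq_top_iff, h1, val_eq_top_iff]
    | some x => rwa [← val_eq_coe_iff, h1, val_eq_coe_iff]

theorem entry_cons_zero (row : List ℕ) (Q : Filling) (c : ℕ) : entry (row :: Q) c 0 = row[c]? :=
  rfl

theorem addBox_newRow_zero (Q : Filling) (j : ℕ) : addBox Q j (NewBox.newRow 0) = [j] :: Q := rfl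

theorem Corner.congr {T T' : Filling} (h : T.map List.length = T'.map List.length) {b : NewBox}
    (hb : Corner T b) : Corner T' b := by
  have key : ∀ c r, val T c r ≠ ⊤ ↔ val T' c r ≠ ⊤ := by
    intro c r; rw [val_ne_top_iff, val_ne_top_iff, h]
  have key' : ∀ c r, val T c r = ⊤ ↔ val T' c r = ⊤ := fun c r => not_iff_not.1 (key c r)
  cases b <;> simpa only [Corner, key, key', Ne] using hb

/-- The box `b` can be added to `T`, at the bottom if it is in a new row. -/
def Addable (T : Filling) : NewBox → Prop
  | NewBox.endOfRow r => r < T.length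
  | NewBox.newRow p => p = 0

/-- The new entry exceeds all others. As the larger entry of a recording triple it requires exactly
that every lower row reaching its column also reaches the next one, which is `Corner`. In a row of
its own it has to be at the bottom, since the first column decreases upwards. -/
theorem Recording.add {m : ℕ} {Q : Filling} (h : Recording m Q) {b : NewBox}
    (hb : Corner (addBox Q (m + 1) b) b) (ha : Addable Q b) :
    Recording (m + 1) (addBox Q (m + 1) b) := by
  obtain ⟨h1, h2, h3, h4, h5, h6⟩ := h
  have hlt : ∀ c r x, entry Q c r = some x → x < m + 1 := fun c r x hx =>
    Nat.lt_succ_of_le ((h2 x).1 ⟨c, r, hx⟩).2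
  cases b with
  | endOfRow r =>
    have hr : Q[r]? = some Q[r] := List.getElem?_eq_getElem ha
    have hent := fun c' r' => entry_addBox_endOfRow (j := m + 1) hr c' r'
    generalize Q[r] = row at hr hent
    have hrow : 0 < row.length := by
      rcases row with _ | ⟨a, l⟩
      · exact absurd (List.mem_of_getElem? hr) h1
      · simp
    have hbig : ∀ c x, entry Q c r = some x → c < row.length := by
      intro c x hx
      rw [entry_of_row hr, List.getElem?_eq_some_iff] at hx
      exact hx.1
    have hex : ∀ c, c < row.length → ∃ x, entry Q c r = some x := by
      intro c hc
      exact ⟨row[c], by rw [entry_of_row hr, List.getElem?_eq_getElem hc]⟩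
    have hlow : ∀ r', r' < r → entry Q row.length r' ≠ none →
        entry Q (row.length + 1) r' ≠ none := by
      obtain ⟨c, g1, g2, g3⟩ := hb
      have e : row.length = c + 1 := by
        simp only [Ne, val_eq_top_iff, hent] at g1 g2
        by_contra hne
        rw [if_neg (by omega)] at g1
        split_ifs at g2 with hc2
        have : c + 1 < row.length := by
          by_contra hc
          apply g1
          rw [entry_of_row hr]
          exact List.getElem?_eq_none (by omega)
        rcases Nat.lt_or_ge (c + 2) row.length with hc | hc
        · obtain ⟨x, hx⟩ := hex _ hc
          rw [g2] at hx
          cases hx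
        · exact hc2 ⟨by omega, trivial⟩
      intro r' hr'
      have := g3 r' hr'
      simp only [Ne, val_eq_top_iff, hent] at this
      rw [if_neg (fun h => hr'.ne h.2), if_neg (fun h => hr'.ne h.2)] at this
      rw [e]
      exact this
    refine ⟨?_, ?_, ?_, ?_, ?_, ?_⟩
    · intro hmem
      simp only [addBox] at hmem
      obtain ⟨i, hi⟩ := List.mem_iff_getElem?.1 hmem
      rw [List.getElem?_modify] at hi
      cases hQi : Q[i]? with
      | none => simp [hQi] at hi
      | some row' =>
        by_cases hri : r = i
        · simp [hQi, hri] at hi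
        · simp [hQi, hri] at hi
          exact h1 (hi ▸ List.mem_of_getElem? hQi)
    · intro x
      simp only [IsEntry, hent]
      constructor
      · rintro ⟨c, r', hx⟩
        split_ifs at hx
        · cases hx; omega
        · have := (h2 x).1 ⟨c, r', hx⟩; omega
      · rintro ⟨hx1, hx2⟩
        rcases Nat.lt_or_ge x (m + 1) with hx | hx
        · obtain ⟨c, r', h7⟩ := (h2 x).2 ⟨hx1, by omega⟩
          refine ⟨c, r', ?_⟩
          rw [if_neg, h7]
          rintro ⟨rfl, rfl⟩
          exact absurd (hbig _ _ h7) (lt_irrefl _)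
        · exact ⟨row.length, r, by rw [if_pos ⟨rfl, rfl⟩]; congr 1; omega⟩
    · intro c r' c' r'' x hx hx'
      rw [hent] at hx hx'
      split_ifs at hx hx' with g1 g2 g2
      · exact ⟨g1.1.trans g2.1.symm, g1.2.trans g2.2.symm⟩
      · cases hx; exact absurd (hlt _ _ _ hx') (lt_irrefl _)
      · cases hx'; exact absurd (hlt _ _ _ hx) (lt_irrefl _)
      · exact h3 _ _ _ _ _ hx hx'
    · intro c c' r' x y hc hx hy
      rw [hent] at hx hy
      split_ifs at hx hy with g1 g2 g2
      · omega
      · obtain ⟨rfl, rfl⟩ := g1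
        exact absurd (hbig _ _ hy) (by omega)
      · cases hy; exact hlt _ _ _ hx
      · exact h4 c c' r' x y hc hx hy
    · intro r' r'' x y hr' hx hy
      rw [hent, if_neg (by omega)] at hx hy
      exact h5 r' r'' x y hr' hx hy
    · intro c r₁ r₂ x y hr12 hx hy hyx
      rw [hent] at hx hy
      split_ifs at hx hy with g1 g2 g2
      · omega
      · obtain ⟨rfl, rfl⟩ := g1
        cases hx
        have := hlow r₂ hr12 (by rw [hy]; simp)
        obtain ⟨z, hz⟩ := Option.ne_none_iff_exists'.1 this
        refine ⟨z, ?_, hlt _ _ _ hz⟩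
        rw [hent, if_neg (by omega), hz]
      · cases hy
        have := hlt _ _ _ hx
        omega
      · obtain ⟨z, hz, hzx⟩ := h6 c r₁ r₂ x y hr12 hx hy hyx
        refine ⟨z, ?_, hzx⟩
        rw [hent, if_neg, hz]
        rintro ⟨e1, e2⟩
        rw [e1, e2] at hz
        exact absurd (hbig _ _ hz) (lt_irrefl _)
  | newRow p =>
    have : p = 0 := ha
    subst this
    rw [addBox_newRow_zero]
    have hz : ∀ c x, entry ([m + 1] :: Q) c 0 = some x → c = 0 ∧ x = m + 1 := by
      intro c x hx
      rw [entry_cons_zero] at hx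
      cases c <;> simp at hx
      exact ⟨rfl, hx.symm⟩
    refine ⟨by simp [h1], ?_, ?_, ?_, ?_, ?_⟩
    · intro x
      constructor
      · rintro ⟨c, r, hx⟩
        cases r with
        | zero => have := (hz c x hx).2; omega
        | succ r => have := (h2 x).1 ⟨c, r, hx⟩; omega
      · rintro ⟨hx1, hx2⟩
        rcases Nat.lt_or_ge x (m + 1) with hx | hx
        · obtain ⟨c, r', h7⟩ := (h2 x).2 ⟨hx1, by omega⟩
          exact ⟨c, r' + 1, h7⟩
        · exact ⟨0, 0, by rw [entry_cons_zero]; simp; omega⟩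
    · intro c r c' r' x hx hx'
      rcases r with _ | r <;> rcases r' with _ | r'
      · exact ⟨(hz _ _ hx).1.trans (hz _ _ hx').1.symm, rfl⟩
      · have := (hz _ _ hx).2; have := hlt _ _ _ hx'; omega
      · have := (hz _ _ hx').2; have := hlt _ _ _ hx; omega
      · have := h3 c r c' r' x hx hx'
        exact ⟨this.1, by omega⟩
    · intro c c' r x y hc hx hy
      cases r with
      | zero => have := (hz _ _ hx).1; have := (hz _ _ hy).1; omega
      | succ r => exact h4 c c' r x y hc hx hy
    · intro r r' x y hr hx hy
      cases r' with
      | zero => omega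
      | succ r' =>
        cases r with
        | zero => have := (hz _ _ hx).2; have := hlt _ _ _ hy; omega
        | succ r => exact h5 r r' x y (by omega) hx hy
    · intro c r r' x y hr hx hy hyx
      cases r with
      | zero => omega
      | succ r =>
        cases r' with
        | zero =>
          have := (hz _ _ hy).2; have := hlt _ _ _ hx; omega
        | succ r' => exact h6 c r r' x y (by omega) hx hy hyx

/-- The largest entry ends its row. If it is in the first column, its row is the bottom one;
otherwise the recording triples with the lower rows say that its box is a corner. -/
theorem Recording.remove {m : ℕ} {Q' : Filling} (h : Recording (m + 1) Q') :
    ∃ (Q : Filling) (b : NewBox), Recording m Q ∧ Q' = addBox Q (m + 1) b ∧ Corner Q' b ∧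
      Addable Q b := by
  obtain ⟨h1, h2, h3, h4, h5, h6⟩ := h
  obtain ⟨c, r, hcr⟩ := (h2 (m + 1)).2 ⟨by omega, le_rfl⟩
  have hle : ∀ c r x, entry Q' c r = some x → x ≤ m + 1 := fun c r x hx =>
    ((h2 x).1 ⟨c, r, hx⟩).2
  have hlt : ∀ c' r' x, entry Q' c' r' = some x → ¬ (c' = c ∧ r' = r) → x ≤ m := by
    intro c' r' x hx hne
    have := hle _ _ _ hx
    by_contra hxm
    have : x = m + 1 := by omega
    subst this
    exact hne (h3 _ _ _ _ _ hx hcr)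
  obtain ⟨row, hrow, hc⟩ := entry_eq_some_iff.1 hcr
  have hclt : c < row.length := (List.getElem?_eq_some_iff.1 hc).1
  have hlen : row.length = c + 1 := by
    by_contra hne
    have : c + 1 < row.length := by omega
    have h7 : entry Q' (c + 1) r = some row[c + 1] := by
      rw [entry_of_row hrow, List.getElem?_eq_getElem this]
    have := h4 c (c + 1) r _ _ (by omega) hcr h7
    have := hle _ _ _ h7
    omega
  cases c with
  | zero =>
    have hr : r = 0 := by
      by_contra hr
      have hr0 : 0 < Q'.length := by
        have := (List.getElem?_eq_some_iff.1 hrow).1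
        omega
      have h7 : Q'[0]? = some Q'[0] := List.getElem?_eq_getElem hr0
      cases h8 : Q'[0] with
      | nil => exact h1 (h8 ▸ List.getElem_mem hr0)
      | cons a l =>
        rw [h8] at h7
        have h9 : entry Q' 0 0 = some a := by rw [entry_of_row h7]; rfl
        have := h5 0 r a (m + 1) (by omega) h9 hcr
        have := hle _ _ _ h9
        omega
    subst hr
    cases Q' with
    | nil => simp at hrow
    | cons row' Q =>
      have hrow : row' = row := by simpa using hrow
      subst hrow
      have : row' = [m + 1] := by
        match row', hlen, hc with
        | [a], _, hc => simpa using hc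
      subst this
      refine ⟨Q, NewBox.newRow 0, ⟨by simp at h1; exact h1, ?_, ?_, ?_, ?_, ?_⟩, rfl,
        ⟨?_, ?_, by simp⟩, rfl⟩
      · intro x
        constructor
        · rintro ⟨c, r, hx⟩
          exact ⟨((h2 x).1 ⟨c, r + 1, hx⟩).1, hlt c (r + 1) x hx (by omega)⟩
        · rintro ⟨hx1, hx2⟩
          obtain ⟨c, r, hx⟩ := (h2 x).2 ⟨hx1, by omega⟩
          cases r with
          | succ r => exact ⟨c, r, hx⟩
          | zero =>
            rw [entry_cons_zero] at hx
            cases c <;> simp at hx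
            omega
      · intro c r c' r' x hx hx'
        have := h3 c (r + 1) c' (r' + 1) x hx hx'
        exact ⟨this.1, by omega⟩
      · exact fun c c' r x y hc hx hy => h4 c c' (r + 1) x y hc hx hy
      · exact fun r r' x y hr hx hy => h5 (r + 1) (r' + 1) x y (by omega) hx hy
      · exact fun c r r' x y hr hx hy hyx => h6 c (r + 1) (r' + 1) x y (by omega) hx hy hyx
      · exact fun h => WithTop.coe_ne_top h
      · rfl
  | succ c =>
    have hrow' : row = row.dropLast ++ [m + 1] := by
      apply List.ext_getElem?
      intro i
      rcases lt_trichotomy i (c + 1) with hi | rfl | hi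
      · rw [List.getElem?_append_left (by simp; omega), List.getElem?_dropLast, if_pos (by omega)]
      · rw [hc, List.getElem?_append_right (by simp; omega)]
        have : c + 1 - row.dropLast.length = 0 := by simp; omega
        rw [this]
        rfl
      · rw [List.getElem?_eq_none (by omega), List.getElem?_eq_none (by simp; omega)]
    have hdl : row.dropLast.length = c + 1 := by simp; omega
    set Q : Filling := Q'.modify r List.dropLast with hQ
    have hQr : Q[r]? = some row.dropLast := by simp [hQ, hrow]
    have hadd : addBox Q (m + 1) (NewBox.endOfRow r) = Q' := by
      apply List.ext_getElem?
      intro i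
      simp only [addBox, hQ, List.getElem?_modify]
      cases hi : Q'[i]? with
      | none => rfl
      | some row' =>
        by_cases hri : r = i
        · subst hri
          rw [hrow] at hi
          cases hi
          simp [← hrow']
        · simp [hri]
    have hent : ∀ c' r', entry Q' c' r' = if c' = c + 1 ∧ r' = r then some (m + 1) else
        entry Q c' r' := by
      intro c' r'
      have := entry_addBox_endOfRow (j := m + 1) hQr c' r'
      rwa [hadd, hdl] at this
    have hsub : ∀ c' r' x, entry Q c' r' = some x →
        ¬ (c' = c + 1 ∧ r' = r) ∧ entry Q' c' r' = some x := by
      intro c' r' x hx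
      have : ¬ (c' = c + 1 ∧ r' = r) := by
        rintro ⟨rfl, rfl⟩
        rw [entry_of_row hQr, List.getElem?_eq_none (by omega)] at hx
        cases hx
      exact ⟨this, by rw [hent, if_neg this, hx]⟩
    refine ⟨Q, NewBox.endOfRow r, ⟨?_, ?_, ?_, ?_, ?_, ?_⟩, hadd.symm, ⟨c, ?_, ?_, ?_⟩,
      (List.getElem?_eq_some_iff.1 hQr).1⟩
    · intro hmem
      obtain ⟨i, hi⟩ := List.mem_iff_getElem?.1 hmem
      by_cases hri : r = i
      · subst hri
        rw [hQr, Option.some.injEq] at hi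
        rw [hi] at hdl
        simp at hdl
      · have hi : Q'[i]? = some [] := by
          rw [hQ, List.getElem?_modify] at hi
          cases h7 : Q'[i]? with
          | none => simp [h7] at hi
          | some row' => simpa [h7, hri] using hi
        exact h1 (List.mem_of_getElem? hi)
    · intro x
      constructor
      · rintro ⟨c', r', hx⟩
        obtain ⟨g1, g2⟩ := hsub _ _ _ hx
        exact ⟨((h2 x).1 ⟨c', r', g2⟩).1, hlt _ _ _ g2 g1⟩
      · rintro ⟨hx1, hx2⟩
        obtain ⟨c', r', hx⟩ := (h2 x).2 ⟨hx1, by omega⟩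
        rw [hent] at hx
        split_ifs at hx
        · cases hx; omega
        · exact ⟨c', r', hx⟩
    · exact fun c r c' r' x hx hx' => h3 c r c' r' x (hsub _ _ _ hx).2 (hsub _ _ _ hx').2
    · exact fun c c' r x y hc hx hy => h4 c c' r x y hc (hsub _ _ _ hx).2 (hsub _ _ _ hy).2
    · exact fun r r' x y hr hx hy => h5 r r' x y hr (hsub _ _ _ hx).2 (hsub _ _ _ hy).2
    · intro c' r₁ r₂ x y hr hx hy hyx
      obtain ⟨g1, g2⟩ := hsub _ _ _ hx
      obtain ⟨z, hz, hzx⟩ := h6 c' r₁ r₂ x y hr g2 (hsub _ _ _ hy).2 hyx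
      refine ⟨z, ?_, hzx⟩
      rw [hent] at hz
      split_ifs at hz
      · cases hz
        have := hle _ _ _ g2
        omega
      · exact hz
    · rw [Ne, val_eq_top_iff, hcr]; simp
    · rw [val_eq_top_iff, entry_of_row hrow, List.getElem?_eq_none (by omega)]
    · intro r' hr' hne
      rw [Ne, val_eq_top_iff] at hne ⊢
      obtain ⟨y, hy⟩ := Option.ne_none_iff_exists'.1 hne
      obtain ⟨z, hz, -⟩ := h6 (c + 1) r r' (m + 1) y hr' hcr hy
        (Nat.lt_succ_of_le (hlt _ _ _ hy (by omega)))
      rw [hz]; simp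

/-- The position of the unique entry `j` reveals the box: in the first column it was added as a new
bottom row, elsewhere at the end of its row. -/
theorem addBox_injective {Q₁ Q₂ : Filling} {j : ℕ} {b₁ b₂ : NewBox}
    (hj : ∀ c r c' r', entry (addBox Q₁ j b₁) c r = some j → entry (addBox Q₁ j b₁) c' r' = some j →
      c = c' ∧ r = r') (h₁ : [] ∉ Q₁) (h₂ : [] ∉ Q₂) (ha₁ : Addable Q₁ b₁) (ha₂ : Addable Q₂ b₂)
    (h : addBox Q₁ j b₁ = addBox Q₂ j b₂) : Q₁ = Q₂ ∧ b₁ = b₂ := by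
  have hloc : ∀ {Q : Filling} {r : ℕ}, [] ∉ Q → r < Q.length →
      ∃ c, 0 < c ∧ entry (addBox Q j (NewBox.endOfRow r)) c r = some j := by
    intro Q r hQ hr
    have h1 : Q[r]? = some Q[r] := List.getElem?_eq_getElem hr
    refine ⟨Q[r].length, ?_, by rw [entry_addBox_endOfRow h1, if_pos ⟨rfl, rfl⟩]⟩
    rw [List.length_pos_iff]
    intro h2
    exact hQ (h2 ▸ List.getElem_mem hr)
  have hinv : ∀ (Q : Filling) (r : ℕ), (addBox Q j (NewBox.endOfRow r)).modify r List.dropLast =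
      Q := by
    intro Q r
    apply List.ext_getElem?
    intro i
    simp only [addBox, List.getElem?_modify]
    cases Q[i]? with
    | none => rfl
    | some row => by_cases hri : r = i <;> simp [hri]
  cases b₁ with
  | endOfRow r₁ =>
    obtain ⟨c₁, hc₁, e₁⟩ := hloc h₁ ha₁
    cases b₂ with
    | endOfRow r₂ =>
      obtain ⟨c₂, hc₂, e₂⟩ := hloc h₂ ha₂
      rw [← h] at e₂
      obtain ⟨-, rfl⟩ := hj _ _ _ _ e₁ e₂
      refine ⟨?_, rfl⟩
      rw [← hinv Q₁ r₁, h, hinv]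
    | newRow p =>
      have : p = 0 := ha₂
      subst this
      have e₂ : entry (addBox Q₂ j (NewBox.newRow 0)) 0 0 = some j := rfl
      rw [← h] at e₂
      have := (hj _ _ _ _ e₁ e₂).1
      omega
  | newRow p₁ =>
    have : p₁ = 0 := ha₁
    subst this
    have e₁ : entry (addBox Q₁ j (NewBox.newRow 0)) 0 0 = some j := rfl
    cases b₂ with
    | endOfRow r₂ =>
      obtain ⟨c₂, hc₂, e₂⟩ := hloc h₂ ha₂
      rw [← h] at e₂
      have := (hj _ _ _ _ e₁ e₂).1
      omega
    | newRow p =>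
      have : p = 0 := ha₂
      subst this
      rw [addBox_newRow_zero, addBox_newRow_zero, List.cons.injEq] at h
      exact ⟨h.2, rfl⟩

theorem colAt_pos_iff {T : Filling} {k : ℕ} (hT : Young T) :
    0 < colAt T k ↔ ∃ r, (insertEntry T k).2 = NewBox.endOfRow r ∧ r < T.length := by
  obtain ⟨M, hM⟩ := exists_bound T
  rcases insertEntry_cases hT (k := k) (hM M le_rfl) with
    ⟨c, r, S, y, hr, hN, h1, h2, h3, h4, h5, h6, h7⟩ | ⟨S, y, h1, h2, h3, h4, hS⟩
  · rw [colAt, h4, newCol, h1]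
    simp [hr]
  · rw [colAt, h3]
    simp [newCol]

/-- A letter that creates a row at the bottom is smaller than all entries. -/
theorem lt_of_insertEntry_eq_newRow_zero {T : Filling} {k : ℕ} (hT : Young T)
    (hk : Fresh (val T) k) (h : (insertEntry T k).2 = NewBox.newRow 0) {x : ℕ}
    (hx : IsEntry T x) : k < x := by
  obtain ⟨M, hM⟩ := exists_bound T
  have hM := hM M le_rfl
  rcases insertEntry_cases hT (k := k) hM with
    ⟨c, r, S, y, hr, hN, h1, h2, h3, h4, h5, h6, h7⟩ | ⟨S, y, h1, h2, h3, h4, hS⟩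
  · rw [h4] at h
    cases h
  · rw [h3] at h
    have h : newRowPos S y = 0 := by simpa using h
    have h5 := (newRowPos_spec hS y).2.2
    rw [h] at h5
    have h6 := trace_col_zero (R := T.length) (s := (val T, (k : WithTop ℕ)))
      (Nat.zero_le (M * T.length)) 0
    have h7 := snd_le_trace (R := T.length) (val T, (k : WithTop ℕ))
      (Nat.zero_le (M * T.length))
    rw [h1] at h6 h7
    obtain ⟨c, r, hx⟩ := isEntry_iff.1 hx
    have h8 : ∀ c, val T 0 r ≤ val T c r := by
      intro c
      induction c with
      | zero => exact le_rfl
      | succ c ih => exact ih.trans (hT.le_succ c r)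
    have h9 : val T 0 0 ≤ val T 0 r := by
      rcases Nat.eq_zero_or_pos r with rfl | hr
      · exact le_rfl
      · rcases hT.1.col 0 r hr with h | h
        · rw [h]; exact le_top
        · exact h.le
    have h10 : val S 0 0 = val T 0 0 := h6
    have h11 : (k : WithTop ℕ) ≤ (x : WithTop ℕ) := by
      rw [← hx]
      refine le_trans ?_ (h9.trans (h8 c))
      rw [← h10]
      exact le_trans h7 (not_lt.1 h5)
    have h12 : k ≤ x := WithTop.coe_le_coe.1 h11
    refine lt_of_le_of_ne h12 ?_
    rintro rfl
    exact fresh_iff.1 hk (isEntry_iff.2 ⟨c, r, hx⟩)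

/-- Words with distinct letters in which every letter that creates a row is smaller than all
preceding letters. -/
def Proper (w : List ℕ) : Prop := w.Nodup ∧
  ∀ u x v, w = u ++ x :: v → colAt (rsk u).1 x = 0 → ∀ y ∈ u, x < y

theorem Proper.of_append {u v : List ℕ} (h : Proper (u ++ v)) : Proper u :=
  ⟨h.1.of_append_left, fun u' x v' hu => h.2 u' x (v' ++ v) (by rw [hu]; simp)⟩

theorem Proper.not_mem {u v : List ℕ} {x : ℕ} (h : Proper (u ++ x :: v)) : x ∉ u := by
  have := List.nodup_append.1 h.1
  intro hx
  exact this.2.2 x hx x (by simp) rfl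

/-- Properties of the pair obtained from a word `w`. -/
structure Good (w : List ℕ) (P Q : Filling) : Prop where
  young : Young P
  isEntry : ∀ x, IsEntry P x ↔ x ∈ w
  shape : P.map List.length = Q.map List.length
  recording : Recording w.length Q

theorem not_isEntry_nil (x : ℕ) : ¬ IsEntry [] x := by
  rintro ⟨c, r, h⟩
  simp [entry] at h

theorem young_nil : Young [] := by
  refine ⟨⟨fun c r => Or.inl rfl, fun r r' _ => Or.inl rfl, fun c r r' _ _ => le_rfl,
    fun c r c' r' _ => Or.inl rfl⟩, by simp⟩

theorem recording_nil : Recording 0 [] := by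
  have : ∀ c r x, entry [] c r = some x → False := fun c r x h => not_isEntry_nil x ⟨c, r, h⟩
  exact ⟨by simp, fun x => ⟨fun h => absurd h (not_isEntry_nil x), fun h => by omega⟩,
    fun c r c' r' x h => (this _ _ _ h).elim, fun c c' r x y _ h => (this _ _ _ h).elim,
    fun r r' x y _ h => (this _ _ _ h).elim, fun c r r' x y _ h => (this _ _ _ h).elim⟩

theorem Good.fresh {w : List ℕ} {P Q : Filling} (h : Good w P Q) {x : ℕ} (hx : x ∉ w) :
    Fresh (val P) x := by
  rw [fresh_iff, h.isEntry]
  exact hx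

theorem Good.addable {w : List ℕ} {P Q : Filling} (h : Good w P Q) {x : ℕ}
    (h0 : colAt P x = 0 → ∀ y ∈ w, x < y) : Addable Q (insertEntry P x).2 := by
  have hl : P.length = Q.length := by simpa using congrArg List.length h.shape
  rcases Nat.eq_zero_or_pos (colAt P x) with hc | hc
  · rw [insertEntry_min h.young fun y hy => h0 hc y ((h.isEntry y).1 hy)]
    rfl
  · obtain ⟨r, h1, h2⟩ := (colAt_pos_iff h.young).1 hc
    rw [h1]
    exact h2.trans_eq hl

theorem Good.snoc {w : List ℕ} {P Q : Filling} (h : Good w P Q) {x : ℕ} (hx : x ∉ w)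
    (h0 : colAt P x = 0 → ∀ y ∈ w, x < y) :
    Good (w ++ [x]) (insertEntry P x).1 (addBox Q (w.length + 1) (insertEntry P x).2) := by
  obtain ⟨h1, h2, h3⟩ := insertEntry_young h.young (h.fresh hx)
  have hs : (insertEntry P x).1.map List.length =
      (addBox Q (w.length + 1) (insertEntry P x).2).map List.length := by
    rw [map_length_addBox, h3, h.shape]
  refine ⟨h1, fun y => ?_, hs, ?_⟩
  · rw [isEntry_insertEntry h.young, h.isEntry]
    simp
  · rw [List.length_append, List.length_singleton]
    exact h.recording.add (h2.congr hs) (h.addable h0)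

theorem Proper.good {w : List ℕ} (h : Proper w) : Good w (rsk w).1 (rsk w).2 := by
  induction w using List.reverseRecOn with
  | nil => exact ⟨young_nil, fun x => by simp [rsk, not_isEntry_nil], rfl, recording_nil⟩
  | append_singleton w x ih =>
    rw [rsk_snoc]
    exact (ih h.of_append).snoc h.not_mem (h.2 w x [] rfl)

theorem Recording.eq_nil {Q : Filling} (h : Recording 0 Q) : Q = [] := by
  cases Q with
  | nil => rfl
  | cons row Q =>
    cases row with
    | nil => exact absurd List.mem_cons_self h.not_nil
    | cons a l =>
      have := (h.isEntry a).1 ⟨0, 0, rfl⟩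
      omega

theorem addLen_injective {l l' : List ℕ} {b : NewBox} (h : addLen l b = addLen l' b)
    (hb : ∀ p, b = NewBox.newRow p → p = 0) : l = l' := by
  cases b with
  | endOfRow r =>
    apply List.ext_getElem?
    intro i
    have := congrArg (fun l => l[i]?) h
    simp only [addLen, List.getElem?_modify] at this
    by_cases hr : r = i
    · cases h1 : l[i]? <;> cases h2 : l'[i]? <;> simp [h1, h2, hr] at this ⊢
      exact this
    · simpa [hr] using this
  | newRow p =>
    rw [hb p rfl] at h
    simpa [addLen] using h

/-- Every pair of a Young composition tableau and a recording filling comes from a word. -/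
theorem exists_proper (m : ℕ) (P Q : Filling) (hP : Young P)
    (hs : P.map List.length = Q.map List.length) (hQ : Recording m Q) :
    ∃ w, Proper w ∧ w.length = m ∧ rsk w = (P, Q) := by
  induction m generalizing P Q with
  | zero =>
    have h := hQ.eq_nil
    subst h
    have : P = [] := by simpa using hs
    subst this
    refine ⟨[], ⟨List.nodup_nil, fun u x v h => ?_⟩, rfl, rfl⟩
    simp at h
  | succ m ih =>
    obtain ⟨Q₀, b, h1, h2, h3, h4⟩ := hQ.remove
    obtain ⟨P₀, k, g1, g2, g3⟩ := exists_insertEntry_eq hP (h3.congr hs.symm)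
    have g4 := (insertEntry_young g1 g2).2.2
    rw [g3] at g4
    have hs₀ : P₀.map List.length = Q₀.map List.length := by
      refine addLen_injective (b := b) ?_ ?_
      · rw [← map_length_addBox Q₀ (m + 1), ← h2, ← hs, ← g4]
      · rintro p rfl
        exact h4
    obtain ⟨w, hw, hwl, hwr⟩ := ih P₀ Q₀ g1 hs₀ h1
    have hg := hw.good
    rw [hwr] at hg
    refine ⟨w ++ [k], ⟨?_, fun u x v huv hc => ?_⟩, by simp [hwl], ?_⟩
    · rw [List.nodup_append]
      refine ⟨hw.1, by simp, fun a ha b hb => ?_⟩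
      rw [List.mem_singleton] at hb
      rintro rfl
      subst hb
      exact fresh_iff.1 g2 ((hg.isEntry _).2 ha)
    · rcases List.eq_nil_or_concat v with rfl | ⟨v', y, rfl⟩
      · have := List.append_inj' huv rfl
        obtain ⟨rfl, h5⟩ := this
        have h5 : k = x := by simpa using h5
        subst h5
        have hc : colAt P₀ k = 0 := by rw [hwr] at hc; exact hc
        intro y hy
        refine lt_of_insertEntry_eq_newRow_zero g1 g2 ?_ ((hg.isEntry y).2 hy)
        rw [g3]
        cases b with
        | endOfRow r =>
          exfalso
          have hr : r < P₀.length := by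
            have : P₀.length = Q₀.length := by simpa using congrArg List.length hs₀
            rw [this]
            exact h4
          have := (colAt_pos_iff g1 (k := k)).2 ⟨r, by rw [g3], hr⟩
          omega
        | newRow p =>
          have : p = 0 := h4
          rw [this]
      · have h5 : w ++ [k] = (u ++ x :: v') ++ [y] := by rw [huv]; simp
        have := List.append_inj' h5 rfl
        exact hw.2 u x v' this.1 hc
    · rw [rsk_snoc, hwr, hwl, g3, h2]

theorem Recording.unique {m m' : ℕ} {Q : Filling} (h : Recording m Q) (h' : Recording m' Q) :
    m = m' := by
  by_contra hne
  rcases lt_or_gt_of_ne hne with h1 | h1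
  · have := (h.isEntry m').1 ((h'.isEntry m').2 (by omega))
    omega
  · have := (h'.isEntry m).1 ((h.isEntry m).2 (by omega))
    omega

/-- The recording filling determines the length of the word, and its largest entry determines the
last created box. Undoing that insertion gives back the last letter and the pair of the shorter
word. -/
theorem rsk_injective {w w' : List ℕ} (h : Proper w) (h' : Proper w') (he : rsk w = rsk w') :
    w = w' := by
  induction w using List.reverseRecOn generalizing w' with
  | nil =>
    have h1 := h'.good.recording
    rw [← he] at h1
    have := h.good.recording.unique h1
    exact (List.eq_nil_of_length_eq_zero this.symm).symm
  | append_singleton u x ih =>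
    have h1 := h'.good.recording
    rw [← he] at h1
    have hl := h.good.recording.unique h1
    rcases List.eq_nil_or_concat w' with rfl | ⟨u', x', rfl⟩
    · simp at hl
    rw [List.concat_eq_append] at h' he
    have hu : u.length = u'.length := by simpa using hl
    have hg := h.of_append.good
    have hg' := h'.of_append.good
    have h0 := h.good.recording.inj
    rw [rsk_snoc] at h0
    rw [rsk_snoc, rsk_snoc, Prod.mk.injEq, ← hu] at he
    obtain ⟨e1, e2⟩ := addBox_injective (fun c r c' r' => h0 c r c' r' _) hg.recording.not_nil
      hg'.recording.not_nil (hg.addable (h.2 u x [] rfl)) (hg'.addable (h'.2 u' x' [] rfl)) he.2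
    obtain ⟨e3, e4⟩ := insertEntry_injective hg.young hg'.young (hg.fresh h.not_mem)
      (hg'.fresh h'.not_mem) (Prod.ext he.1 e2)
    rw [ih h.of_append h'.of_append (Prod.ext e3 e1), e4, List.concat_eq_append]

theorem entry_addBox_of_addable {Q : Filling} {b : NewBox} (hb : Addable Q b) {j c r x : ℕ}
    (h : entry Q c r = some x) : ∃ r', entry (addBox Q j b) c r' = some x := by
  cases b with
  | endOfRow r₀ =>
    refine ⟨r, ?_⟩
    have h1 : Q[r₀]? = some Q[r₀] := List.getElem?_eq_getElem hb
    rw [entry_addBox_endOfRow h1, if_neg, h]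
    rintro ⟨rfl, rfl⟩
    rw [entry_of_row h1, List.getElem?_eq_none le_rfl] at h
    cases h
  | newRow p =>
    have : p = 0 := hb
    subst this
    exact ⟨r + 1, h⟩

/-- For a proper word new rows appear only at the bottom, so later steps may shift an entry of the
recording filling upwards but never change its column. -/
theorem Proper.entry_col {u v : List ℕ} {x : ℕ} (h : Proper (u ++ x :: v)) :
    ∃ r, entry (rsk (u ++ x :: v)).2 (colAt (rsk u).1 x) r = some (u.length + 1) := by
  induction v using List.reverseRecOn with
  | nil =>
    have hg := h.of_append.good
    have ha := hg.addable (h.2 u x [] rfl)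
    rw [rsk_snoc, colAt]
    cases hb : (insertEntry (rsk u).1 x).2 with
    | endOfRow r =>
      rw [hb] at ha
      have h1 : (rsk u).2[r]? = some (rsk u).2[r] := List.getElem?_eq_getElem ha
      refine ⟨r, ?_⟩
      rw [entry_addBox_endOfRow h1, if_pos]
      simp [newCol, hg.shape, h1]
    | newRow p =>
      rw [hb] at ha
      have : p = 0 := ha
      subst this
      exact ⟨0, rfl⟩
  | append_singleton v y ih =>
    have e : u ++ x :: (v ++ [y]) = (u ++ x :: v) ++ [y] := by simp
    rw [e] at h ⊢
    obtain ⟨r, hr⟩ := ih h.of_append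
    rw [rsk_snoc]
    exact entry_addBox_of_addable (h.of_append.good.addable (h.2 _ y [] rfl)) hr

theorem Proper.weaklyLeft {w u v : List ℕ} {i : ℕ} (h : Proper w) (hw : w = u ++ i :: v)
    (hi : i + 1 ∈ u) : WeaklyLeft (rsk w).1 i := by
  induction w using List.reverseRecOn generalizing v with
  | nil => simp at hw
  | append_singleton w x ih =>
    have hg := h.of_append.good
    rw [rsk_snoc]
    rcases List.eq_nil_or_concat v with rfl | ⟨v', y, rfl⟩
    · obtain ⟨rfl, h5⟩ := List.append_inj' hw rfl
      have h5 : x = i := by simpa using h5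
      subst h5
      refine WeaklyLeft.insertEntry hg.young (hg.fresh h.not_mem) ?_ (by omega)
      intro c r c' r' h1
      exact absurd ((hg.isEntry x).1 ⟨c, r, h1⟩) h.not_mem
    · have h5 : w ++ [x] = (u ++ i :: v') ++ [y] := by rw [hw]; simp
      obtain ⟨rfl, h6⟩ := List.append_inj' h5 rfl
      refine WeaklyLeft.insertEntry hg.young (hg.fresh h.not_mem) (ih h.of_append rfl) ?_
      rintro rfl
      exact absurd (by simp [hi]) h.not_mem

theorem Proper.rightOf {w u v : List ℕ} {i : ℕ} (h : Proper w) (hw : w = u ++ (i + 1) :: v)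
    (hi : i ∈ u) : RightOf (rsk w).1 i := by
  induction w using List.reverseRecOn generalizing v with
  | nil => simp at hw
  | append_singleton w x ih =>
    have hg := h.of_append.good
    rw [rsk_snoc]
    rcases List.eq_nil_or_concat v with rfl | ⟨v', y, rfl⟩
    · obtain ⟨rfl, h5⟩ := List.append_inj' hw rfl
      have h5 : x = i + 1 := by simpa using h5
      subst h5
      refine RightOf.insertEntry hg.young (hg.fresh h.not_mem) ?_ (by omega)
      intro c r c' r' h1 h2
      exact absurd ((hg.isEntry _).1 ⟨c', r', h2⟩) h.not_mem
    · have h5 : w ++ [x] = (u ++ (i + 1) :: v') ++ [y] := by rw [hw]; simp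
      obtain ⟨rfl, h6⟩ := List.append_inj' h5 rfl
      refine RightOf.insertEntry hg.young (hg.fresh h.not_mem) (ih h.of_append rfl) ?_
      rintro rfl
      exact absurd (by simp [hi]) h.not_mem

/-! ### The defining conditions of the tableaux in terms of arrays -/

/-- Distinct boxes have distinct entries. -/
def EntryInj (T : Filling) : Prop :=
  ∀ c r c' r' x, entry T c r = some x → entry T c' r' = some x → c = c' ∧ r = r'

theorem isEntry_iff_mem_flatten {T : Filling} {x : ℕ} : IsEntry T x ↔ x ∈ T.flatten := by
  rw [List.mem_flatten]
  constructor
  · rintro ⟨c, r, h⟩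
    obtain ⟨row, h1, h2⟩ := entry_eq_some_iff.1 h
    exact ⟨row, List.mem_of_getElem? h1, List.mem_of_getElem? h2⟩
  · rintro ⟨row, h1, h2⟩
    obtain ⟨r, h1⟩ := List.mem_iff_getElem?.1 h1
    obtain ⟨c, h2⟩ := List.mem_iff_getElem?.1 h2
    exact ⟨c, r, entry_eq_some_iff.2 ⟨row, h1, h2⟩⟩

theorem entryInj_iff {T : Filling} : EntryInj T ↔ T.flatten.Nodup := by
  rw [List.nodup_flatten]
  constructor
  · intro h
    refine ⟨fun row hrow => ?_, ?_⟩
    · obtain ⟨r, hr⟩ := List.mem_iff_getElem?.1 hrow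
      rw [List.nodup_iff_injective_get]
      intro i j hij
      have h1 : entry T i r = some (row.get i) := by
        rw [entry_of_row hr]; simp
      have h2 : entry T j r = some (row.get i) := by
        rw [hij, entry_of_row hr]; simp
      exact Fin.ext (h _ _ _ _ _ h1 h2).1
    · rw [List.pairwise_iff_getElem]
      intro i j hi hj hij x hxi hxj
      obtain ⟨c, hc⟩ := List.mem_iff_getElem?.1 hxi
      obtain ⟨c', hc'⟩ := List.mem_iff_getElem?.1 hxj
      have h1 : entry T c i = some x := by
        rw [entry_of_row (List.getElem?_eq_getElem hi), hc]
      have h2 : entry T c' j = some x := by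
        rw [entry_of_row (List.getElem?_eq_getElem hj), hc']
      exact hij.ne (h _ _ _ _ _ h1 h2).2
  · rintro ⟨h1, h2⟩ c r c' r' x hx hx'
    obtain ⟨row, g1, g2⟩ := entry_eq_some_iff.1 hx
    obtain ⟨row', g1', g2'⟩ := entry_eq_some_iff.1 hx'
    rw [List.pairwise_iff_getElem] at h2
    obtain ⟨k1, k2⟩ := List.getElem?_eq_some_iff.1 g1
    obtain ⟨k1', k2'⟩ := List.getElem?_eq_some_iff.1 g1'
    have hr : r = r' := by
      rcases lt_trichotomy r r' with h | h | h
      · exact (h2 r r' k1 k1' h (k2 ▸ List.mem_of_getElem? g2)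
          (k2' ▸ List.mem_of_getElem? g2')).elim
      · exact h
      · exact (h2 r' r k1' k1 h (k2' ▸ List.mem_of_getElem? g2')
          (k2 ▸ List.mem_of_getElem? g2)).elim
    subst hr
    rw [g1] at g1'
    cases g1'
    refine ⟨?_, rfl⟩
    have h3 := h1 row (List.mem_of_getElem? g1)
    rw [List.nodup_iff_injective_get] at h3
    obtain ⟨l1, l2⟩ := List.getElem?_eq_some_iff.1 g2
    obtain ⟨l1', l2'⟩ := List.getElem?_eq_some_iff.1 g2'
    have := @h3 ⟨c, l1⟩ ⟨c', l1'⟩ (by simp [l2, l2'])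
    exact congrArg Fin.val this

theorem perm_range_iff {n : ℕ} {l : List ℕ} :
    l.Perm (List.range' 1 n) ↔ l.Nodup ∧ ∀ x, x ∈ l ↔ 1 ≤ x ∧ x ≤ n := by
  have hr : ∀ x, x ∈ List.range' 1 n ↔ 1 ≤ x ∧ x ≤ n := by
    intro x
    rw [List.mem_range'_1]
    omega
  constructor
  · intro h
    exact ⟨h.nodup_iff.2 List.nodup_range', fun x => by rw [h.mem_iff, hr]⟩
  · rintro ⟨h1, h2⟩
    rw [List.perm_ext_iff_of_nodup h1 List.nodup_range']
    intro x
    rw [h2, hr]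

theorem isStandard_iff {n : ℕ} {α : Composition n} {T : Filling} : IsStandard α T ↔
    T.map List.length = α.blocks ∧ EntryInj T ∧ ∀ x, IsEntry T x ↔ 1 ≤ x ∧ x ≤ n := by
  rw [IsStandard, HasShape, perm_range_iff, entryInj_iff]
  simp only [isEntry_iff_mem_flatten]

theorem not_nil_mem_of_blocks {n : ℕ} {α : Composition n} {T : Filling}
    (h : T.map List.length = α.blocks) : [] ∉ T := by
  rw [not_nil_mem_iff, h]
  intro h0
  exact absurd (α.blocks_pos h0) (lt_irrefl 0)

/-- The composition of the row lengths of a standard filling. -/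
theorem exists_composition {n : ℕ} {T : Filling} (h : [] ∉ T) (hi : EntryInj T)
    (he : ∀ x, IsEntry T x ↔ 1 ≤ x ∧ x ≤ n) :
    ∃ β : Composition n, T.map List.length = β.blocks := by
  refine ⟨⟨T.map List.length, ?_, ?_⟩, rfl⟩
  · intro i hi
    rw [not_nil_mem_iff] at h
    exact Nat.pos_of_ne_zero fun h0 => h (h0 ▸ hi)
  · have h1 := (perm_range_iff (l := T.flatten)).2
      ⟨entryInj_iff.1 hi, fun x => by rw [← isEntry_iff_mem_flatten, he]⟩
    have := h1.length_eq
    rwa [List.length_flatten, List.length_range'] at this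

theorem entry_none_of_le {T : Filling} {c c' r : ℕ} (h : entry T c r = none) (hc : c ≤ c') :
    entry T c' r = none := by
  cases hr : T[r]? with
  | none => exact entry_of_none hr c'
  | some row =>
    rw [entry_of_row hr, List.getElem?_eq_none_iff] at h ⊢
    omega

theorem coe_lt_coe' {x y : ℕ} : ((x : WithTop ℕ) < (y : WithTop ℕ)) ↔ x < y := Nat.cast_lt

theorem entry_zero_none_of_le {T : Filling} (hT : [] ∉ T) {r r' : ℕ} (h : entry T 0 r = none)
    (hr : r ≤ r') : entry T 0 r' = none := by
  rw [← val_eq_top_iff] at h ⊢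
  by_contra hne
  have := (val_zero_ne_top_iff hT).1 hne
  exact (val_zero_ne_top_iff hT).2 (hr.trans_lt this) h

/-- The triple condition for arrays is weak because both sides may be ⊤. For a finite right-hand
side the distinctness of the entries makes it strict and makes the left-hand side an actual box. -/
theorem young_iff {T : Filling} : Young T ↔
    [] ∉ T ∧ EntryInj T ∧ RowsIncrease T ∧ FirstColIncreasesUp T ∧ YoungTriple T := by
  constructor
  · rintro ⟨⟨h1, h2, h3, h4⟩, h5⟩
    have hinj : EntryInj T := by
      intro c r c' r' x hx hx'
      rw [← val_eq_coe_iff] at hx hx'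
      exact (h4 c r c' r' (hx.trans hx'.symm)).resolve_left
        (by rw [hx]; exact WithTop.coe_ne_top)
    refine ⟨h5, hinj, ?_, ?_, ?_⟩
    · intro c c' r x y hc hx hy
      rw [← val_eq_coe_iff] at hx hy
      rw [← coe_lt_coe', ← hx, ← hy]
      have hle : ∀ d, val T (c + 1) r ≤ val T (c + 1 + d) r := by
        intro d
        induction d with
        | zero => exact le_rfl
        | succ d ih =>
          rcases h1 (c + 1 + d) r with h | h
          · exact (h ▸ le_top : val T (c + 1) r ≤ val T (c + 1 + d + 1) r)
          · exact ih.trans h.le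
      obtain ⟨d, rfl⟩ := Nat.exists_eq_add_of_le (Nat.succ_le_of_lt hc)
      have h6 := hle d
      have h7 : val T (c + 1 + d) r ≠ ⊤ := by
        have : val T (c + 1 + d) r = y := hy
        rw [this]
        exact WithTop.coe_ne_top
      rcases h1 c r with h | h
      · rw [h, top_le_iff] at h6
        exact absurd h6 h7
      · exact h.trans_le h6
    · intro r r' x y hr hx hy
      rw [← val_eq_coe_iff] at hx hy
      rw [← coe_lt_coe', ← hx, ← hy]
      exact (h2 r r' hr).resolve_left (by rw [hy]; exact WithTop.coe_ne_top)
    · intro c r r' x y hr hx hy hxy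
      have hx' := val_eq_coe_iff.2 hx
      have hy' := val_eq_coe_iff.2 hy
      have h6 := h3 c r r' hr (by rw [hx', hy', coe_lt_coe']; exact hxy)
      rw [hy'] at h6
      obtain ⟨z, hz⟩ := WithTop.ne_top_iff_exists.1 (h6.trans_lt (WithTop.coe_lt_top y)).ne
      have hz : val T (c + 1) r = (z : WithTop ℕ) := hz.symm
      rw [hz] at h6
      have h7 : z ≤ y := WithTop.coe_le_coe.1 h6
      rw [val_eq_coe_iff] at hz
      refine ⟨z, hz, lt_of_le_of_ne h7 ?_⟩
      rintro rfl
      have := (hinj _ _ _ _ _ hz hy).2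
      omega
  · rintro ⟨h5, h4, h1, h2, h3⟩
    refine ⟨⟨?_, ?_, ?_, ?_⟩, h5⟩
    · intro c r
      cases hy : entry T (c + 1) r with
      | none => exact Or.inl (val_eq_top_iff.2 hy)
      | some y =>
        cases hx : entry T c r with
        | none =>
          rw [entry_none_of_le hx (Nat.le_succ c)] at hy
          cases hy
        | some x =>
          right
          rw [val_eq_coe_iff.2 hx, val_eq_coe_iff.2 hy, coe_lt_coe']
          exact h1 _ _ _ _ _ (Nat.lt_succ_self c) hx hy
    · intro r r' hr
      cases hy : entry T 0 r' with
      | none => exact Or.inl (val_eq_top_iff.2 hy)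
      | some y =>
        cases hx : entry T 0 r with
        | none =>
          rw [entry_zero_none_of_le h5 hx hr.le] at hy
          cases hy
        | some x =>
          right
          rw [val_eq_coe_iff.2 hx, val_eq_coe_iff.2 hy, coe_lt_coe']
          exact h2 _ _ _ _ hr hx hy
    · intro c r r' hr hlt
      cases hy : entry T (c + 1) r' with
      | none => rw [val_eq_top_iff.2 hy]; exact le_top
      | some y =>
        obtain ⟨x, hx⟩ := WithTop.ne_top_iff_exists.1 (hlt.trans_le le_top).ne
        have hx : val T c r = (x : WithTop ℕ) := hx.symm
        rw [hx, val_eq_coe_iff.2 hy, coe_lt_coe'] at hlt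
        obtain ⟨z, hz, hzy⟩ := h3 c r r' x y hr (val_eq_coe_iff.1 hx) hy hlt
        rw [val_eq_coe_iff.2 hz, val_eq_coe_iff.2 hy]
        exact (coe_lt_coe'.2 hzy).le
    · intro c r c' r' h
      by_cases hne : val T c r = ⊤
      · exact Or.inl hne
      · right
        obtain ⟨x, hx⟩ := WithTop.ne_top_iff_exists.1 hne
        have hx : val T c r = (x : WithTop ℕ) := hx.symm
        exact h4 c r c' r' x (val_eq_coe_iff.1 hx) (val_eq_coe_iff.1 (h ▸ hx))

theorem getElem?_takeWhile_iff {α : Type*} {p : α → Bool} {l : List α}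
    (h : ∀ (i j : ℕ) a b, i < j → l[i]? = some a → l[j]? = some b → p b = true → p a = true)
    {i : ℕ} {x : α} : (l.takeWhile p)[i]? = some x ↔ l[i]? = some x ∧ p x = true := by
  induction l generalizing i with
  | nil => simp
  | cons a l ih =>
    by_cases ha : p a = true
    · rw [List.takeWhile_cons_of_pos ha]
      cases i with
      | zero =>
        simp only [List.getElem?_cons_zero, Option.some.injEq]
        exact ⟨fun h => ⟨h, h ▸ ha⟩, fun h => h.1⟩
      | succ i =>
        simp only [List.getElem?_cons_succ]
        exact ih fun i j a b hij hi hj => h (i + 1) (j + 1) a b (Nat.succ_lt_succ hij) hi hj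
    · rw [List.takeWhile_cons_of_neg ha]
      constructor
      · intro h; simp at h
      · rintro ⟨h1, h2⟩
        exfalso
        cases i with
        | zero =>
          simp only [List.getElem?_cons_zero, Option.some.injEq] at h1
          exact ha (h1 ▸ h2)
        | succ i => exact ha (h 0 (i + 1) a x (by omega) rfl h1 h2)

theorem lt_length_takeWhile_iff {α : Type*} {p : α → Bool} {l : List α}
    (h : ∀ (i j : ℕ) a b, i < j → l[i]? = some a → l[j]? = some b → p b = true → p a = true)
    {i : ℕ} : i < (l.takeWhile p).length ↔ ∃ x, l[i]? = some x ∧ p x = true := by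
  constructor
  · intro hi
    exact ⟨_, (getElem?_takeWhile_iff h).1 (List.getElem?_eq_getElem hi)⟩
  · rintro ⟨x, hx⟩
    exact (List.getElem?_eq_some_iff.1 ((getElem?_takeWhile_iff h).2 hx)).1

/-- Only the moments at which a new row starts matter: the row below must then already have its
second box. Conversely, the entries at most `k` form an initial segment in each row and, in the
first column, an initial segment of the rows. -/
theorem peakCondition_iff {n : ℕ} {T : Filling} (h0 : [] ∉ T) (hi : EntryInj T)
    (hr : RowsIncrease T) (hc : FirstColIncreasesUp T) (hn : ∀ x, IsEntry T x → x ≤ n) :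
    PeakCondition n T ↔ PeakCols T := by
  constructor
  · intro h r hne
    obtain ⟨x, hx⟩ := WithTop.ne_top_iff_exists.1 hne
    have hx : val T 0 (r + 1) = (x : WithTop ℕ) := hx.symm
    rw [hx]
    rw [val_eq_coe_iff] at hx
    obtain ⟨m, β, hβ, hset⟩ := h x (hn x ⟨_, _, hx⟩)
    have h1 : ((0, r + 1) : ℕ × ℕ) ∈ diagram β := by
      rw [← hset]
      exact ⟨x, hx, le_rfl⟩
    obtain ⟨a, ha, -⟩ := h1
    have hlt := (List.getElem?_eq_some_iff.1 ha).1
    simp only at hlt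
    have hr' : r < β.blocks.length := by omega
    have h2 : β.blocks[r] ∈ β.blocks.dropLast := by
      rw [List.mem_iff_getElem?]
      exact ⟨r, by rw [List.getElem?_dropLast, if_pos (by omega), List.getElem?_eq_getElem hr']⟩
    have h3 : ((1, r) : ℕ × ℕ) ∈ diagram β := ⟨_, List.getElem?_eq_getElem hr', hβ _ h2⟩
    rw [← hset] at h3
    obtain ⟨y, hy, hyx⟩ := h3
    rw [val_eq_coe_iff.2 hy, coe_lt_coe']
    refine lt_of_le_of_ne hyx ?_
    rintro rfl
    have := (hi _ _ _ _ _ hx hy).1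
    omega
  · intro h k _
    have hrow : ∀ (r : ℕ) row, T[r]? = some row → ∀ (i j : ℕ) a b, i < j → row[i]? = some a →
        row[j]? = some b → decide (b ≤ k) = true → decide (a ≤ k) = true := by
      intro r row hrow i j a b hij ha hb hbk
      rw [decide_eq_true_eq] at hbk ⊢
      have := hr i j r a b hij (by rw [entry_of_row hrow, ha]) (by rw [entry_of_row hrow, hb])
      omega
    set cnt : List ℕ → ℕ := fun row => (row.takeWhile fun x => decide (x ≤ k)).length with hcnt
    have hcntlt : ∀ (r : ℕ) row, T[r]? = some row → ∀ c, c < cnt row ↔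
        ∃ x, entry T c r = some x ∧ x ≤ k := by
      intro r row h1 c
      rw [hcnt, lt_length_takeWhile_iff (hrow r row h1), entry_of_row h1]
      simp
    have hmono : ∀ (i j : ℕ) a b, i < j → (T.map cnt)[i]? = some a → (T.map cnt)[j]? = some b →
        decide (0 < b) = true → decide (0 < a) = true := by
      intro i j a b hij ha hb hb0
      rw [decide_eq_true_eq] at hb0 ⊢
      rw [List.getElem?_map, Option.map_eq_some_iff] at ha hb
      obtain ⟨row, h1, rfl⟩ := ha
      obtain ⟨row', h1', rfl⟩ := hb
      obtain ⟨x, hx, hxk⟩ := (hcntlt j row' h1' 0).1 hb0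
      rw [hcntlt i row h1]
      cases row with
      | nil => exact absurd (List.mem_of_getElem? h1) h0
      | cons y l =>
        have hy : entry T 0 i = some y := by rw [entry_of_row h1]; rfl
        have := hc i j y x hij hy hx
        exact ⟨y, hy, by omega⟩
    -- The parts of the truncated diagram: the number of entries at most `k` in each row, up to the
    -- first row without any.
    set bl := (T.map cnt).takeWhile fun a => decide (0 < a) with hbl
    have hget : ∀ (r : ℕ) a, bl[r]? = some a ↔ ∃ row, T[r]? = some row ∧ cnt row = a ∧ 0 < a := by
      intro r a
      rw [hbl, getElem?_takeWhile_iff hmono, List.getElem?_map, Option.map_eq_some_iff]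
      simp only [decide_eq_true_eq]
      constructor
      · rintro ⟨⟨row, h1, h2⟩, h3⟩; exact ⟨row, h1, h2, h3⟩
      · rintro ⟨row, h1, h2, h3⟩; exact ⟨⟨row, h1, h2⟩, h3⟩
    refine ⟨bl.sum, ⟨bl, fun {i} hi => ?_, rfl⟩, ?_, ?_⟩
    · obtain ⟨r, hr⟩ := List.mem_iff_getElem?.1 hi
      obtain ⟨row, -, -, h3⟩ := (hget r i).1 hr
      exact h3
    · intro a ha
      obtain ⟨r, hra⟩ := List.mem_iff_getElem?.1 ha
      simp only at hra
      rw [List.getElem?_dropLast] at hra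
      split_ifs at hra with hlt
      obtain ⟨row, h1, rfl, -⟩ := (hget r a).1 hra
      have hlt' : r + 1 < bl.length := by omega
      obtain ⟨row', h1', h2', h3'⟩ := (hget _ _).1 (List.getElem?_eq_getElem hlt')
      rw [← h2'] at h3'
      obtain ⟨x, hx, hxk⟩ := (hcntlt _ _ h1' 0).1 h3'
      rw [hcntlt r row h1]
      have h4 := h r (by rw [val_eq_coe_iff.2 hx]; exact WithTop.coe_ne_top)
      rw [val_eq_coe_iff.2 hx] at h4
      obtain ⟨y, hy⟩ := WithTop.ne_top_iff_exists.1 (h4.trans_le le_top).ne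
      have hy : val T 1 r = (y : WithTop ℕ) := hy.symm
      rw [hy, coe_lt_coe'] at h4
      exact ⟨y, val_eq_coe_iff.1 hy, by omega⟩
    · ext ⟨c, r⟩
      simp only [Set.mem_ofPred_eq, diagram]
      constructor
      · rintro ⟨x, hx, hxk⟩
        obtain ⟨row, h1, -⟩ := entry_eq_some_iff.1 hx
        have h2 := (hcntlt r row h1 c).2 ⟨x, hx, hxk⟩
        exact ⟨cnt row, (hget _ _).2 ⟨row, h1, rfl, by omega⟩, h2⟩
      · rintro ⟨a, ha, hca⟩
        obtain ⟨row, h1, rfl, -⟩ := (hget r a).1 ha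
        exact (hcntlt r row h1 c).1 hca

theorem mem_SPYCT_iff {n : ℕ} {β : Composition n} {P : Filling} : P ∈ SPYCT β ↔
    P.map List.length = β.blocks ∧ (∀ x, IsEntry P x ↔ 1 ≤ x ∧ x ≤ n) ∧ Young P ∧ PeakCols P := by
  rw [SPYCT, Set.mem_ofPred_eq, isStandard_iff, young_iff]
  constructor
  · rintro ⟨⟨h1, h2, h3⟩, h4, h5, h6, h7⟩
    have h0 := not_nil_mem_of_blocks h1
    exact ⟨h1, h3, ⟨h0, h2, h4, h5, h7⟩,
      (peakCondition_iff h0 h2 h4 h5 fun x hx => ((h3 x).1 hx).2).1 h6⟩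
  · rintro ⟨h1, h3, ⟨h0, h2, h4, h5, h7⟩, h6⟩
    exact ⟨⟨h1, h2, h3⟩, h4, h5,
      (peakCondition_iff h0 h2 h4 h5 fun x hx => ((h3 x).1 hx).2).2 h6, h7⟩

theorem mem_SPCT_iff {n : ℕ} {α : Composition n} {T : Filling} : T ∈ SPCT α ↔
    T.map List.length = α.blocks ∧ T.flatten.Perm (List.range' 1 n) ∧ RowsIncrease T ∧
      FirstColIncreasesUp T ∧ PeakCols T := by
  rw [SPCT, Set.mem_ofPred_eq]
  constructor
  · rintro ⟨h, h4, h5, h6⟩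
    obtain ⟨h1, h2, h3⟩ := isStandard_iff.1 h
    have h0 := not_nil_mem_of_blocks h1
    exact ⟨h1, h.2, h4, h5,
      (peakCondition_iff h0 h2 h4 h5 fun x hx => ((h3 x).1 hx).2).1 h6⟩
  · rintro ⟨h1', hp, h4, h5, h6⟩
    obtain ⟨h1, h2, h3⟩ := isStandard_iff.1 (⟨h1', hp⟩ : IsStandard α T)
    have h0 := not_nil_mem_of_blocks h1
    exact ⟨⟨h1', hp⟩, h4, h5,
      (peakCondition_iff h0 h2 h4 h5 fun x hx => ((h3 x).1 hx).2).2 h6⟩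

theorem mem_DIRT_iff {n : ℕ} {β : Composition n} {Q : Filling} : Q ∈ DIRT β ↔
    Q.map List.length = β.blocks ∧ Recording n Q ∧
      ∀ a j, IsRowStrip Q a j → ∃ r, entry Q 0 r = some a := by
  rw [DIRT, Set.mem_ofPred_eq, isStandard_iff]
  constructor
  · rintro ⟨⟨h1, h2, h3⟩, h4, h5, h6, h7⟩
    exact ⟨h1, ⟨not_nil_mem_of_blocks h1, h3, h2, h4, h6, h7⟩, h5⟩
  · rintro ⟨h1, ⟨-, h3, h2, h4, h6, h7⟩, h5⟩
    exact ⟨⟨h1, h2, h3⟩, h4, h5, h6, h7⟩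

theorem isPeakComposition_of_peakCols {n : ℕ} {β : Composition n} {P : Filling}
    (h : P.map List.length = β.blocks) (hP : PeakCols P) : IsPeakComposition β := by
  have h0 := not_nil_mem_of_blocks h
  intro a ha
  obtain ⟨r, hra⟩ := List.mem_iff_getElem?.1 ha
  rw [List.getElem?_dropLast] at hra
  split_ifs at hra with hlt
  rw [← h] at hra hlt
  rw [List.length_map] at hlt
  have h1 := hP r ((val_zero_ne_top_iff h0).2 (by omega))
  obtain ⟨l, h2, h3⟩ := val_ne_top_iff.1 (h1.trans_le le_top).ne
  rw [hra] at h2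
  cases h2
  exact h3

/-! ### Rows of the tableau and row strips of the recording filling -/

theorem Proper.snoc {u : List ℕ} {x : ℕ} (h : Proper u) (hx : x ∉ u)
    (h0 : colAt (rsk u).1 x = 0 → ∀ y ∈ u, x < y) : Proper (u ++ [x]) := by
  refine ⟨List.nodup_append.2 ⟨h.1, List.nodup_singleton x, ?_⟩, ?_⟩
  · rintro a ha b hb rfl
    rw [List.mem_singleton] at hb
    exact hx (hb ▸ ha)
  · intro u' y v hu
    rcases List.eq_nil_or_concat v with rfl | ⟨v', y', rfl⟩
    · obtain ⟨rfl, h5⟩ := List.append_inj' hu rfl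
      have h5 : x = y := by simpa using h5
      subst h5
      exact h0
    · have h5 : u ++ [x] = (u' ++ y :: v') ++ [y'] := by rw [hu]; simp
      obtain ⟨rfl, -⟩ := List.append_inj' h5 rfl
      exact h.2 u' y v' rfl

theorem Proper.insertEntry_min {u : List ℕ} {z : ℕ} (h : Proper u) (hz : ∀ y ∈ u, z < y) :
    insertEntry (rsk u).1 z = ([z] :: (rsk u).1, NewBox.newRow 0) :=
  PeakTableaux.insertEntry_min h.good.young fun x hx => hz x ((h.good.isEntry x).1 hx)

theorem Proper.colAt_min {u : List ℕ} {z : ℕ} (h : Proper u) (hz : ∀ y ∈ u, z < y) :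
    colAt (rsk u).1 z = 0 := by
  rw [colAt, h.insertEntry_min hz]
  rfl

theorem Proper.rsk_min {u : List ℕ} {z : ℕ} (h : Proper u) (hz : ∀ y ∈ u, z < y) :
    (rsk (u ++ [z])).1 = [z] :: (rsk u).1 := by
  rw [rsk_snoc, h.insertEntry_min hz]

theorem Proper.fresh {u v : List ℕ} {x : ℕ} (h : Proper (u ++ x :: v)) :
    Fresh (val (rsk u).1) x :=
  h.of_append.good.fresh h.not_mem

theorem Proper.young {u : List ℕ} (h : Proper u) : Young (rsk u).1 := h.good.young

/-- The letters of `row` can form, after the word `u`, the next row from above of a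
standard peak composition tableau. -/
def RowOK (u row : List ℕ) : Prop :=
  ∃ z l, row = z :: l ∧ (z :: l).IsChain (· < ·) ∧ (∀ y ∈ u, z < y) ∧
    (u ≠ [] → ∃ z' l', l = z' :: l' ∧ ∀ y ∈ u, z' < y)

/-- When the letters of `row` are inserted after the word `u`, the new boxes form a row strip
that starts in the first column. -/
def StripOK (u row : List ℕ) : Prop :=
  (∀ z l, row = z :: l → colAt (rsk u).1 z = 0) ∧
    ∀ a x y b, row = a ++ x :: y :: b →
      colAt (rsk (u ++ a)).1 x < colAt (rsk (u ++ a ++ [x])).1 y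

/-- The first letter forms a new bottom row. The second one is larger than this single entry and
creates no row (`colAt_pos_of_single`); from then on the columns of the new boxes increase by row
bumping. -/
theorem proper_append_row {u l : List ℕ} {z : ℕ} (hu : Proper u) (hnd : (u ++ z :: l).Nodup)
    (hc : (z :: l).IsChain (· < ·)) (hz : ∀ y ∈ u, z < y) :
    Proper (u ++ z :: l) ∧ ∀ a x b, l = a ++ x :: b → 0 < colAt (rsk (u ++ z :: a)).1 x := by
  induction l using List.reverseRecOn with
  | nil =>
    refine ⟨hu.snoc ?_ fun _ => hz, fun a x b h => by simp at h⟩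
    intro h
    exact lt_irrefl _ (hz z h)
  | append_singleton l x ih =>
    have e : u ++ z :: (l ++ [x]) = (u ++ z :: l) ++ [x] := by simp
    have hnd' : (u ++ z :: l ++ [x]).Nodup := e ▸ hnd
    have hx : x ∉ u ++ z :: l := by
      intro h
      exact (List.nodup_append.1 hnd').2.2 x h x (by simp) rfl
    have hc' : (z :: l).IsChain (· < ·) := List.IsChain.left_of_append (l₂ := [x]) (by simpa using hc)
    obtain ⟨h1, h2⟩ := ih hnd'.of_append_left hc'
    have hpos : 0 < colAt (rsk (u ++ z :: l)).1 x := by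
      rcases List.eq_nil_or_concat l with rfl | ⟨l', y, rfl⟩
      · have hf := h1.good.fresh hx
        rw [hu.rsk_min hz] at hf ⊢
        refine colAt_pos_of_single (hu.rsk_min hz ▸ h1.young) hf ?_
        exact (List.isChain_cons_cons.1 hc).1
      · rw [List.concat_eq_append] at *
        have hy := h2 l' y [] rfl
        have e' : u ++ z :: (l' ++ [y]) = (u ++ z :: l') ++ [y] := by simp
        rw [e'] at h1 ⊢
        rw [rsk_snoc]
        refine lt_trans hy (colAt_lt_colAt h1.of_append.young h1.fresh hy ?_)
        rw [List.isChain_iff_forall_rel_of_append_cons_cons] at hc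
        exact @hc y x (z :: l') [] (by simp)
    refine ⟨e ▸ h1.snoc hx fun h => absurd h hpos.ne', ?_⟩
    intro a y b hab
    rcases List.eq_nil_or_concat b with rfl | ⟨b', y', rfl⟩
    · obtain ⟨rfl, h5⟩ := List.append_inj' hab rfl
      have h5 : x = y := by simpa using h5
      exact h5 ▸ hpos
    · have h5 : l ++ [x] = (a ++ y :: b') ++ [y'] := by rw [hab]; simp
      obtain ⟨rfl, -⟩ := List.append_inj' h5 rfl
      exact h2 a y b' rfl

theorem peakCols_append {u v : List ℕ} (h : Proper (u ++ v))
    (hv : ∀ a x b, v = a ++ x :: b → 0 < colAt (rsk (u ++ a)).1 x)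
    (hp : PeakCols (rsk u).1) : PeakCols (rsk (u ++ v)).1 := by
  induction v using List.reverseRecOn with
  | nil => simpa using hp
  | append_singleton v x ih =>
    rw [← List.append_assoc] at h ⊢
    rw [rsk_snoc]
    refine PeakCols.insertEntry h.of_append.young h.fresh (hv v x [] rfl) ?_
    exact ih h.of_append fun a y b hab => hv a y (b ++ [x]) (by rw [hab]; simp)

theorem peakCols_of_append {u v : List ℕ} (h : Proper (u ++ v))
    (hv : ∀ a x b, v = a ++ x :: b → 1 < colAt (rsk (u ++ a)).1 x)
    (hp : PeakCols (rsk (u ++ v)).1) : PeakCols (rsk u).1 := by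
  induction v using List.reverseRecOn with
  | nil => simpa using hp
  | append_singleton v x ih =>
    rw [← List.append_assoc] at h hp
    rw [rsk_snoc] at hp
    refine ih h.of_append (fun a y b hab => hv a y (b ++ [x]) (by rw [hab]; simp)) ?_
    exact (peakCols_insertEntry_iff h.of_append.young h.fresh (hv v x [] rfl)).1 hp

theorem peakCols_nil : PeakCols [] := fun _ h => absurd rfl h

theorem peakCols_singleton (z : ℕ) : PeakCols [[z]] := fun _ h => absurd rfl h

/-- After its first two letters the bottom row consists of these letters, both below all others, so
the peak condition holds. The remaining letters create no row and preserve it. -/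
theorem RowOK.spec {u row : List ℕ} (h : RowOK u row) (hu : Proper u)
    (hp : PeakCols (rsk u).1) (hnd : (u ++ row).Nodup) :
    Proper (u ++ row) ∧ PeakCols (rsk (u ++ row)).1 ∧ StripOK u row := by
  obtain ⟨z, l, rfl, hc, hz, h2⟩ := h
  obtain ⟨h3, h4⟩ := proper_append_row hu hnd hc hz
  refine ⟨h3, ?_, ?_, ?_⟩
  · by_cases hu0 : u = []
    · subst hu0
      have e : [] ++ z :: l = [z] ++ l := rfl
      rw [e] at h3 ⊢
      refine peakCols_append h3 h4 ?_
      have := hu.rsk_min hz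
      rw [List.nil_append] at this
      rw [this]
      exact peakCols_singleton z
    · obtain ⟨z', l', rfl, hz'⟩ := h2 hu0
      have e : u ++ z :: z' :: l' = (u ++ [z, z']) ++ l' := by simp
      have e' : u ++ [z, z'] = (u ++ [z]) ++ [z'] := by simp
      rw [e] at h3 ⊢
      refine peakCols_append h3 (fun a x b hab => ?_) ?_
      · have := h4 (z' :: a) x b (by rw [hab]; rfl)
        simpa using this
      · rw [e', rsk_snoc, hu.rsk_min hz, insertEntry_second (List.isChain_cons_cons.1 hc).1
          fun x hx => hz' x ((hu.good.isEntry x).1 hx)]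
        intro r hr
        cases r with
        | zero =>
          change val (rsk u).1 0 0 ≠ ⊤ at hr
          change (z' : WithTop ℕ) < val (rsk u).1 0 0
          obtain ⟨y, hy⟩ := WithTop.ne_top_iff_exists.1 hr
          have hy : val (rsk u).1 0 0 = (y : WithTop ℕ) := hy.symm
          rw [hy, coe_lt_coe']
          exact hz' y ((hu.good.isEntry y).1 ⟨0, 0, val_eq_coe_iff.1 hy⟩)
        | succ r => exact hp r hr
  · intro z₁ l₁ h
    cases h
    exact hu.colAt_min hz
  · intro a x y b hab
    cases a with
    | nil =>
      simp only [List.nil_append, List.cons.injEq] at hab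
      obtain ⟨rfl, rfl⟩ := hab
      rw [List.append_nil, hu.colAt_min hz]
      exact h4 [] y b rfl
    | cons z₁ a =>
      simp only [List.cons_append, List.cons.injEq] at hab
      obtain ⟨rfl, rfl⟩ := hab
      have e : u ++ z :: (a ++ x :: y :: b) = (u ++ z :: a) ++ x :: (y :: b) := by simp
      rw [e] at h3
      rw [rsk_snoc]
      refine colAt_lt_colAt h3.of_append.young h3.fresh (h4 a x (y :: b) rfl) ?_
      rw [List.isChain_iff_forall_rel_of_append_cons_cons] at hc
      exact @hc x y (z :: a) b (by simp)

theorem StripOK.length_le {u row : List ℕ} (h : StripOK u row) {a b : List ℕ} {x : ℕ}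
    (hab : row = a ++ x :: b) : a.length ≤ colAt (rsk (u ++ a)).1 x := by
  induction a using List.reverseRecOn generalizing x b with
  | nil => exact Nat.zero_le _
  | append_singleton a y ih =>
    have h1 := ih (b := x :: b) (x := y) (by rw [hab]; simp)
    have h2 := h.2 a y x b (by rw [hab]; simp)
    rw [List.length_append, List.length_singleton, ← List.append_assoc]
    omega

theorem Young.zero_le {T : Filling} (hT : Young T) (c r : ℕ) : val T 0 0 ≤ val T c r := by
  induction c with
  | zero =>
    rcases Nat.eq_zero_or_pos r with rfl | hr
    · exact le_rfl
    · rcases hT.1.col 0 r hr with h | h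
      · rw [h]; exact le_top
      · exact h.le
  | succ c ih => exact ih.trans (hT.le_succ c r)

/-- A descent within the row would send the next box weakly left, against the strip condition. From
the third letter on the new boxes lie right of the second column, so the peak condition can be
pulled back to the moment after the second letter, where `peakCols_of_insertEntry_second` applies.
-/
theorem StripOK.rowOK {u row : List ℕ} (h : StripOK u row) (hw : Proper (u ++ row))
    (hp : PeakCols (rsk (u ++ row)).1) (h0 : row ≠ []) (h1 : u ≠ [] → 1 < row.length) :
    RowOK u row ∧ PeakCols (rsk u).1 := by
  obtain ⟨z, l, rfl⟩ := List.exists_cons_of_ne_nil h0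
  have hu := hw.of_append
  have hz := hw.2 u z l rfl (h.1 z l rfl)
  have hc : (z :: l).IsChain (· < ·) := by
    rw [List.isChain_iff_forall_rel_of_append_cons_cons]
    intro x y a b hab
    have hlt := h.2 a x y b hab
    have e : u ++ z :: l = (u ++ a) ++ x :: y :: b := by rw [hab]; simp
    have e' : u ++ z :: l = (u ++ a ++ [x]) ++ y :: b := by rw [hab]; simp
    have hw1 := e ▸ hw
    have hw2 := e' ▸ hw
    by_contra hxy
    have hyx : y < x := lt_of_le_of_ne (not_lt.1 hxy) (by
      rintro rfl
      exact hw2.not_mem (by simp))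
    -- If `x` created a row, it is smaller than all letters before it. Then `y < x` would create a
    -- row as well and land in column 0.
    rcases Nat.eq_zero_or_pos (colAt (rsk (u ++ a)).1 x) with hx0 | hx0
    · rw [hw2.of_append.colAt_min] at hlt
      · omega
      · intro t ht
        rcases List.mem_append.1 ht with ht | ht
        · exact hyx.trans (hw1.2 _ _ _ rfl hx0 t ht)
        · rw [List.mem_singleton] at ht
          exact ht ▸ hyx
    · have hf := hw2.fresh
      rw [rsk_snoc] at hf hlt
      exact absurd hlt (not_lt.2 (colAt_le_colAt hw1.of_append.young hw1.fresh hx0 hf hyx))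
  by_cases hu0 : u = []
  · subst hu0
    exact ⟨⟨z, l, rfl, hc, hz, fun h => absurd rfl h⟩, peakCols_nil⟩
  · have hl := h1 hu0
    obtain _ | ⟨z', l'⟩ := l
    · simp at hl
    have e : u ++ z :: z' :: l' = (u ++ [z] ++ [z']) ++ l' := by simp
    have e' : u ++ z :: z' :: l' = (u ++ [z]) ++ z' :: l' := by simp
    rw [e] at hp
    have hw1 := e ▸ hw
    have hw2 := e' ▸ hw
    have hp' := peakCols_of_append hw1 (fun a x b hab => by
      have := h.length_le (a := z :: z' :: a) (x := x) (b := b) (by rw [hab]; rfl)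
      have e2 : u ++ [z] ++ [z'] ++ a = u ++ z :: z' :: a := by simp
      rw [e2]
      simp only [List.length_cons] at this
      omega) hp
    have hf := hw2.fresh
    have hy := hw2.of_append.young
    rw [rsk_snoc, hu.rsk_min hz] at hp'
    rw [hu.rsk_min hz] at hf hy
    obtain ⟨g1, g2⟩ := peakCols_of_insertEntry_second hy hf (List.isChain_cons_cons.1 hc).1 hp'
    refine ⟨⟨z, z' :: l', rfl, hc, hz, fun _ => ⟨z', l', rfl, fun y hy => ?_⟩⟩, g1⟩
    obtain ⟨c, r, hcr⟩ := (hu.good.isEntry y).2 hy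
    have := g2.trans_le (hu.young.zero_le c r)
    rwa [val_eq_coe_iff.2 hcr, coe_lt_coe'] at this

theorem rows_spec {L : List (List ℕ)} (hnd : L.flatten.Nodup)
    (h : ∀ pre row post, L = pre ++ row :: post → RowOK pre.flatten row) :
    Proper L.flatten ∧ PeakCols (rsk L.flatten).1 ∧
      ∀ pre row post, L = pre ++ row :: post → StripOK pre.flatten row := by
  induction L using List.reverseRecOn with
  | nil => exact ⟨⟨hnd, fun u x v h => by simp at h⟩, peakCols_nil, fun _ _ _ h => by simp at h⟩
  | append_singleton L row ih =>
    have e : (L ++ [row]).flatten = L.flatten ++ row := by simp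
    rw [e] at hnd ⊢
    obtain ⟨h1, h2, h3⟩ := ih hnd.of_append_left
      fun pre r post hL => h pre r (post ++ [row]) (by rw [hL]; simp)
    obtain ⟨h4, h5, h6⟩ := (h L row [] rfl).spec h1 h2 hnd
    refine ⟨h4, h5, fun pre r post hL => ?_⟩
    rcases List.eq_nil_or_concat post with rfl | ⟨post', y', rfl⟩
    · obtain ⟨rfl, g⟩ := List.append_inj' hL rfl
      have g : row = r := by simpa using g
      exact g ▸ h6
    · have g : L ++ [row] = (pre ++ r :: post') ++ [y'] := by rw [hL]; simp
      obtain ⟨rfl, -⟩ := List.append_inj' g rfl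
      exact h3 pre r post' rfl

/-- The rows are peeled off from the last one. `hl` exempts only the row that is read first, which
corresponds to the last part of the peak composition. -/
theorem rows_of_strips {L : List (List ℕ)} (hw : Proper L.flatten)
    (hp : PeakCols (rsk L.flatten).1) (h0 : [] ∉ L)
    (hl : ∀ pre row post, L = pre ++ row :: post → pre ≠ [] → 1 < row.length)
    (h : ∀ pre row post, L = pre ++ row :: post → StripOK pre.flatten row) :
    ∀ pre row post, L = pre ++ row :: post → RowOK pre.flatten row := by
  induction L using List.reverseRecOn with
  | nil => exact fun _ _ _ h => by simp at h
  | append_singleton L row ih =>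
    have e : (L ++ [row]).flatten = L.flatten ++ row := by simp
    rw [e] at hw hp
    obtain ⟨h1, h2⟩ := (h L row [] rfl).rowOK hw hp (by rintro rfl; simp at h0)
      (fun hL => hl L row [] rfl (by rintro rfl; exact hL rfl))
    intro pre r post hL
    rcases List.eq_nil_or_concat post with rfl | ⟨post', y', rfl⟩
    · obtain ⟨rfl, g⟩ := List.append_inj' hL rfl
      have g : row = r := by simpa using g
      exact g ▸ h1
    · have g : L ++ [row] = (pre ++ r :: post') ++ [y'] := by rw [hL]; simp
      obtain ⟨g, -⟩ := List.append_inj' g rfl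
      refine ih hw.of_append h2 (fun h => h0 (by simp [h])) ?_ ?_ pre r post' g
      · exact fun pre r post hL => hl pre r (post ++ [row]) (by rw [hL]; simp)
      · exact fun pre r post hL => h pre r (post ++ [row]) (by rw [hL]; simp)

theorem Recording.not_strictlyRight {m : ℕ} {Q : Filling} (h : Recording m Q) {a b r : ℕ}
    (hb : entry Q 0 r = some b) : ¬ StrictlyRight Q a b := by
  rintro ⟨c, r', c', r'', -, h2, h3⟩
  have := (h.inj _ _ _ _ _ hb h2).1
  omega

theorem Proper.entry_zero_iff {u v : List ℕ} {x : ℕ} (h : Proper (u ++ x :: v)) :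
    (∃ r, entry (rsk (u ++ x :: v)).2 0 r = some (u.length + 1)) ↔ colAt (rsk u).1 x = 0 := by
  obtain ⟨r, hr⟩ := h.entry_col
  constructor
  · rintro ⟨r', hr'⟩
    exact (h.good.recording.inj _ _ _ _ _ hr hr').1
  · intro h0
    exact ⟨r, h0 ▸ hr⟩

theorem Proper.strictlyRight_iff {u v : List ℕ} {x y : ℕ} (h : Proper (u ++ x :: y :: v)) :
    StrictlyRight (rsk (u ++ x :: y :: v)).2 (u.length + 1) (u.length + 1 + 1) ↔
      colAt (rsk u).1 x < colAt (rsk (u ++ [x])).1 y := by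
  obtain ⟨r, hr⟩ := h.entry_col
  have e : u ++ x :: y :: v = (u ++ [x]) ++ y :: v := by simp
  obtain ⟨r', hr'⟩ := (e ▸ h : Proper ((u ++ [x]) ++ y :: v)).entry_col
  rw [← e, List.length_append, List.length_singleton] at hr'
  constructor
  · rintro ⟨c, s, c', s', h1, h2, h3⟩
    rw [(h.good.recording.inj _ _ _ _ _ hr h1).1, (h.good.recording.inj _ _ _ _ _ hr' h2).1]
    exact h3
  · intro hlt
    exact ⟨_, _, _, _, hr, hr', hlt⟩

theorem exists_eq_append_of_flatten_eq {L : List (List ℕ)} {u v : List ℕ} {x : ℕ}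
    (h : L.flatten = u ++ x :: v) : ∃ pre s t post, L = pre ++ (s ++ x :: t) :: post ∧
      u = pre.flatten ++ s := by
  induction L generalizing u with
  | nil => simp at h
  | cons row L ih =>
    rw [List.flatten_cons, List.append_eq_append_iff] at h
    rcases h with ⟨a, rfl, h⟩ | ⟨a, rfl, h⟩
    · obtain ⟨pre, s, t, post, rfl, rfl⟩ := ih h
      exact ⟨row :: pre, s, t, post, rfl, by simp⟩
    · cases a with
      | nil =>
        obtain ⟨pre, s, t, post, rfl, g⟩ := ih (u := []) h.symm
        exact ⟨(u ++ []) :: pre, s, t, post, rfl, by simp [← g]⟩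
      | cons y a =>
        simp only [List.cons_append, List.cons.injEq] at h
        obtain ⟨rfl, -⟩ := h
        exact ⟨[], u, a, L, rfl, rfl⟩

/-- The `j`-th created box has the column of the entry `j` of the recording filling, so both sides
compare the columns of consecutive entries. Maximality of the strips amounts to every row of `L`
starting in the first column. -/
theorem strips_iff {L : List (List ℕ)} (hw : Proper L.flatten) (h0 : [] ∉ L) :
    (∀ pre row post, L = pre ++ row :: post → StripOK pre.flatten row) ↔
      (∀ pre row post, L = pre ++ row :: post →
        IsRowStrip (rsk L.flatten).2 (pre.flatten.length + 1) row.length) ∧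
      ∀ a j, IsRowStrip (rsk L.flatten).2 a j → ∃ r, entry (rsk L.flatten).2 0 r = some a := by
  have hR := hw.good.recording
  have hflat : ∀ pre row post, L = pre ++ row :: post → ∀ s t, row = s ++ t →
      L.flatten = (pre.flatten ++ s) ++ (t ++ post.flatten) := by
    rintro pre row post rfl s t rfl
    simp
  have hcol : ∀ pre x row post, L = pre ++ (x :: row) :: post →
      ((∃ r, entry (rsk L.flatten).2 0 r = some (pre.flatten.length + 1)) ↔
        colAt (rsk pre.flatten).1 x = 0) := by
    intro pre x row post hL
    have e := hflat pre _ post hL [] _ rfl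
    rw [List.append_nil, List.cons_append] at e
    rw [e] at hw ⊢
    exact hw.entry_zero_iff
  have hright : ∀ pre row post, L = pre ++ row :: post → ∀ a x y b, row = a ++ x :: y :: b →
      (StrictlyRight (rsk L.flatten).2 (pre.flatten.length + 1 + a.length)
        (pre.flatten.length + 1 + a.length + 1) ↔
      colAt (rsk (pre.flatten ++ a)).1 x < colAt (rsk (pre.flatten ++ a ++ [x])).1 y) := by
    intro pre row post hL a x y b hrow
    have e := hflat pre _ post hL a _ hrow
    rw [List.cons_append, List.cons_append] at e
    rw [e] at hw ⊢
    rw [← hw.strictlyRight_iff, List.length_append]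
    have e1 : pre.flatten.length + 1 + a.length = pre.flatten.length + a.length + 1 := by omega
    rw [e1]
  constructor
  · intro h
    have hstart : ∀ pre row post, L = pre ++ row :: post →
        ∃ r, entry (rsk L.flatten).2 0 r = some (pre.flatten.length + 1) := by
      intro pre row post hL
      obtain ⟨z, l, rfl⟩ := List.exists_cons_of_ne_nil (l := row) (by
        rintro rfl; exact h0 (by simp [hL]))
      exact (hcol pre z l post hL).2 ((h _ _ _ hL).1 z l rfl)
    constructor
    · intro pre row post hL
      have hrow : row ≠ [] := by rintro rfl; exact h0 (by simp [hL])
      refine ⟨List.length_pos_iff.2 hrow, ?_, ?_, ?_, ?_⟩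
      · obtain ⟨r, hr⟩ := hstart pre row post hL
        exact ⟨0, r, hr⟩
      · intro i hi
        have e : row = row.take i ++ row[i] :: row[i + 1] :: row.drop (i + 2) := by
          rw [← List.drop_eq_getElem_cons, ← List.drop_eq_getElem_cons, List.take_append_drop]
        have e1 : (row.take i).length = i := by rw [List.length_take]; omega
        have := (hright pre row post hL _ _ _ _ e).2 ((h _ _ _ hL).2 _ _ _ _ e)
        rwa [e1] at this
      · intro b hb
        have e : b + 1 = (pre ++ [row]).flatten.length + 1 := by
          simp only [List.flatten_append, List.flatten_singleton, List.length_append]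
          omega
        rw [e]
        cases post with
        | nil =>
          rintro ⟨-, -, c, r, -, h2, -⟩
          have := (hR.isEntry _).1 ⟨c, r, h2⟩
          rw [hL] at this
          omega
        | cons row' post =>
          obtain ⟨r, hr⟩ := hstart (pre ++ [row]) row' post (by rw [hL]; simp)
          exact hR.not_strictlyRight hr
      · intro b hb
        obtain ⟨r, hr⟩ := hstart pre row post hL
        exact hR.not_strictlyRight hr
    · rintro a j ⟨-, hent, -, -, hns⟩
      have ha := (hR.isEntry a).1 hent
      have hlt : a - 1 < L.flatten.length := by omega
      have e : L.flatten = L.flatten.take (a - 1) ++ L.flatten[a - 1] :: L.flatten.drop (a - 1 + 1) := by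
        rw [← List.drop_eq_getElem_cons, List.take_append_drop]
      obtain ⟨pre, s, t, post, hL, hu⟩ := exists_eq_append_of_flatten_eq e
      have hlen : a - 1 = pre.flatten.length + s.length := by
        rw [← List.length_append, ← hu, List.length_take]
        omega
      -- The letter with number `a` lies in some row of `L`, preceded there by `s`. If `s` is
      -- nonempty, the entry `a - 1` extends the strip to the left.
      rcases List.eq_nil_or_concat s with rfl | ⟨s', y, rfl⟩
      · obtain ⟨r, hr⟩ := hstart pre _ post hL
        refine ⟨r, ?_⟩
        rw [hr, List.length_nil] at *
        congr 1
        omega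
      · exfalso
        rw [List.concat_eq_append] at *
        have hrow : s' ++ [y] ++ L.flatten[a - 1] :: t = s' ++ y :: L.flatten[a - 1] :: t := by simp
        rw [List.length_append, List.length_singleton] at hlen
        have := (hright pre _ post hL _ _ _ _ hrow).2 ((h _ _ _ hL).2 _ _ _ _ hrow)
        refine hns (a - 1) (by omega) ?_
        have e1 : pre.flatten.length + 1 + s'.length = a - 1 := by omega
        have e2 : a - 1 + 1 = a := by omega
        rwa [e1, e2] at this
  · rintro ⟨h1, h2⟩ pre row post hL
    have hs := h1 pre row post hL
    constructor
    · rintro z l rfl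
      exact (hcol pre z l post hL).1 (h2 _ _ hs)
    · intro a x y b hrow
      refine (hright pre row post hL a x y b hrow).1 (hs.2.2.1 a.length ?_)
      rw [hrow]
      simp only [List.length_append, List.length_cons]
      omega

theorem hasRowStripShape_iff {n : ℕ} {γ : Composition n} {Q : Filling} {L : List (List ℕ)}
    (h : L.map List.length = γ.blocks) : HasRowStripShape γ Q ↔
      ∀ pre row post, L = pre ++ row :: post →
        IsRowStrip Q (pre.flatten.length + 1) row.length := by
  have hlen : L.length = γ.length := by
    have := congrArg List.length h
    rwa [List.length_map] at this
  constructor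
  · rintro hQ pre row post rfl
    have hi : pre.length < γ.length := by
      rw [← hlen, List.length_append, List.length_cons]
      omega
    have := hQ ⟨pre.length, hi⟩
    simpa [Composition.sizeUpTo, Composition.blocksFun, ← h] using this
  · intro hQ i
    have hi : (i : ℕ) < L.length := by rw [hlen]; exact i.2
    have e : L = L.take i ++ L[(i : ℕ)] :: L.drop (i + 1) := by
      rw [← List.drop_eq_getElem_cons, List.take_append_drop]
    have := hQ _ _ _ e
    simpa [Composition.sizeUpTo, Composition.blocksFun, ← h, List.length_flatten] using this

/-! ### The tableau conditions and the descents in terms of the reading word -/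

theorem entry_append_cons {A B : Filling} {row : List ℕ} (c : ℕ) :
    entry (A ++ row :: B) c A.length = row[c]? :=
  entry_of_row (by simp) c

theorem exists_entry_append_cons {A B : Filling} {row : List ℕ} {y : ℕ} (h : y ∈ B.flatten) :
    ∃ c r, A.length < r ∧ entry (A ++ row :: B) c r = some y := by
  obtain ⟨c, r, h⟩ := isEntry_iff_mem_flatten.2 h
  refine ⟨c, A.length + 1 + r, by omega, ?_⟩
  obtain ⟨l, h1, h2⟩ := entry_eq_some_iff.1 h
  rw [entry_of_row (row := l), h2]
  rw [List.getElem?_append_right (by omega)]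
  have : A.length + 1 + r - A.length = r + 1 := by omega
  rw [this]
  exact h1

theorem mem_of_entry_append_cons {A B : Filling} {row : List ℕ} {y c r : ℕ} (hr : A.length < r)
    (h : entry (A ++ row :: B) c r = some y) : y ∈ B.flatten := by
  obtain ⟨l, h1, h2⟩ := entry_eq_some_iff.1 h
  rw [List.getElem?_append_right (by omega)] at h1
  obtain ⟨d, hd⟩ := Nat.exists_eq_add_of_lt hr
  have : r - A.length = d + 1 := by omega
  rw [this, List.getElem?_cons_succ] at h1
  exact List.mem_flatten.2 ⟨l, List.mem_of_getElem? h1, List.mem_of_getElem? h2⟩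

/-- The rows of `T`, from top to bottom, satisfy `RowOK`. -/
def RowsOK (T : Filling) : Prop :=
  ∀ pre row post, T.reverse = pre ++ row :: post → RowOK pre.flatten row

theorem rowsOK_iff {T : Filling} : RowsOK T ↔
    ∀ A row B, T = A ++ row :: B → RowOK B.reverse.flatten row := by
  constructor
  · rintro h A row B rfl
    exact h B.reverse row A.reverse (by simp)
  · intro h pre row post hT
    have := h post.reverse row pre.reverse (by
      rw [← List.reverse_reverse T, hT]; simp)
    rwa [List.reverse_reverse] at this

theorem mem_flatten_reverse {B : Filling} {y : ℕ} : y ∈ B.reverse.flatten ↔ y ∈ B.flatten := by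
  simp only [List.mem_flatten, List.mem_reverse]

theorem exists_split {T : Filling} {c r x : ℕ} (h : entry T c r = some x) :
    ∃ A s t B, T = A ++ (s ++ x :: t) :: B ∧ A.length = r ∧ s.length = c := by
  obtain ⟨row, h1, h2⟩ := entry_eq_some_iff.1 h
  obtain ⟨g1, rfl⟩ := List.getElem?_eq_some_iff.1 h1
  obtain ⟨g2, rfl⟩ := List.getElem?_eq_some_iff.1 h2
  refine ⟨T.take r, T[r].take c, T[r].drop (c + 1), T.drop (r + 1), ?_, ?_, ?_⟩
  · rw [← List.drop_eq_getElem_cons, List.take_append_drop, ← List.drop_eq_getElem_cons,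
      List.take_append_drop]
  · rw [List.length_take]; omega
  · rw [List.length_take]; omega

/-- As rows increase to the right and the first column upwards, the smallest entry above a given row
is the first entry of the next row. Hence the comparison with all letters read before reduces to
that one entry. -/
theorem rowsOK_iff_conditions {T : Filling} : [] ∉ T ∧ RowsIncrease T ∧ FirstColIncreasesUp T ∧
    PeakCols T ↔ RowsOK T := by
  rw [rowsOK_iff]
  constructor
  · rintro ⟨h0, h1, h2, h3⟩ A row B rfl
    obtain ⟨z, l, rfl⟩ := List.exists_cons_of_ne_nil (l := row) (by
      rintro rfl; exact h0 (by simp))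
    have hfirst : ∀ c r y, entry (A ++ (z :: l) :: B) c r = some y →
        ∃ y', entry (A ++ (z :: l) :: B) 0 r = some y' ∧ y' ≤ y := by
      intro c r y h
      rcases Nat.eq_zero_or_pos c with rfl | hc
      · exact ⟨y, h, le_rfl⟩
      · cases hy' : entry (A ++ (z :: l) :: B) 0 r with
        | none => rw [entry_none_of_le hy' c.zero_le] at h; cases h
        | some y' => exact ⟨y', rfl, (h1 _ _ _ _ _ hc hy' h).le⟩
    have hz : entry (A ++ (z :: l) :: B) 0 A.length = some z := entry_append_cons 0
    refine ⟨z, l, rfl, ?_, ?_, ?_⟩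
    · rw [List.isChain_iff_forall_rel_of_append_cons_cons]
      intro x y a b hab
      refine h1 a.length (a.length + 1) A.length x y (Nat.lt_succ_self _) ?_ ?_
      · rw [entry_append_cons, hab]; simp
      · rw [entry_append_cons, hab]; simp
    · intro y hy
      obtain ⟨c, r, hr, hy⟩ := exists_entry_append_cons (A := A) (row := z :: l)
        (mem_flatten_reverse.1 hy)
      obtain ⟨y', hy', hle⟩ := hfirst _ _ _ hy
      exact (h2 _ _ _ _ hr hz hy').trans_le hle
    · intro hB
      have hB' : B ≠ [] := by rintro rfl; exact hB rfl
      have h4 := h3 A.length ((val_zero_ne_top_iff h0).2 (by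
        rw [List.length_append, List.length_cons]
        have := List.length_pos_iff.2 hB'
        omega))
      obtain ⟨x, hx⟩ := WithTop.ne_top_iff_exists.1 (h4.trans_le le_top).ne
      have hx' := val_eq_coe_iff.1 hx.symm
      rw [entry_append_cons] at hx'
      obtain _ | ⟨z', l'⟩ := l
      · simp at hx'
      have hx' : z' = x := by simpa using hx'
      subst hx'
      refine ⟨z', l', rfl, fun y hy => ?_⟩
      obtain ⟨c, r, hr, hy⟩ := exists_entry_append_cons (A := A) (row := z :: z' :: l')
        (mem_flatten_reverse.1 hy)
      obtain ⟨y', hy', hle⟩ := hfirst _ _ _ hy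
      refine lt_of_lt_of_le ?_ hle
      rw [← coe_lt_coe']
      rw [← hx] at h4
      refine h4.trans_le ?_
      rcases Nat.eq_or_lt_of_le hr with h | h
      · rw [← val_eq_coe_iff.2 hy', ← h]
      · cases hq : entry (A ++ (z :: z' :: l') :: B) 0 (A.length + 1) with
        | none => rw [entry_zero_none_of_le h0 hq hr] at hy'; cases hy'
        | some q =>
          rw [val_eq_coe_iff.2 hq]
          exact (coe_lt_coe'.2 (h2 _ _ _ _ h hq hy')).le
  · intro h
    have h0 : [] ∉ T := by
      intro hT
      obtain ⟨A, B, rfl⟩ := List.append_of_mem hT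
      obtain ⟨z, l, hzl, -⟩ := h A [] B rfl
      cases hzl
    refine ⟨h0, ?_, ?_, ?_⟩
    · intro c c' r x y hc hx hy
      obtain ⟨A, s, t, B, rfl, rfl, rfl⟩ := exists_split hx
      obtain ⟨z, l, hzl, hch, -⟩ := h A _ B rfl
      rw [entry_append_cons] at hx hy
      rw [← hzl, List.isChain_iff_pairwise, List.pairwise_iff_getElem] at hch
      obtain ⟨g1, g2⟩ := List.getElem?_eq_some_iff.1 hx
      obtain ⟨g3, g4⟩ := List.getElem?_eq_some_iff.1 hy
      rw [← g2, ← g4]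
      exact hch _ _ g1 g3 hc
    · intro r r' x y hr hx hy
      obtain ⟨A, s, t, B, rfl, rfl, hs⟩ := exists_split hx
      obtain ⟨z, l, hzl, -, hz, -⟩ := h A _ B rfl
      have hy' := mem_of_entry_append_cons hr hy
      rw [entry_append_cons, hzl] at hx
      have hx : z = x := by simpa using hx
      exact hx ▸ hz y (mem_flatten_reverse.2 hy')
    · intro r hr
      obtain ⟨y, hy⟩ := WithTop.ne_top_iff_exists.1 hr
      have hy' := val_eq_coe_iff.1 hy.symm
      have hlt : r < T.length := lt_trans (Nat.lt_succ_self r) ((val_zero_ne_top_iff h0).1 hr)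
      obtain ⟨x, hx⟩ := WithTop.ne_top_iff_exists.1 ((val_zero_ne_top_iff h0).2 hlt)
      obtain ⟨A, s, t, B, rfl, rfl, hs⟩ := exists_split (val_eq_coe_iff.1 hx.symm)
      obtain ⟨z, l, hzl, -, -, hz⟩ := h A _ B rfl
      have hyB := mem_flatten_reverse.2 (mem_of_entry_append_cons (Nat.lt_succ_self _) hy')
      obtain ⟨z', l', rfl, hz'⟩ := hz (List.ne_nil_of_mem hyB)
      have : val (A ++ (s ++ x :: t) :: B) 1 A.length = (z' : WithTop ℕ) := by
        rw [val_eq_coe_iff, entry_append_cons, hzl]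
        rfl
      rw [this, ← hy]
      exact coe_lt_coe'.2 (hz' y hyB)

theorem exists_readingWord_eq {T : Filling} {c r c' r' x y : ℕ} (hx : entry T c r = some x)
    (hy : entry T c' r' = some y) (h : r' < r ∨ r' = r ∧ c < c') :
    ∃ u v, readingWord T = u ++ y :: v ∧ x ∈ u := by
  obtain ⟨A, s, t, B, rfl, rfl, rfl⟩ := exists_split hy
  refine ⟨B.reverse.flatten ++ s, t ++ A.reverse.flatten, by simp [readingWord], ?_⟩
  rcases h with h | ⟨rfl, h⟩
  · exact List.mem_append_left _ (mem_flatten_reverse.2 (mem_of_entry_append_cons h hx))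
  · rw [entry_append_cons, List.getElem?_append_left h] at hx
    exact List.mem_append_right _ (List.mem_of_getElem? hx)

theorem mem_readingWord {T : Filling} {x : ℕ} : x ∈ readingWord T ↔ IsEntry T x := by
  rw [isEntry_iff_mem_flatten, readingWord, mem_flatten_reverse]

/-- Since rows increase, `i + 1` is strictly above `i` exactly when it precedes `i` in the reading
word. This order decides their relative position in the insertion tableau, by `Proper.weaklyLeft`
and `Proper.rightOf`. -/
theorem desUp_eq_desLeft {T : Filling} (hr : RowsIncrease T) (h : Proper (readingWord T)) :
    desUp T = desLeft (rsk (readingWord T)).1 := by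
  have hent : ∀ x, IsEntry (rsk (readingWord T)).1 x ↔ IsEntry T x := fun x => by
    rw [h.good.isEntry, mem_readingWord]
  ext i
  constructor
  · rintro ⟨c, r, c', r', h1, h2, h3⟩
    obtain ⟨u, v, huv, hmem⟩ := exists_readingWord_eq h2 h1 (Or.inl h3)
    obtain ⟨d, s, g1⟩ := (hent i).2 ⟨c, r, h1⟩
    obtain ⟨d', s', g2⟩ := (hent (i + 1)).2 ⟨c', r', h2⟩
    exact ⟨d, s, d', s', g1, g2, h.weaklyLeft huv hmem d s d' s' g1 g2⟩
  · rintro ⟨d, s, d', s', g1, g2, g3⟩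
    obtain ⟨c, r, h1⟩ := (hent i).1 ⟨d, s, g1⟩
    obtain ⟨c', r', h2⟩ := (hent (i + 1)).1 ⟨d', s', g2⟩
    refine ⟨c, r, c', r', h1, h2, ?_⟩
    by_contra hlt
    have hpos : r' < r ∨ r' = r ∧ c < c' := by
      rcases Nat.lt_or_ge r' r with h | h
      · exact Or.inl h
      · obtain rfl : r' = r := by omega
        refine Or.inr ⟨rfl, ?_⟩
        by_contra hc
        rcases Nat.lt_or_ge c' c with hc' | hc'
        · have := hr _ _ _ _ _ hc' h2 h1
          omega
        · obtain rfl : c = c' := by omega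
          rw [h1] at h2
          have := Option.some.inj h2
          omega
    obtain ⟨u, v, huv, hmem⟩ := exists_readingWord_eq h1 h2 hpos
    have := h.rightOf huv hmem d s d' s' g1 g2
    omega

/-! ### The bijection -/

theorem readingWord_injOn {T T' : Filling} (h : readingWord T = readingWord T')
    (hl : T.map List.length = T'.map List.length) : T = T' := by
  apply List.reverse_injective
  rw [List.eq_iff_flatten_eq]
  refine ⟨h, ?_⟩
  rw [List.map_reverse, List.map_reverse, hl]

theorem readingWord_perm (T : Filling) : (readingWord T).Perm T.flatten :=
  (List.reverse_perm T).flatten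

/-- What reading insertion does to a standard peak composition tableau. -/
theorem spec_of_mem_SPCT {n : ℕ} {α : Composition n} {T : Filling} (h : T ∈ SPCT α) :
    Proper (readingWord T) ∧ PeakCols (rsk (readingWord T)).1 ∧
      ∀ pre row post, T.reverse = pre ++ row :: post → StripOK pre.flatten row := by
  obtain ⟨h1, h2, h3⟩ := mem_SPCT_iff.1 h
  have h0 := not_nil_mem_of_blocks h1
  exact rows_spec (((readingWord_perm T).trans h2).nodup_iff.2 List.nodup_range')
    (rowsOK_iff_conditions.1 ⟨h0, h3⟩)

theorem map_length_reverse {n : ℕ} {α : Composition n} {T : Filling}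
    (h : T.map List.length = α.blocks) : T.reverse.map List.length = α.reverse.blocks := by
  rw [List.map_reverse, h]
  rfl

theorem rsk_mem_tableauPairs {n : ℕ} {α : Composition n} {T : Filling} (h : T ∈ SPCT α) :
    rsk (readingWord T) ∈ tableauPairs α.reverse := by
  obtain ⟨h1, h2, -⟩ := mem_SPCT_iff.1 h
  have h0 := not_nil_mem_of_blocks h1
  obtain ⟨hw, hp, hs⟩ := spec_of_mem_SPCT h
  have hg := hw.good
  have hperm := (readingWord_perm T).trans h2
  have hlen : (readingWord T).length = n := by simpa using hperm.length_eq
  have hent : ∀ x, IsEntry (rsk (readingWord T)).1 x ↔ 1 ≤ x ∧ x ≤ n := fun x => by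
    rw [hg.isEntry]
    exact (perm_range_iff.1 hperm).2 x
  have hy := young_iff.1 hg.young
  obtain ⟨β, hβ⟩ := exists_composition hy.1 hy.2.1 hent
  obtain ⟨h5, h6⟩ := (strips_iff hw (by simpa using h0)).1 hs
  exact ⟨β, isPeakComposition_of_peakCols hβ hp, mem_SPYCT_iff.2 ⟨hβ, hent, hg.young, hp⟩,
    mem_DIRT_iff.2 ⟨hg.shape ▸ hβ, hlen ▸ hg.recording, h6⟩,
    (hasRowStripShape_iff (map_length_reverse h1)).2 h5⟩

/-- The pair comes from a unique proper word; cutting it into pieces of the lengths prescribed by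
the row strips gives the rows of the tableau from top to bottom. -/
theorem exists_mem_SPCT {n : ℕ} {α : Composition n} (hα : IsPeakComposition α)
    {PQ : Filling × Filling} (h : PQ ∈ tableauPairs α.reverse) :
    ∃ T ∈ SPCT α, rsk (readingWord T) = PQ := by
  obtain ⟨P, Q⟩ := PQ
  obtain ⟨β, -, hP, hQ, hγ⟩ := h
  obtain ⟨h1, h2, h3, h4⟩ := mem_SPYCT_iff.1 hP
  obtain ⟨h5, h6, h7⟩ := mem_DIRT_iff.1 hQ
  obtain ⟨w, hw, hlen, hPQ⟩ := exists_proper n P Q h3 (h1.trans h5.symm) h6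
  subst hlen
  set L := w.splitWrtComposition α.reverse with hL
  have hLw : L.flatten = w := List.flatten_splitWrtComposition w _
  have hLl : L.map List.length = α.reverse.blocks := List.map_length_splitWrtComposition w _
  have hL0 : [] ∉ L := not_nil_mem_of_blocks hLl
  have hLr : L.reverse.map List.length = α.blocks := by
    rw [List.map_reverse, hLl]
    exact List.reverse_reverse _
  have hread : readingWord L.reverse = w := by rw [readingWord, List.reverse_reverse, hLw]
  -- The rows of `L` have the lengths of `α` in reverse order, so a row that is not first in `L`
  -- belongs to a part of `α` other than the last.
  have hpeak : ∀ pre row post, L = pre ++ row :: post → pre ≠ [] → 1 < row.length := by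
    intro pre row post h hpre
    apply hα
    rw [← hLr, h]
    obtain ⟨p, pre', rfl⟩ := List.exists_cons_of_ne_nil hpre
    have e : ((p :: pre') ++ row :: post).reverse =
        (post.reverse ++ row :: pre'.reverse) ++ [p] := by simp
    rw [e, List.map_append, List.map_singleton, List.dropLast_concat]
    simp
  have hstrip := (strips_iff (hLw.symm ▸ hw) hL0).2 (by
    rw [hLw, hPQ]
    exact ⟨(hasRowStripShape_iff hLl).1 hγ, h7⟩)
  have hrows := rows_of_strips (hLw.symm ▸ hw) (by rw [hLw, hPQ]; exact h4) hL0 hpeak hstrip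
  have hcond := rowsOK_iff_conditions.2
    (fun pre row post h => hrows pre row post (by rwa [List.reverse_reverse] at h) : RowsOK L.reverse)
  refine ⟨L.reverse, mem_SPCT_iff.2 ⟨hLr, ?_, hcond.2⟩, by rw [hread, hPQ]⟩
  refine (readingWord_perm _).symm.trans ?_
  rw [hread, perm_range_iff]
  refine ⟨hw.1, fun x => ?_⟩
  rw [← h2, ← hw.good.isEntry, hPQ]

end PeakTableaux

theorem mainTheorem3 (n : ℕ) (α : Composition n) (hα : PeakTableaux.IsPeakComposition α) :
    Set.BijOn PeakTableaux.readingInsertion (PeakTableaux.SPCT α)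
        (PeakTableaux.tableauPairs α.reverse) ∧
      ∀ T ∈ PeakTableaux.SPCT α,
        PeakTableaux.peakUp T = PeakTableaux.peakLeft (PeakTableaux.readingInsertion T).1 := by
  refine ⟨⟨?_, ?_, ?_⟩, ?_⟩
  · intro T hT
    -- By definition `readingInsertion T` is `rsk (readingWord T)`.
    exact PeakTableaux.rsk_mem_tableauPairs hT
  · intro T hT T' hT' h
    refine PeakTableaux.readingWord_injOn (PeakTableaux.rsk_injective
      (PeakTableaux.spec_of_mem_SPCT hT).1 (PeakTableaux.spec_of_mem_SPCT hT').1 h) ?_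
    exact (PeakTableaux.mem_SPCT_iff.1 hT).1.trans (PeakTableaux.mem_SPCT_iff.1 hT').1.symm
  · intro PQ hPQ
    obtain ⟨T, hT, h⟩ := PeakTableaux.exists_mem_SPCT hα hPQ
    exact ⟨T, hT, h⟩
  · intro T hT
    rw [PeakTableaux.peakUp, PeakTableaux.peakLeft, PeakTableaux.desUp_eq_desLeft
      (PeakTableaux.mem_SPCT_iff.1 hT).2.2.1 (PeakTableaux.spec_of_mem_SPCT hT).1]
    rfl
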